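/- **Setting.** Let $G$ be a compact second-countable Hausdorff group (for instance a compact Lie group or a finite group) with normalized Haar measure. Consider a finite oriented graph with edge set $E$ (multiple edges and self-loops are allowed), a set $\mathcal B$ of global boundary vertices, and a region $\Sigma$ (a set of edges together with a set of vertices) whose vertices split disjointly into interior vertices and corner vertices, none of them in $\mathcal B$; both ends of an edge of $\Sigma$ are vertices of $\Sigma$, and every edge at an interior vertex belongs to $\Sigma$. The corner $\partial\Sigma$ is the subgraph formed by the corner vertices and a given set of edges of $\Sigma$ joining corner vertices. The kinematical Hilbert space is $\mathcal H_{\rm kin}=L^2(G^E)=\bigotimes_{e\in E}L^2(G)$. A gauge transformation $h$ acts on link variables by $c_e\mapsto h_{{\rm tgt}(e)}\,c_e\,h_{{\rm src}(e)}^{-1}$, with $h=1$ on $\mathcal B$; $\mathcal H^{\rm phys}$ is the space of invariant vectors. For a set $S$ of edges, $\mathcal H_S^{\rm phys}\subseteq L^2(G^S)$ is the space of vectors invariant under all gauge transformations that are trivial on $\mathcal B$ and on the corner vertices; for the edges of $\Sigma$ it is written $\mathcal H_\Sigma^{\rm phys}$. Given Wilson lines $\varphi_v$ (holonomies along paths ending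 at the corner vertices $v$) and an orientation $g$, dressing a configuration means applying to it the configuration-dependent gauge transformation that brings all $\varphi_v$ to the value $g_v$. The reduction $\mathcal R$ to the perspective of the frame assigns to $\psi\in\mathcal H^{\rm phys}$ the wave function $\chi$ of the link variables not replaced by the frame, whose value at the dressed configuration is the value of $\psi$. *Extrinsic frames.* An extrinsic frame $\Phi$ consists, for each corner vertex $v$, of a Wilson line along a path without repeated vertices and without edges of $\Sigma$, from $\mathcal B$ to $v$; lines to distinct corner vertices have no common edge. The frame variables replace the last link of every line. The extrinsic relational algebra is $\mathcal A^{\rm phys}_{\Sigma|\Phi}=\mathcal R^\dagger\big(B(\mathcal H_\Sigma^{\rm phys})\otimes 1\big)\mathcal R\cong B(\mathcal H^{\rm phys}_\Sigma)$. The reorientation by $h\in G^{\partial\Sigma}$ (one group element for each corner vertex) is the unitary $V(h)$ that translates the first link of each line so that $\varphi_v\mapsto\varphi_vh_v^{-1}$, and the electric corner twirl is $\mathbb G_{\partial\Sigma}(T)=\int_{G^{\partial\Sigma}}V(h)\,T\,V(h)^\dagger\,dh$ (weak integral). The electric center $\mathcal A_E$ is the algebra of operators on $\mathcal H^{\rm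 phys}$ of the form $A\otimes 1$, with $A\in B(\mathcal H^{\rm phys}_\Sigma)$ commuting with the gauge transformations supported on the corner vertices. *Intrinsic frames.* An intrinsic frame $\tilde\Phi$ consists of a spanning tree of $\partial\Sigma$, a root, and the Wilson lines along the tree from the root to the corner vertices. Its orientations are $g\in G^{\partial\Sigma}$ with $g_{\rm root}=1$; the isotropy group of $g$ consists of the corner gauge transformations $(g_vhg_v^{-1})_v$, $h\in G$. The frame variables replace the tree edges; let $S$ be the set of the edges of $\Sigma$ outside the tree. The intrinsic relational algebra $\mathcal A^{\rm phys}_{\Sigma\setminus\tilde\Phi|\tilde\Phi}$ consists of the operators $\mathcal R^\dagger(A\otimes1)\mathcal R$ with $A\in B(\mathcal H^{\rm phys}_S)$ commuting with the isotropy group. The magnetic center $\mathcal A_M$ is the intersection of all intrinsic relational algebras. For finite Abelian $G$, let $C$ be the set of edges of $\partial\Sigma$ outside the tree; each $e\in C$ closes a corner loop with holonomy $\ell_e$. For a family $\chi=(\chi_e)_{e\in C}$ of characters of $G$ let $\hat U^\chi$ be multiplication by $\prod_{e\in C}\chi_e(\ell_e)$. The dual magnetic twirl is $\hat G_{\partial\Sigma}(T)=|G|^{-|C|}\sum_\chi\hat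 U^\chi\,T\,(\hat U^\chi)^\dagger$. A *state* in a relational algebra is an operator on $\mathcal H^{\rm phys}$ represented there by a density operator $A$ (positive, trace one) on $\mathcal H^{\rm phys}_\Sigma$, respectively $\mathcal H^{\rm phys}_S$. Its entropy is $S_{\rm vN}=\operatorname{Tr}(-A\log A)\in[0,\infty]$. **Corollary (relational entanglement entropy hierarchy).** 1. For every extrinsic frame $\Phi$ with any orientation and every state $\rho$ in $\mathcal A^{\rm phys}_{\Sigma|\Phi}$, the twirled operator $\mathbb G_{\partial\Sigma}(\rho)$ exists, lies in $\mathcal A_E$, is again a state in $\mathcal A^{\rm phys}_{\Sigma|\Phi}$, and $S_{\rm vN}(\rho)\le S_{\rm vN}\big(\mathbb G_{\partial\Sigma}(\rho)\big)$. 2. Let $G$ be finite and Abelian. For every intrinsic frame $\tilde\Phi$ with any orientation and every state $\rho$ in $\mathcal A^{\rm phys}_{\Sigma\setminus\tilde\Phi|\tilde\Phi}$, the twirled operator $\hat G_{\partial\Sigma}(\rho)$ lies in $\mathcal A_M$, is again a state in $\mathcal A^{\rm phys}_{\Sigma\setminus\tilde\Phi|\tilde\Phi}$, and $S_{\rm vN}(\rho)\le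 S_{\rm vN}\big(\hat G_{\partial\Sigma}(\rho)\big)$. -/

import Mathlib

open MeasureTheory
open scoped ENNReal InnerProductSpace ComplexConjugate

noncomputable section

/-! ### Von Neumann entropy of density operators on a complex Hilbert space -/

namespace QEntropy

variable {H : Type*} [NormedAddCommGroup H] [InnerProductSpace ℂ H] [CompleteSpace H]

/-- The trace, in `[0, ∞]`, of a positive operator: the sum of its diagonal entries in an
orthonormal basis (the value does not depend on the basis). -/
def posTrace (A : H →L[ℂ] H) : ℝ≥0∞ :=
  ∑' e : (exists_hilbertBasis ℂ H).choose,
    ENNReal.ofReal (RCLike.re ⟪(e : H), A (e : H)⟫_ℂ)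

/-- Density operators: positive operators of trace one. -/
def IsDensity (A : H →L[ℂ] H) : Prop :=
  A.IsPositive ∧ posTrace A = 1

/-- The von Neumann entropy `Tr (-A log A)`, in `[0, ∞]`, of a density operator `A`;
`-A log A` is given by the continuous functional calculus for `x ↦ -x log x`. -/
def vonNeumannEntropy (A : H →L[ℂ] H) : ℝ≥0∞ :=
  posTrace (cfc Real.negMulLog A)

end QEntropy

/-! ### Wave functions on spaces of lattice configurations -/

namespace LGT

section HilbertSpaces

variable (G : Type*) [Group G] [TopologicalSpace G] [IsTopologicalGroup G] [CompactSpace G]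
  [MeasurableSpace G] [BorelSpace G]

/-- The normalized Haar measure of the compact group `G`. -/
def haarProb : Measure G := Measure.haarMeasure ⊤

instance : IsProbabilityMeasure (haarProb G) :=
  ⟨by simpa [haarProb] using Measure.haarMeasure_self (K₀ := (⊤ : TopologicalSpace.PositiveCompacts G))⟩

instance : (haarProb G).IsHaarMeasure := by
  unfold haarProb; infer_instance

/-- The product of the normalized Haar measures on `G^κ`. -/
abbrev configMeasure (κ : Type*) [Fintype κ] : Measure (κ → G) :=
  Measure.pi fun _ => haarProb G

/-- The Hilbert space `⨂_{k ∈ κ} L²(G) = L²(G^κ)`. -/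
abbrev L2 (κ : Type*) [Fintype κ] : Type _ := Lp ℂ 2 (configMeasure G κ)

variable {G}

theorem haarProb_map_mul_right [SecondCountableTopology G] (b : G) :
    MeasurePreserving (fun x : G => x * b) (haarProb G) (haarProb G) := by
  refine ⟨measurable_mul_const b, ?_⟩
  have : IsProbabilityMeasure (Measure.map (fun x : G => x * b) (haarProb G)) :=
    Measure.isProbabilityMeasure_map (measurable_mul_const b).aemeasurable
  exact Measure.isHaarMeasure_eq_of_isProbabilityMeasure _ _

theorem shift_measurePreserving [SecondCountableTopology G]
    {κ : Type*} [Fintype κ] (a b : κ → G) :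
    MeasurePreserving (fun (c : κ → G) (k : κ) => (a k)⁻¹ * c k * b k)
      (configMeasure G κ) (configMeasure G κ) :=
  measurePreserving_pi (fun _ => haarProb G) (fun _ => haarProb G)
    fun k => (haarProb_map_mul_right (b k)).comp (measurePreserving_mul_left (haarProb G) (a k)⁻¹)

/-- The unitary `⨂ₖ U(aₖ) V(bₖ)` on `⨂ₖ L²(G)`, where `U` and `V` are left and right
multiplication, `U(a) V(b) |g⟩ = |a g b⁻¹⟩`. -/
def shift [SecondCountableTopology G] {κ : Type*} [Fintype κ] (a b : κ → G) :
    L2 G κ →ₗᵢ[ℂ] L2 G κ :=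
  Lp.compMeasurePreservingₗᵢ ℂ (fun (c : κ → G) (k : κ) => (a k)⁻¹ * c k * b k)
    (shift_measurePreserving a b)

theorem eLpNorm_phase_mul {κ : Type*} [Fintype κ] (m : C(κ → G, Circle)) (ψ : L2 G κ) :
    eLpNorm (fun c => (m c : ℂ) * ψ c) 2 (configMeasure G κ) =
      eLpNorm ψ 2 (configMeasure G κ) := by
  refine eLpNorm_congr_norm_ae (ae_of_all _ fun c => ?_)
  change ‖(m c : ℂ) * ψ c‖ = ‖ψ c‖
  rw [norm_mul, Circle.norm_coe, one_mul]

theorem memLp_phase_mul [SecondCountableTopology G] {κ : Type*} [Fintype κ]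
    (m : C(κ → G, Circle)) (ψ : L2 G κ) :
    MemLp (fun c => (m c : ℂ) * ψ c) 2 (configMeasure G κ) := by
  have hm : Continuous fun c => (m c : ℂ) := by fun_prop
  refine ⟨hm.aestronglyMeasurable.mul (Lp.memLp ψ).aestronglyMeasurable, ?_⟩
  rw [eLpNorm_phase_mul]
  exact Lp.eLpNorm_lt_top ψ

/-- Multiplication of wave functions by a continuous function of modulus one. -/
def phaseMul [SecondCountableTopology G] {κ : Type*} [Fintype κ] (m : C(κ → G, Circle)) :
    L2 G κ →ₗᵢ[ℂ] L2 G κ where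
  toFun ψ := (memLp_phase_mul m ψ).toLp _
  map_add' ψ φ := by
    rw [← MemLp.toLp_add]
    refine MemLp.toLp_congr _ _ ?_
    filter_upwards [Lp.coeFn_add ψ φ] with c hc
    rw [hc, Pi.add_apply, Pi.add_apply, mul_add]
  map_smul' z ψ := by
    rw [RingHom.id_apply, ← MemLp.toLp_const_smul]
    refine MemLp.toLp_congr _ _ ?_
    filter_upwards [Lp.coeFn_smul z ψ] with c hc
    simp only [hc, Pi.smul_apply, smul_eq_mul]
    ring
  norm_map' ψ := by
    change ‖(memLp_phase_mul m ψ).toLp _‖ = ‖ψ‖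
    rw [Lp.norm_toLp, Lp.norm_def, eLpNorm_phase_mul]

/-- `χ' = (A ⊗ 1) χ`, for an operator `A` on a Hilbert space `K ⊆ L²(G^κ)` of wave functions of
the variables `κ`, acting on wave functions of all the variables `ι` (the disjoint union of `κ`
and `μ`). It is tested against all product vectors `f ⊗ k`:
`⟨f ⊗ k, χ'⟩ = ⟨A† f ⊗ k, χ⟩`. -/
def ActsAs {ι κ μ : Type*} [Fintype ι] [Fintype κ] [Fintype μ] (i : κ → ι) (j : μ → ι)
    (K : Submodule ℂ (L2 G κ)) [CompleteSpace K] (A : K →L[ℂ] K) (χ χ' : L2 G ι) : Prop :=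
  ∀ (f : K) (k : L2 G μ),
    ∫ c : ι → G, conj ((f : L2 G κ) (c ∘ i) * k (c ∘ j)) * χ' c ∂(configMeasure G ι) =
    ∫ c : ι → G, conj ((ContinuousLinearMap.adjoint A f : L2 G κ) (c ∘ i) * k (c ∘ j)) * χ c
      ∂(configMeasure G ι)

end HilbertSpaces

/-! ### The lattice and the region -/

/-- A finite oriented lattice with vertices `V` and edges `E`, with a global boundary `bdry`, and
with a region `Σ` away from `bdry`. The region consists of the edges `region` and of the vertices
`interior ∪ corner`; its boundary `∂Σ` is the subgraph of `Σ` with vertices `corner` and edges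
`cornerEdges`. The region meets the rest of the lattice in vertices of `∂Σ` only. -/
structure Lattice (V E : Type*) where
  src : E → V
  tgt : E → V
  bdry : Finset V
  interior : Finset V
  corner : Finset V
  region : Finset E
  cornerEdges : Finset E
  interior_disjoint_corner : Disjoint interior corner
  interior_disjoint_bdry : Disjoint interior bdry
  corner_disjoint_bdry : Disjoint corner bdry
  region_ends : ∀ e ∈ region,
    (src e ∈ interior ∨ src e ∈ corner) ∧ (tgt e ∈ interior ∨ tgt e ∈ corner)
  mem_region_of_interior : ∀ e, src e ∈ interior ∨ tgt e ∈ interior → e ∈ region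
  cornerEdges_subset : cornerEdges ⊆ region
  cornerEdges_ends : ∀ e ∈ cornerEdges, src e ∈ corner ∧ tgt e ∈ corner

namespace Lattice

variable {V E : Type*} (Λ : Lattice V E)

/-- A step of a path: an edge, run through along (`true`) or against (`false`) its orientation. -/
abbrev Step (E : Type*) := E × Bool

def stepSrc (s : Step E) : V := if s.2 then Λ.src s.1 else Λ.tgt s.1

def stepTgt (s : Step E) : V := if s.2 then Λ.tgt s.1 else Λ.src s.1

/-- The list `l` of steps is a walk from `v` to `w`. -/
def IsWalk : V → List (Step E) → V → Prop
  | v, [], w => v = w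
  | v, s :: l, w => Λ.stepSrc s = v ∧ IsWalk (Λ.stepTgt s) l w

/-- The list `l` of steps is a path from `v` to `w`: a walk without repeated vertices. -/
def IsPath (v : V) (l : List (Step E)) (w : V) : Prop :=
  Λ.IsWalk v l w ∧ (v :: l.map Λ.stepTgt).Nodup

/-- An extrinsic edge mode frame `Φ`: for every `v ∈ ∂Σ` a Wilson line, outside of `Σ`, from an
anchor in the global boundary to `v`; Wilson lines to distinct vertices share no edges. -/
structure ExtrinsicFrame where
  anchor : V → V
  line : V → List (Step E)
  anchor_mem : ∀ v ∈ Λ.corner, anchor v ∈ Λ.bdry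
  isPath : ∀ v ∈ Λ.corner, Λ.IsPath (anchor v) (line v) v
  exterior : ∀ v ∈ Λ.corner, ∀ s ∈ line v, s.1 ∉ Λ.region
  edge_disjoint : ∀ v ∈ Λ.corner, ∀ w ∈ Λ.corner, v ≠ w →
    ∀ s ∈ line v, ∀ t ∈ line w, s.1 ≠ t.1

/-- An intrinsic edge mode frame: a spanning tree of `∂Σ`, with a root in `∂Σ`, and the Wilson
lines from the root to the vertices of `∂Σ` along the tree. (A connected graph on `n` vertices
with `n - 1` edges is a tree.) -/
structure IntrinsicFrame where
  root : V
  root_mem : root ∈ Λ.corner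
  tree : Finset E
  tree_subset : tree ⊆ Λ.cornerEdges
  card_tree : tree.card + 1 = Λ.corner.card
  line : V → List (Step E)
  isPath : ∀ v ∈ Λ.corner, Λ.IsPath root (line v) v
  line_tree : ∀ v ∈ Λ.corner, ∀ s ∈ line v, s.1 ∈ tree

section Physics

variable [Fintype E] (G : Type*) [Group G] [TopologicalSpace G] [IsTopologicalGroup G]
  [CompactSpace G] [SecondCountableTopology G] [MeasurableSpace G] [BorelSpace G]

/-! ### Gauge transformations and Hilbert spaces -/

variable {G} in
/-- The gauge transformation with parameter `h`, on wave functions of the link variables of a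
family `i : κ → E` of edges: a link variable `c_e` becomes `h_(tgt e) c_e h_(src e)⁻¹`. -/
def gauge {κ : Type*} [Fintype κ] (i : κ → E) (h : V → G) : L2 G κ →ₗᵢ[ℂ] L2 G κ :=
  shift (fun k => h (Λ.tgt (i k))) (fun k => h (Λ.src (i k)))

variable {G} in
/-- The wave functions that are invariant under all gauge transformations in `P`. -/
def invariants {κ : Type*} [Fintype κ] (i : κ → E) (P : Set (V → G)) : Submodule ℂ (L2 G κ) where
  carrier := {ψ | ∀ h ∈ P, Λ.gauge i h ψ = ψ}
  add_mem' hψ hφ h hh := by rw [map_add, hψ h hh, hφ h hh]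
  zero_mem' h _ := map_zero _
  smul_mem' z ψ hψ h hh := by rw [map_smul, hψ h hh]

instance {κ : Type*} [Fintype κ] (i : κ → E) (P : Set (V → G)) :
    CompleteSpace (Λ.invariants i P) := by
  have hc : IsClosed {ψ : L2 G κ | ∀ h ∈ P, Λ.gauge i h ψ = ψ} := by
    simp only [Set.ofPred_forall]
    exact isClosed_iInter fun h => isClosed_iInter fun _ =>
      isClosed_eq (Λ.gauge i h).continuous continuous_id
  exact hc.completeSpace_coe

/-- Small gauge transformations: arbitrary at the bulk vertices, trivial on the global boundary. -/
def bulkGauge : Set (V → G) := {h | ∀ v ∈ Λ.bdry, h v = 1}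

/-- Small gauge transformations that are trivial on the corner `∂Σ`. -/
def offCornerGauge : Set (V → G) := {h | ∀ v, v ∈ Λ.bdry ∨ v ∈ Λ.corner → h v = 1}

/-- Small gauge transformations that are trivial away from the corner `∂Σ`. -/
def cornerGauge : Set (V → G) := {h | ∀ v, v ∉ Λ.corner → h v = 1}

/-- The physical Hilbert space: the gauge-invariant vectors of the kinematical Hilbert space
`L²(G^E)`. -/
abbrev Hphys : Submodule ℂ (L2 G E) := Λ.invariants id (Λ.bulkGauge G)

/-- The Hilbert space `H_S^phys` of a set `S` of edges: wave functions of the link variables on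
`S`, with all bulk gauge constraints imposed except on the corner. -/
abbrev HRegion (S : Finset E) : Submodule ℂ (L2 G S) :=
  Λ.invariants (fun e : S => (e : E)) (Λ.offCornerGauge G)

open scoped Classical in
variable {G} in
/-- The internal perspective of a frame with removed edges `R` and isotropy group `iso`: wave
functions of the remaining link variables, with all bulk gauge constraints imposed except on the
corner, and invariant under the isotropy group. -/
abbrev HPersp (R : Finset E) (iso : Set (V → G)) : Submodule ℂ (L2 G {e : E // e ∉ R}) :=
  Λ.invariants (fun e : {e : E // e ∉ R} => (e : E)) (Λ.offCornerGauge G ∪ iso)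

variable {G} in
/-- An operator on the physical Hilbert space as an operator on the kinematical one, vanishing on
the orthogonal complement. -/
def toKin (T : Λ.Hphys G →L[ℂ] Λ.Hphys G) : L2 G E →L[ℂ] L2 G E :=
  (Λ.Hphys G).subtypeL ∘L T ∘L (Λ.Hphys G).orthogonalProjectionOnto

variable {G} in
/-- The restriction and compression of a kinematical operator to the physical Hilbert space. -/
def toPhys (T : L2 G E →L[ℂ] L2 G E) : Λ.Hphys G →L[ℂ] Λ.Hphys G :=
  (Λ.Hphys G).orthogonalProjectionOnto ∘L T ∘L (Λ.Hphys G).subtypeL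

/-! ### Wilson lines, reduction to the perspective of a frame, relational algebras -/

variable {G}

/-- The holonomy of a step. -/
def stepHol (c : E → G) (s : Step E) : G := if s.2 then c s.1 else (c s.1)⁻¹

/-- The Wilson line variable `g_n ⋯ g_1` along a list of steps. -/
def hol (c : E → G) : List (Step E) → G
  | [] => 1
  | s :: l => hol c l * stepHol c s

open scoped Classical in
/-- The gauge transformation, depending on the configuration `c`, that brings the frame variables
`φ_v`, the Wilson lines along `line v`, into the orientation `φ_v = g_v` for `v ∈ ∂Σ`. -/
def dressing (line : V → List (Step E)) (g : V → G) (c : E → G) (v : V) : G :=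
  if v ∈ Λ.corner then g v * (hol c (line v))⁻¹ else 1

/-- The dressed values of the link variables outside the set `R` of removed edges. -/
def dressed (line : V → List (Step E)) (R : Finset E) (g : V → G) (c : E → G)
    (e : {e : E // e ∉ R}) : G :=
  Λ.dressing line g c (Λ.tgt e) * c e * (Λ.dressing line g c (Λ.src e))⁻¹

open scoped Classical in
/-- `χ` is the Page-Wootters reduction `⟨g| ψ` of the physical state `ψ` to the orientation `g` of
the frame, i.e. `ψ` is the gauge-invariant extension of `χ`: its value at a configuration is the
value of `χ` at the dressed configuration. -/
def IsReduction (line : V → List (Step E)) (R : Finset E) (g : V → G)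
    (ψ : L2 G E) (χ : L2 G {e : E // e ∉ R}) : Prop :=
  (ψ : (E → G) → ℂ) =ᵐ[configMeasure G E] fun c => χ (Λ.dressed line R g c)

open scoped Classical in
/-- `T = 𝓡† (A ⊗ 1) 𝓡`, where `𝓡` is the reduction to the perspective of a frame, with Wilson
lines `line`, removed edges `R`, orientation `g` and isotropy group `iso`, and where `A` is an
operator on the Hilbert space of a set `S` of remaining edges that commutes with the isotropy
group: `T` is the relational observable describing `A` relative to the frame. -/
def IsRelational (line : V → List (Step E)) (R : Finset E) (g : V → G) (iso : Set (V → G))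
    (S : Finset E) (hSR : ∀ e ∈ S, e ∉ R)
    (T : Λ.Hphys G →L[ℂ] Λ.Hphys G) (A : Λ.HRegion G S →L[ℂ] Λ.HRegion G S) : Prop :=
  (∀ u ∈ iso, ∀ f f' : Λ.HRegion G S,
    (f' : L2 G S) = Λ.gauge (fun e : S => (e : E)) u f →
    (A f' : L2 G S) = Λ.gauge (fun e : S => (e : E)) u (A f)) ∧
  ∀ ψ : Λ.Hphys G, ∃ χ χ' : Λ.HPersp R iso,
    Λ.IsReduction line R g ψ χ ∧ Λ.IsReduction line R g (T ψ) χ' ∧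
    ActsAs (fun e : S => (⟨e, hSR e e.2⟩ : {e : E // e ∉ R}))
      (fun e : {e : E // e ∉ S ∧ e ∉ R} => (⟨e, e.2.2⟩ : {e : E // e ∉ R}))
      (Λ.HRegion G S) A χ χ'

/-! ### Extrinsic frames and the electric center algebra -/

variable {Λ}

open scoped Classical in
/-- The edges on which the variables of an extrinsic frame replace the link variables: the last
edge of every Wilson line. -/
def ExtrinsicFrame.lastEdges (Φ : Λ.ExtrinsicFrame) : Finset E :=
  Finset.univ.filter fun e => ∃ v ∈ Λ.corner, ∃ b : Bool, (Φ.line v).getLast? = some (e, b)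

theorem ExtrinsicFrame.notMem_lastEdges (Φ : Λ.ExtrinsicFrame) :
    ∀ e ∈ Λ.region, e ∉ Φ.lastEdges := by
  intro e he h
  simp only [ExtrinsicFrame.lastEdges, Finset.mem_filter, Finset.mem_univ, true_and] at h
  obtain ⟨v, hv, b, hb⟩ := h
  exact Φ.exterior v hv _ (List.mem_of_getLast? hb) he

/-- `T` is the element of the extrinsic relational algebra `A^phys_{Σ|Φ} ≃ B(H_Σ^phys)` that
corresponds to the operator `A` on `H_Σ^phys`. -/
def ExtrinsicFrame.Represents (Φ : Λ.ExtrinsicFrame) (g : V → G)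
    (T : Λ.Hphys G →L[ℂ] Λ.Hphys G)
    (A : Λ.HRegion G Λ.region →L[ℂ] Λ.HRegion G Λ.region) : Prop :=
  Λ.IsRelational Φ.line Φ.lastEdges g ∅ Λ.region Φ.notMem_lastEdges T A

open scoped Classical in
/-- The parameter of the frame reorientation `h` at the first edge `e` of a Wilson line that runs
through `e` in the direction `b`; it is trivial at all other edges. -/
def ExtrinsicFrame.reorientAt (Φ : Λ.ExtrinsicFrame) (h : Λ.corner → G) (b : Bool) (e : E) : G :=
  if hv : ∃ v : Λ.corner, (Φ.line v).head? = some (e, b) then h hv.choose else 1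

/-- The frame reorientation `h ∈ G^∂Σ`: right translation of the first link of every Wilson line,
so that `φ_v` becomes `φ_v h_v⁻¹`. -/
def ExtrinsicFrame.reorient (Φ : Λ.ExtrinsicFrame) (h : Λ.corner → G) : L2 G E →ₗᵢ[ℂ] L2 G E :=
  shift (Φ.reorientAt h false) (Φ.reorientAt h true)

/-- `T'` is the electric corner twirl `∫ V(h) T V(h)† dh` of `T` over the frame reorientations
(as a weak integral with respect to the normalized Haar measure). -/
def ExtrinsicFrame.IsElectricTwirl (Φ : Λ.ExtrinsicFrame)
    (T T' : Λ.Hphys G →L[ℂ] Λ.Hphys G) : Prop :=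
  ∀ ψ φ : Λ.Hphys G,
    Integrable (fun h : Λ.corner → G =>
      ⟪(φ : L2 G E), Φ.reorient h (Λ.toKin T (Φ.reorient h⁻¹ ψ))⟫_ℂ)
      (configMeasure G Λ.corner) ∧
    ⟪φ, T' ψ⟫_ℂ = ∫ h : Λ.corner → G,
      ⟪(φ : L2 G E), Φ.reorient h (Λ.toKin T (Φ.reorient h⁻¹ ψ))⟫_ℂ
      ∂(configMeasure G Λ.corner)

variable (Λ G) in
open scoped Classical in
/-- The electric center algebra `A_Σ^{G_∂Σ} Π^phys`: the operators on the physical Hilbert space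
that are given by `A ⊗ 1`, where `A` is an operator on `H_Σ^phys` that commutes with the gauge
transformations on the corner. -/
def electricCenter : Set (Λ.Hphys G →L[ℂ] Λ.Hphys G) :=
  {T | ∃ A : Λ.HRegion G Λ.region →L[ℂ] Λ.HRegion G Λ.region,
    (∀ u ∈ Λ.cornerGauge G, ∀ f f' : Λ.HRegion G Λ.region,
      (f' : L2 G Λ.region) = Λ.gauge (fun e : Λ.region => (e : E)) u f →
      (A f' : L2 G Λ.region) = Λ.gauge (fun e : Λ.region => (e : E)) u (A f)) ∧
    ∀ ψ : Λ.Hphys G, ActsAs (fun e : Λ.region => (e : E))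
      (fun e : {e : E // e ∉ Λ.region} => (e : E)) (Λ.HRegion G Λ.region) A ψ (T ψ)}

/-! ### Intrinsic frames and the magnetic center algebra -/

/-- The orientations of an intrinsic frame; there is no orientation variable at the root. -/
def IntrinsicFrame.IsOrientation (F : Λ.IntrinsicFrame) (g : V → G) : Prop := g F.root = 1

open scoped Classical in
/-- The isotropy group of the orientation `g` of an intrinsic frame: the gauge transformations
`g_v h g_v⁻¹` on the corner, for `h ∈ G`. -/
def IntrinsicFrame.isotropy (_F : Λ.IntrinsicFrame) (g : V → G) : Set (V → G) :=
  {u | ∃ h : G, ∀ v, u v = if v ∈ Λ.corner then g v * h * (g v)⁻¹ else 1}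

open scoped Classical in
/-- The edges of `Σ` outside the tree. -/
def IntrinsicFrame.regionEdges (F : Λ.IntrinsicFrame) : Finset E := Λ.region \ F.tree

open scoped Classical in
/-- The edges of `∂Σ` outside the tree. -/
def IntrinsicFrame.loopEdges (F : Λ.IntrinsicFrame) : Finset E := Λ.cornerEdges \ F.tree

theorem IntrinsicFrame.notMem_tree (F : Λ.IntrinsicFrame) : ∀ e ∈ F.regionEdges, e ∉ F.tree := by
  intro e he
  simp only [IntrinsicFrame.regionEdges, Finset.mem_sdiff] at he
  exact he.2

/-- `T` is the element of the intrinsic relational algebra `A^phys_{Σ∖F|F}` that corresponds to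
the isotropy-invariant operator `A` on the Hilbert space of the edges of `Σ` outside the tree. -/
def IntrinsicFrame.Represents (F : Λ.IntrinsicFrame) (g : V → G)
    (T : Λ.Hphys G →L[ℂ] Λ.Hphys G)
    (A : Λ.HRegion G F.regionEdges →L[ℂ] Λ.HRegion G F.regionEdges) : Prop :=
  Λ.IsRelational F.line F.tree g (F.isotropy g) F.regionEdges F.notMem_tree T A

/-- The intrinsic relational algebra of an intrinsic frame in the orientation `g`. -/
def IntrinsicFrame.algebra (F : Λ.IntrinsicFrame) (g : V → G) :
    Set (Λ.Hphys G →L[ℂ] Λ.Hphys G) :=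
  {T | ∃ A, F.Represents g T A}

variable (Λ G) in
/-- The magnetic center algebra: the intersection of all intrinsic relational algebras. -/
def magneticCenter : Set (Λ.Hphys G →L[ℂ] Λ.Hphys G) :=
  {T | ∀ (F : Λ.IntrinsicFrame) (g : V → G), F.IsOrientation g → T ∈ F.algebra g}

/-- The holonomy of the corner loop, based at the root, that runs along the tree to the source of
the edge `e`, through `e`, and back to the root along the tree. -/
def IntrinsicFrame.loopHol (F : Λ.IntrinsicFrame) (e : E) (c : E → G) : G :=
  (hol c (F.line (Λ.tgt e)))⁻¹ * c e * hol c (F.line (Λ.src e))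

theorem continuous_hol (l : List (Step E)) : Continuous fun c : E → G => hol c l := by
  induction l with
  | nil => exact continuous_const
  | cons s l ih =>
    refine ih.mul ?_
    unfold stepHol
    split_ifs
    · exact continuous_apply s.1
    · exact (continuous_apply s.1).inv

/-- The product over the corner loops of the characters `χ_e` of their holonomies. -/
def IntrinsicFrame.loopCharacter (F : Λ.IntrinsicFrame) (χ : F.loopEdges → PontryaginDual G) :
    C(E → G, Circle) where
  toFun c := ∏ e : F.loopEdges, χ e (F.loopHol e c)
  continuous_toFun := continuous_finsetProd _ fun e _ =>
    (map_continuous (χ e)).comp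
      (((continuous_hol _).inv.mul (continuous_apply (e : E))).mul (continuous_hol _))

/-- The unitary representation `χ ↦ Û^χ` of the magnetic corner group, the group of families of
characters of `G` indexed by the edges of `∂Σ` outside the tree, by corner Wilson loops. -/
def IntrinsicFrame.wilsonLoop (F : Λ.IntrinsicFrame) (χ : F.loopEdges → PontryaginDual G) :
    L2 G E →ₗᵢ[ℂ] L2 G E :=
  phaseMul (F.loopCharacter χ)

/-- The dual magnetic twirl of `T`: the average of `Û^χ T (Û^χ)†` over the magnetic corner group
(for finite Abelian `G`). -/
def IntrinsicFrame.magneticTwirl (F : Λ.IntrinsicFrame) (T : Λ.Hphys G →L[ℂ] Λ.Hphys G) :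
    Λ.Hphys G →L[ℂ] Λ.Hphys G :=
  ((Nat.card G : ℂ) ^ F.loopEdges.card)⁻¹ •
    ∑ᶠ χ : F.loopEdges → PontryaginDual G,
      Λ.toPhys ((F.wilsonLoop χ).toContinuousLinearMap ∘L Λ.toKin T ∘L
        (F.wilsonLoop χ⁻¹).toContinuousLinearMap)

end Physics

end Lattice

end LGT

set_option linter.unusedSectionVars false

/-! ### Trace, spectral decomposition and entropy of averaged density operators. -/

namespace QEntropy

open ContinuousLinearMap

universe u

variable {H : Type u} [NormedAddCommGroup H] [InnerProductSpace ℂ H] [CompleteSpace H]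

/-! Entropy is unitarily invariant and concave, so averaging a density operator over unitaries
cannot lower it. It remains to see that each twirl is such an average of the operator `A` in the
perspective of the frame, and that it lands in the center.

Entropy (`isDensity_twirl`). Write η(x) = -x log x. The average B has trace one, so it is compact
and has an eigenbasis b_i; its eigenvalue l_i is the mean of ⟨W b_i, A W b_i⟩ over the unitaries W.
The Peierls inequality ⟨x, η(A) x⟩ ≤ η(⟨x, A x⟩) for unit vectors, followed by Jensen's inequality,
bounds the mean of ⟨W b_i, η(A) W b_i⟩ by η(l_i). Summing over i gives S(A) ≤ S(B), because the
trace is the same in every rotated basis.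

Electric part. Dressing preserves Haar measure (`measurePreserving_dressed`). In the perspective of
the frame the reorientation h becomes the corner gauge transformation g h g⁻¹, combined with
translations of links outside Σ (`reorient_extend`). The translations cancel under conjugation, so
the twirl is represented by the Haar average of `A` over the corner gauge group
(`represents_twirl`), and this average commutes with the group. Since the Wilson lines avoid Σ,
dressing is, for fixed exterior links, a corner gauge transformation of Σ. An operator commuting
with these is therefore the same relative to the frame and without it (`mem_electricCenter`).

Magnetic part, G finite and Abelian. Corner Wilson loops act in the perspective as multiplication by
characters of the loop holonomies. By orthogonality of characters the average removes all matrix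
elements between different loop values (`regionTwirl_congr`). Loop values together with the oriented
tree fix every link of ∂Σ, so within one sector the gauge transformation to any other intrinsic
frame is constant, and the twirled operator can be carried over to that frame
(`magneticTwirl_mem_magneticCenter`). -/

theorem hilbertBasis_parseval {ι : Type*} (b : HilbertBasis ι ℂ H) (x : H) :
    ∑' i, ENNReal.ofReal (‖⟪b i, x⟫_ℂ‖ ^ 2) = ENNReal.ofReal (‖x‖ ^ 2) := by
  have h := (b.hasSum_inner_mul_inner x x).mapL Complex.reCLM
  have h2 : HasSum (fun i => ‖⟪b i, x⟫_ℂ‖ ^ 2) (‖x‖ ^ 2) := by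
    convert h using 1
    · ext i
      rw [← inner_conj_symm x (b i), Complex.reCLM_apply, mul_comm, Complex.mul_conj,
        Complex.normSq_eq_norm_sq]
      norm_cast
    · rw [Complex.reCLM_apply, inner_self_eq_norm_sq_to_K]
      norm_cast
  rw [← h2.tsum_eq, ENNReal.ofReal_tsum_of_nonneg (fun _ => by positivity) h2.summable]

theorem IsPositive.exists_sqrt {A : H →L[ℂ] H} (hA : A.IsPositive) :
    ∃ S : H →L[ℂ] H, S.IsPositive ∧ S * S = A :=
  ⟨CFC.sqrt A, (nonneg_iff_isPositive _).1 (CFC.sqrt_nonneg A),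
    CFC.sqrt_mul_sqrt_self A ((nonneg_iff_isPositive _).2 hA)⟩

theorem inner_mul_self_apply {S : H →L[ℂ] H} (hS : S.IsPositive) (x : H) :
    RCLike.re ⟪x, (S * S) x⟫_ℂ = ‖S x‖ ^ 2 := by
  rw [mul_apply_eq_comp, ← hS.inner_left_eq_inner_right, inner_self_eq_norm_sq]

/-- By Parseval both sides are the double sum of |⟨c_j, S b_i⟩|²; in `[0, ∞]` the order of summation
is free. -/
theorem tsum_norm_sq_eq {ι κ : Type*} (b : HilbertBasis ι ℂ H) (c : HilbertBasis κ ℂ H)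
    {S : H →L[ℂ] H} (hS : S.IsPositive) :
    ∑' i, ENNReal.ofReal (‖S (b i)‖ ^ 2) = ∑' j, ENNReal.ofReal (‖S (c j)‖ ^ 2) := by
  simp_rw [← hilbertBasis_parseval c (S (b _)), ← hilbertBasis_parseval b (S (c _))]
  rw [ENNReal.tsum_comm]
  refine tsum_congr fun j => tsum_congr fun i => ?_
  rw [← hS.inner_left_eq_inner_right, ← inner_conj_symm, RCLike.norm_conj]

theorem posTrace_eq {ι : Type*} (b : HilbertBasis ι ℂ H) {A : H →L[ℂ] H} (hA : A.IsPositive) :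
    posTrace A = ∑' i, ENNReal.ofReal (RCLike.re ⟪b i, A (b i)⟫_ℂ) := by
  obtain ⟨S, hS, rfl⟩ := IsPositive.exists_sqrt hA
  obtain ⟨c, hc⟩ := (exists_hilbertBasis ℂ H).choose_spec
  simp_rw [posTrace, inner_mul_self_apply hS]
  rw [tsum_norm_sq_eq b c hS, hc]

/-- Distinct basis vectors are at distance √2, so the balls of radius 1/2 around them are disjoint.
Countability allows sums over a basis to be exchanged with integrals. -/
theorem countable_of_hilbertBasis [TopologicalSpace.SeparableSpace H] {ι : Type*}
    (b : HilbertBasis ι ℂ H) : Countable ι := by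
  refine Pairwise.countable_of_isOpen_disjoint (s := fun i => Metric.ball (b i) (1 / 2))
    (fun i j hij => ?_) (fun i => Metric.isOpen_ball) fun i => ⟨b i, by simp⟩
  refine Metric.ball_disjoint_ball ?_
  have h : ‖b i - b j‖ ^ 2 = 2 := by
    rw [@norm_sub_sq ℂ, b.orthonormal.1 i, b.orthonormal.1 j, b.orthonormal.2 hij]
    norm_num
  rw [dist_eq_norm]
  nlinarith [norm_nonneg (b i - b j)]

/-- A unitary image of a Hilbert basis. -/
def mapBasis {ι : Type*} (b : HilbertBasis ι ℂ H) (W : H ≃ₗᵢ[ℂ] H) : HilbertBasis ι ℂ H :=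
  HilbertBasis.ofRepr (W.symm.trans b.repr)

theorem mapBasis_apply {ι : Type*} (b : HilbertBasis ι ℂ H) (W : H ≃ₗᵢ[ℂ] H) (i : ι) :
    mapBasis b W i = W (b i) := by
  classical
  rw [← HilbertBasis.repr_symm_single, ← HilbertBasis.repr_symm_single]
  rfl

/-- The square root S of A is Hilbert–Schmidt, since the sum of ‖S b_i‖² is the trace of A. Its
truncations have finite rank and converge in norm, so S is compact, and so is A = S². -/
theorem isCompactOperator_of_posTrace {A : H →L[ℂ] H} (hA : A.IsPositive)
    (ht : posTrace A ≠ ∞) : IsCompactOperator A := by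
  obtain ⟨S, hS, rfl⟩ := IsPositive.exists_sqrt hA
  classical
  obtain ⟨w, b, -⟩ := exists_hilbertBasis ℂ H
  rw [posTrace_eq b hA] at ht
  simp_rw [inner_mul_self_apply hS] at ht
  -- As S is self-adjoint, ⟨S b_i, x⟩ = ⟨b_i, S x⟩: `T s` is S followed by the projection onto the
  -- span of the `b i` with `i ∈ s`. The error is controlled by the tail of the trace.
  let T : Finset w → H →L[ℂ] H := fun s => ∑ i ∈ s, (innerSL ℂ (S (b i))).smulRight (b i)
  suffices hc : IsCompactOperator S from hc.clm_comp S
  refine isCompactOperator_of_tendsto (l := Filter.atTop) (F := T) ?_ (Filter.Eventually.of_forall fun s => ?_)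
  · rw [tendsto_iff_norm_sub_tendsto_zero]
    have hz := ENNReal.tendsto_tsum_compl_atTop_zero ht
    have hz2 : Filter.Tendsto (fun s : Finset w => Real.sqrt
        (∑' i : {x // x ∉ s}, ENNReal.ofReal (‖S (b i)‖ ^ 2)).toReal) Filter.atTop (nhds 0) := by
      have h3 := (Real.continuous_sqrt.tendsto _).comp
        ((ENNReal.tendsto_toReal ENNReal.zero_ne_top).comp hz)
      rw [ENNReal.toReal_zero, Real.sqrt_zero] at h3
      exact h3
    refine squeeze_zero (fun _ => norm_nonneg _) (fun s => ?_) hz2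
    refine opNorm_le_bound _ (Real.sqrt_nonneg _) fun x => ?_
    have hne : (∑' i : {x // x ∉ s}, ENNReal.ofReal (‖S (b i)‖ ^ 2)) ≠ ∞ :=
      ne_top_of_le_ne_top ht (ENNReal.tsum_comp_le_tsum_of_injective Subtype.val_injective _)
    refine le_of_sq_le_sq ?_ (by positivity)
    rw [mul_pow, Real.sq_sqrt ENNReal.toReal_nonneg, ← ENNReal.ofReal_le_ofReal_iff (by positivity),
      ENNReal.ofReal_mul ENNReal.toReal_nonneg, ENNReal.ofReal_toReal hne,
      ← hilbertBasis_parseval b, ← ENNReal.tsum_mul_right]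
    have hcoef : ∀ i, ⟪b i, (T s - S) x⟫_ℂ = if i ∈ s then 0 else - ⟪S (b i), x⟫_ℂ := by
      intro i
      have : ⟪b i, T s x⟫_ℂ = if i ∈ s then ⟪S (b i), x⟫_ℂ else 0 := by
        simp only [T, sum_apply, smulRight_apply, innerSL_apply_apply, inner_sum, inner_smul_right]
        simp_rw [orthonormal_iff_ite.1 b.orthonormal]
        simp
      rw [sub_apply, inner_sub_right, this, hS.inner_left_eq_inner_right]
      split_ifs <;> simp
    rw [← ENNReal.sum_add_tsum_compl s, Finset.sum_eq_zero (fun i hi => by rw [hcoef i, if_pos hi]; simp), zero_add]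
    refine ENNReal.tsum_le_tsum ?_
    rintro ⟨i, hi⟩
    have hi' : i ∉ s := hi
    rw [hcoef, if_neg hi', norm_neg, ← ENNReal.ofReal_mul (by positivity), ← mul_pow]
    exact ENNReal.ofReal_le_ofReal (by gcongr; exact norm_inner_le_norm _ _)
  · simp only [T]
    induction s using Finset.induction_on with
    | empty => simpa using isCompactOperator_zero
    | insert i s hi ih =>
      rw [Finset.sum_insert hi]
      refine IsCompactOperator.add ?_ ih
      have h := isCompactOperator_of_locallyCompactSpace_dom (innerSL ℂ (S (b i)) : H →L[ℂ] ℂ)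
      exact h.clm_comp ((ContinuousLinearMap.id ℂ ℂ).smulRight (b i))

/-- The basis is the union of Hilbert bases of the `K i`: a vector orthogonal to this union has zero
projection onto each `K i`, hence is orthogonal to their supremum. -/
theorem exists_hilbertBasis_of_orthogonalFamily {ι : Type} (K : ι → Submodule ℂ H)
    [∀ i, CompleteSpace (K i)]
    (hK : OrthogonalFamily ℂ (fun i => K i) fun i => (K i).subtypeₗᵢ) (hbot : (⨆ i, K i)ᗮ = ⊥) :
    ∃ (κ : Type u) (b : HilbertBasis κ ℂ H), ∀ k, ∃ i, b k ∈ K i := by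
  choose w b hb using fun i => exists_hilbertBasis ℂ (K i)
  have hon := hK.orthonormal_sigma_orthonormal (fun i => (b i).orthonormal)
  have hsp : (Submodule.span ℂ (Set.range fun a : Σ i, w i =>
      (K a.1).subtypeₗᵢ (b a.1 a.2)))ᗮ = ⊥ := by
    rw [eq_bot_iff, ← hbot]
    intro x hx
    rw [Submodule.mem_orthogonal] at hx ⊢
    intro u hu
    refine Submodule.iSup_induction _ (motive := fun u => ⟪u, x⟫_ℂ = 0) hu (fun i y hy => ?_)
      (by simp) (fun y z hy hz => by rw [inner_add_left, hy, hz, add_zero])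
    have hP : (K i).orthogonalProjectionOnto x = 0 := by
      apply (b i).repr.injective
      ext j
      rw [(b i).repr_apply_apply, Submodule.inner_orthogonalProjectionOnto_eq_of_mem_left, map_zero]
      exact hx _ (Submodule.subset_span ⟨⟨i, j⟩, rfl⟩)
    have := Submodule.inner_orthogonalProjectionOnto_eq_of_mem_left (⟨y, hy⟩ : K i) x
    rw [← this, hP, inner_zero_right]
  refine ⟨_, HilbertBasis.mkOfOrthogonalEqBot hon hsp, fun a => ⟨a.1, ?_⟩⟩
  rw [HilbertBasis.coe_mkOfOrthogonalEqBot]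
  exact (b a.1 a.2).2

theorem exists_eigenbasis {A : H →L[ℂ] H} (hA : A.IsPositive) (hc : IsCompactOperator A) :
    ∃ (ι : Type u) (b : HilbertBasis ι ℂ H) (l : ι → ℝ), ∀ i, A (b i) = (l i : ℂ) • b i := by
  have hs := hA.isSymmetric
  have hcs : ∀ μ, CompleteSpace (Module.End.eigenspace (A : H →ₗ[ℂ] H) μ) := by
    intro μ
    have h2 : (Module.End.eigenspace (A : H →ₗ[ℂ] H) μ : Set H) = {x | A x = μ • x} := by
      ext x; exact Module.End.mem_eigenspace_iff
    have : IsClosed (Module.End.eigenspace (A : H →ₗ[ℂ] H) μ : Set H) := by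
      rw [h2]
      exact isClosed_eq A.continuous (continuous_const_smul μ)
    exact this.completeSpace_coe
  obtain ⟨κ, b, hb⟩ := exists_hilbertBasis_of_orthogonalFamily _ hs.orthogonalFamily_eigenspaces
    (orthogonalComplement_iSup_eigenspaces_eq_bot hc hs)
  choose μ hμ using hb
  refine ⟨κ, b, fun k => (μ k).re, fun k => ?_⟩
  have hmem : A (b k) = μ k • b k := Module.End.mem_eigenspace_iff.1 (hμ k)
  have hev : Module.End.HasEigenvalue (A : H →ₗ[ℂ] H) (μ k) :=
    Module.End.hasEigenvalue_of_hasEigenvector ⟨hμ k, b.orthonormal.ne_zero k⟩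
  rw [hmem, Complex.conj_eq_iff_re.1 (hs.conj_eigenvalue_eq_self hev)]

/-- The functions for which the identity holds form a closed subalgebra containing the identity
function, hence are all continuous functions on the spectrum, by Stone–Weierstrass. -/
theorem cfc_apply_eigenvector {A : H →L[ℂ] H} (hA : IsSelfAdjoint A) {l : ℝ} {x : H}
    (hx : A x = (l : ℂ) • x) (hx0 : x ≠ 0) {f : ℝ → ℝ} (hf : ContinuousOn f (spectrum ℝ A)) :
    cfc f A x = (f l : ℂ) • x := by
  have hl : l ∈ spectrum ℝ A := by
    -- Otherwise l - A would be invertible, although it annihilates x ≠ 0.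
    by_contra h
    rw [spectrum.notMem_iff] at h
    obtain ⟨u, hu⟩ := h
    apply hx0
    have h1 : (u : H →L[ℂ] H) x = 0 := by
      rw [hu, sub_apply, hx, sub_eq_zero]
      simp [Algebra.algebraMap_eq_smul_one]
    calc x = ((u⁻¹ : (H →L[ℂ] H)ˣ) * u : H →L[ℂ] H) x := by rw [Units.inv_mul]; rfl
      _ = 0 := by rw [mul_apply_eq_comp, h1, map_zero]
  have key : ∀ g : C(spectrum ℝ A, ℝ), cfcHom hA g x = (g ⟨l, hl⟩ : ℂ) • x := by
    intro g
    induction g using ContinuousMap.induction_on_of_compact with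
    | const r =>
      have : cfcHom hA (ContinuousMap.const _ r) = algebraMap ℝ (H →L[ℂ] H) r :=
        AlgHomClass.commutes (cfcHom hA) r
      rw [this]
      simp [Algebra.algebraMap_eq_smul_one]
    | id => rw [cfcHom_id]; exact hx
    | star_id =>
      rw [map_star, cfcHom_id, hA.star_eq]; simpa using hx
    | add f g hf hg =>
      rw [map_add, add_apply, hf, hg, ← add_smul]; simp
    | mul f g hf hg =>
      rw [map_mul, mul_apply_eq_comp, hg, map_smul, hf, smul_smul, mul_comm]; simp
    | frequently f h =>
      have hcl : IsClosed {g : C(spectrum ℝ A, ℝ) | cfcHom hA g x = (g ⟨l, hl⟩ : ℂ) • x} := by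
        refine isClosed_eq ?_ ?_
        · exact (ContinuousLinearMap.apply ℂ H x).continuous.comp (cfcHom_continuous hA)
        · exact (Complex.continuous_ofReal.comp
            (continuous_eval_const (⟨l, hl⟩ : spectrum ℝ A))).smul continuous_const
      exact hcl.closure_subset (mem_closure_iff_frequently.2 h)
  rw [cfc_apply f A hA hf, key]
  rfl

/-- The operator norm of the square root is at most its Hilbert–Schmidt norm, which is 1. This
places the spectrum in [0, 1], where -x log x is nonnegative. -/
theorem IsDensity.norm_le_one {A : H →L[ℂ] H} (hA : IsDensity A) : ‖A‖ ≤ 1 := by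
  obtain ⟨hp, ht⟩ := hA
  obtain ⟨S, hS, rfl⟩ := IsPositive.exists_sqrt hp
  obtain ⟨w, b, -⟩ := exists_hilbertBasis ℂ H
  rw [posTrace_eq b hp] at ht
  simp_rw [inner_mul_self_apply hS] at ht
  have h : ‖S‖ ≤ 1 := by
    refine opNorm_le_bound _ zero_le_one fun x => ?_
    refine le_of_sq_le_sq ?_ (by positivity)
    rw [one_mul, ← ENNReal.ofReal_le_ofReal_iff (by positivity), ← hilbertBasis_parseval b,
      ← one_mul (ENNReal.ofReal (‖x‖ ^ 2)), ← ht, ← ENNReal.tsum_mul_right]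
    refine ENNReal.tsum_le_tsum fun i => ?_
    rw [← ENNReal.ofReal_mul (by positivity), ← mul_pow, ← hS.inner_left_eq_inner_right]
    exact ENNReal.ofReal_le_ofReal (by gcongr; exact norm_inner_le_norm _ _)
  calc ‖S * S‖ ≤ ‖S‖ * ‖S‖ := norm_mul_le _ _
    _ ≤ 1 * 1 := by gcongr
    _ = 1 := one_mul 1

theorem IsDensity.spectrum_subset {A : H →L[ℂ] H} (hA : IsDensity A) :
    spectrum ℝ A ⊆ Set.Icc 0 1 := by
  intro l hl
  refine ⟨spectrum_nonneg_of_nonneg ((nonneg_iff_isPositive _).2 hA.1) hl, ?_⟩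
  have h := spectrum.norm_le_norm_mul_of_mem hl
  have h1 : ‖(1 : H →L[ℂ] H)‖ ≤ 1 := norm_id_le
  have h2 := hA.norm_le_one
  calc l ≤ ‖l‖ := Real.le_norm_self l
    _ ≤ ‖A‖ * ‖(1 : H →L[ℂ] H)‖ := h
    _ ≤ 1 * 1 := by gcongr
    _ = 1 := one_mul 1

theorem IsDensity.isPositive_cfc {A : H →L[ℂ] H} (hA : IsDensity A) :
    (cfc Real.negMulLog A).IsPositive := by
  rw [← nonneg_iff_isPositive]
  refine cfc_nonneg fun t ht => ?_
  exact Real.negMulLog_nonneg (hA.spectrum_subset ht).1 (hA.spectrum_subset ht).2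

/-- The right side is the tangent at s of the concave function -x log x; the inequality is log y ≤ y
- 1 at y = s / t. -/
theorem negMulLog_le_tangent {s t : ℝ} (hs : 0 < s) (ht : 0 ≤ t) :
    Real.negMulLog t ≤ s + (-Real.log s - 1) * t := by
  rcases ht.eq_or_lt with rfl | ht
  · simp [hs.le]
  · have h := Real.log_le_sub_one_of_pos (div_pos hs ht)
    rw [Real.log_div hs.ne' ht.ne'] at h
    have h2 := mul_le_mul_of_nonneg_left h ht.le
    rw [mul_sub t (s / t), mul_div_cancel₀ _ ht.ne'] at h2
    rw [Real.negMulLog]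
    linarith

/-- The Peierls inequality for `x ↦ -x log x`. -/
theorem IsDensity.re_inner_cfc_le {A : H →L[ℂ] H} (hA : IsDensity A) {x : H} (hx : ‖x‖ = 1) :
    RCLike.re ⟪x, cfc Real.negMulLog A x⟫_ℂ ≤ Real.negMulLog (RCLike.re ⟪x, A x⟫_ℂ) := by
  have hp := hA.1
  have hsa := hp.isSelfAdjoint
  have hs := hp.re_inner_nonneg_right x
  rcases hs.eq_or_lt with h0 | hpos
  -- The tangent at 0 is vertical, so this case is treated apart: a vanishing expectation value
  -- forces A x = 0, and x is an eigenvector.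
  · obtain ⟨S, hS, hSA⟩ := IsPositive.exists_sqrt hp
    have hA0 : A x = 0 := by
      rw [← hSA, inner_mul_self_apply hS] at h0
      have : S x = 0 := by simpa using h0.symm
      rw [← hSA, mul_apply_eq_comp, this, map_zero]
    have hx0 : x ≠ 0 := by rintro rfl; simp at hx
    rw [cfc_apply_eigenvector hsa (l := 0) (by simpa using hA0) hx0
      Real.continuous_negMulLog.continuousOn, ← h0]
    simp
  · set s := RCLike.re ⟪x, A x⟫_ℂ with hsdef
    -- The tangent is taken at the expectation value s itself: in the unit vector x, the expectation
    -- of an affine function of A is its value at s, here -s log s.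
    have hle : cfc Real.negMulLog A ≤ cfc (fun t => s + (-Real.log s - 1) * t) A :=
      cfc_mono (fun t ht => negMulLog_le_tangent hpos (hA.spectrum_subset ht).1)
        Real.continuous_negMulLog.continuousOn
    rw [cfc_const_add s _ A, cfc_const_mul _ (fun t => t) A, cfc_id' ℝ A] at hle
    have h := ((le_def _ _).1 hle).re_inner_nonneg_right x
    rw [sub_apply, inner_sub_right, map_sub, sub_nonneg] at h
    refine h.trans (le_of_eq ?_)
    rw [add_apply, inner_add_right, map_add, Algebra.algebraMap_eq_smul_one]
    simp only [smul_apply, one_apply_eq_self, inner_smul_right_eq_smul, RCLike.smul_re, ← hsdef,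
      inner_self_eq_norm_sq, hx, Real.negMulLog]
    ring

section Twirl

variable {Ω : Type*} [MeasurableSpace Ω] {P : Measure Ω} [IsProbabilityMeasure P]
  {W : Ω → H ≃ₗᵢ[ℂ] H} {A B : H →L[ℂ] H}

theorem aestronglyMeasurable_inner_conj (hW : ∀ x, AEStronglyMeasurable (fun ω => W ω x) P)
    (C : H →L[ℂ] H) (x : H) :
    AEStronglyMeasurable (fun ω => ⟪W ω x, C (W ω x)⟫_ℂ) P :=
  (hW x).inner (C.continuous.comp_aestronglyMeasurable (hW x))

theorem integrable_inner_conj (hW : ∀ x, AEStronglyMeasurable (fun ω => W ω x) P)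
    (C : H →L[ℂ] H) (x : H) :
    Integrable (fun ω => ⟪W ω x, C (W ω x)⟫_ℂ) P := by
  refine Integrable.of_bound (aestronglyMeasurable_inner_conj hW C x) (‖x‖ * (‖C‖ * ‖x‖))
    (ae_of_all _ fun ω => ?_)
  refine (norm_inner_le_norm _ _).trans ?_
  have := C.le_opNorm (W ω x)
  rw [LinearIsometryEquiv.norm_map] at this ⊢
  gcongr

/-- For each ω the sum over i is the trace of C in the rotated basis `W ω (b i)`, so it does not
depend on ω; Tonelli does the rest. -/
theorem tsum_lintegral_conj [TopologicalSpace.SeparableSpace H]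
    (hW : ∀ x, AEStronglyMeasurable (fun ω => W ω x) P)
    {C : H →L[ℂ] H} (hC : C.IsPositive) {ι : Type*} (b : HilbertBasis ι ℂ H) :
    ∑' i, ∫⁻ ω, ENNReal.ofReal (RCLike.re ⟪W ω (b i), C (W ω (b i))⟫_ℂ) ∂P = posTrace C := by
  have := countable_of_hilbertBasis b
  rw [← lintegral_tsum fun i => (RCLike.continuous_re.comp_aestronglyMeasurable
    (aestronglyMeasurable_inner_conj hW C (b i))).aemeasurable.ennreal_ofReal]
  have h : ∀ ω, ∑' i, ENNReal.ofReal (RCLike.re ⟪W ω (b i), C (W ω (b i))⟫_ℂ) = posTrace C := by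
    intro ω
    rw [posTrace_eq (mapBasis b (W ω)) hC]
    simp_rw [mapBasis_apply]
  simp_rw [h]
  simp

/-- Here and below B is the average of W† A W. Only its quadratic form is prescribed, which
determines B over ℂ. -/
theorem re_inner_twirl (hW : ∀ x, AEStronglyMeasurable (fun ω => W ω x) P)
    (hB : ∀ x, ⟪x, B x⟫_ℂ = ∫ ω, ⟪W ω x, A (W ω x)⟫_ℂ ∂P) (x : H) :
    RCLike.re ⟪x, B x⟫_ℂ = ∫ ω, RCLike.re ⟪W ω x, A (W ω x)⟫_ℂ ∂P := by
  rw [hB, ← integral_re (integrable_inner_conj hW A x)]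

theorem isPositive_twirl (hW : ∀ x, AEStronglyMeasurable (fun ω => W ω x) P)
    (hA : A.IsPositive) (hB : ∀ x, ⟪x, B x⟫_ℂ = ∫ ω, ⟪W ω x, A (W ω x)⟫_ℂ ∂P) :
    B.IsPositive := by
  rw [isPositive_iff_complex]
  intro x
  have hre := re_inner_twirl hW hB x
  have hc : ∀ ω, ⟪W ω x, A (W ω x)⟫_ℂ = ((RCLike.re ⟪W ω x, A (W ω x)⟫_ℂ : ℝ) : ℂ) := by
    intro ω
    have h := ((isPositive_iff_complex A).1 hA (W ω x)).1
    rw [hA.inner_left_eq_inner_right] at h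
    exact h.symm
  have h2 : ⟪x, B x⟫_ℂ = ((RCLike.re ⟪x, B x⟫_ℂ : ℝ) : ℂ) := by
    rw [hre, hB x, ← integral_complex_ofReal]
    exact integral_congr_ae (ae_of_all _ hc)
  have h3 : ⟪B x, x⟫_ℂ = ⟪x, B x⟫_ℂ := by
    rw [← inner_conj_symm, h2]
    exact Complex.conj_ofReal _
  rw [h3]
  refine ⟨h2.symm, ?_⟩
  rw [hre]
  exact integral_nonneg fun ω => hA.re_inner_nonneg_right _

/-- Averaging a density operator over unitaries gives a density operator, of larger entropy. -/
theorem isDensity_twirl [TopologicalSpace.SeparableSpace H]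
    (hW : ∀ x, AEStronglyMeasurable (fun ω => W ω x) P) (hA : IsDensity A)
    (hB : ∀ x, ⟪x, B x⟫_ℂ = ∫ ω, ⟪W ω x, A (W ω x)⟫_ℂ ∂P) :
    IsDensity B ∧ vonNeumannEntropy A ≤ vonNeumannEntropy B := by
  have hBp := isPositive_twirl hW hA.1 hB
  have hBd : IsDensity B := by
    refine ⟨hBp, ?_⟩
    obtain ⟨w, b, -⟩ := exists_hilbertBasis ℂ H
    rw [posTrace_eq b hBp, ← hA.2, ← tsum_lintegral_conj hW hA.1 b]
    refine tsum_congr fun i => ?_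
    rw [re_inner_twirl hW hB, ofReal_integral_eq_lintegral_ofReal
      (integrable_inner_conj hW A _).re (ae_of_all _ fun ω => hA.1.re_inner_nonneg_right _)]
  refine ⟨hBd, ?_⟩
  -- The entropies are compared in an eigenbasis of the average B rather than of A. The entropy of B
  -- becomes the sum of the -l_i log l_i, with l_i a mean of expectation values of A.
  obtain ⟨ι, b, l, hl⟩ := exists_eigenbasis hBp
    (isCompactOperator_of_posTrace hBp (by rw [hBd.2]; exact ENNReal.one_ne_top))
  have hb1 := b.orthonormal.1
  rw [vonNeumannEntropy, vonNeumannEntropy, posTrace_eq b hBd.isPositive_cfc,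
    ← tsum_lintegral_conj hW hA.isPositive_cfc b]
  refine ENNReal.tsum_le_tsum fun i => ?_
  have hli : RCLike.re ⟪b i, B (b i)⟫_ℂ = l i := by
    rw [hl, inner_smul_right, inner_self_eq_norm_sq_to_K, hb1]
    simp
  have hf : RCLike.re ⟪b i, cfc Real.negMulLog B (b i)⟫_ℂ = Real.negMulLog (l i) := by
    rw [cfc_apply_eigenvector hBp.isSelfAdjoint (hl i) (b.orthonormal.ne_zero i)
      Real.continuous_negMulLog.continuousOn, inner_smul_right, inner_self_eq_norm_sq_to_K, hb1]
    simp
  have h01 : ∀ ω, RCLike.re ⟪W ω (b i), A (W ω (b i))⟫_ℂ ∈ Set.Icc (0 : ℝ) 1 := by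
    intro ω
    refine ⟨hA.1.re_inner_nonneg_right _, (RCLike.re_le_norm _).trans
      ((norm_inner_le_norm _ _).trans ?_)⟩
    have h1 : ‖W ω (b i)‖ = 1 := by rw [LinearIsometryEquiv.norm_map, hb1]
    have := A.le_opNorm (W ω (b i))
    rw [h1] at this ⊢
    linarith [hA.norm_le_one]
  have hint1 : Integrable (fun ω => RCLike.re ⟪W ω (b i), A (W ω (b i))⟫_ℂ) P :=
    (integrable_inner_conj hW A _).re
  have hint2 : Integrable (Real.negMulLog ∘
      fun ω => RCLike.re ⟪W ω (b i), A (W ω (b i))⟫_ℂ) P := by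
    refine Integrable.of_bound
      (Real.continuous_negMulLog.comp_aestronglyMeasurable hint1.aestronglyMeasurable) 1
      (ae_of_all _ fun ω => ?_)
    obtain ⟨h0, h1⟩ := h01 ω
    have hn := Real.negMulLog_nonneg h0 h1
    simp only [Function.comp_apply]
    rw [Real.norm_of_nonneg hn]
    have := negMulLog_le_tangent zero_lt_one h0
    simp only [Real.log_one] at this
    linarith
  have hint3 : Integrable
      (fun ω => RCLike.re ⟪W ω (b i), cfc Real.negMulLog A (W ω (b i))⟫_ℂ) P :=
    (integrable_inner_conj hW _ _).re
  rw [hf, ← hli, re_inner_twirl hW hB, ← ofReal_integral_eq_lintegral_ofReal hint3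
    (ae_of_all _ fun ω => hA.isPositive_cfc.re_inner_nonneg_right _)]
  refine ENNReal.ofReal_le_ofReal ?_
  -- Peierls for each ω, then Jensen.
  calc ∫ ω, RCLike.re ⟪W ω (b i), cfc Real.negMulLog A (W ω (b i))⟫_ℂ ∂P
      ≤ ∫ ω, Real.negMulLog (RCLike.re ⟪W ω (b i), A (W ω (b i))⟫_ℂ) ∂P :=
        integral_mono hint3 hint2 fun ω =>
          hA.re_inner_cfc_le (by rw [LinearIsometryEquiv.norm_map, hb1])
    _ ≤ _ := Real.concaveOn_negMulLog.le_map_integral Real.continuous_negMulLog.continuousOn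
        isClosed_Ici (ae_of_all _ fun ω => (h01 ω).1) hint1 hint2

end Twirl

end QEntropy

/-! ### Wave functions on G^κ: translations, product vectors and partial inner products. -/

namespace LGT

section Wave

variable {G : Type*} [Group G] [TopologicalSpace G] [IsTopologicalGroup G] [CompactSpace G]
  [T2Space G] [SecondCountableTopology G] [MeasurableSpace G] [BorelSpace G]
variable {ι κ μ : Type*} [Fintype ι] [Fintype κ] [Fintype μ]

instance separableSpace_L2 : TopologicalSpace.SeparableSpace (L2 G κ) := by
  have : Fact ((2 : ℝ≥0∞) ≠ ∞) := ⟨by simp⟩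
  have : SecondCountableTopology (L2 G κ) := Lp.SecondCountableTopology
  infer_instance

/-- The normalized Haar measure of a compact group is also right invariant, so its image under
inversion is left invariant; uniqueness identifies the two. -/
theorem haarProb_map_inv : MeasurePreserving (fun x : G => x⁻¹) (haarProb G) (haarProb G) := by
  refine ⟨measurable_inv, ?_⟩
  have hR : (haarProb G).IsMulRightInvariant := ⟨fun g => (haarProb_map_mul_right g).map_eq⟩
  have h1 : IsProbabilityMeasure (Measure.map (fun x : G => x⁻¹) (haarProb G)) :=
    Measure.isProbabilityMeasure_map measurable_inv.aemeasurable
  have hL : (Measure.map (fun x : G => x⁻¹) (haarProb G)).IsMulLeftInvariant :=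
    inferInstanceAs (haarProb G).inv.IsMulLeftInvariant
  have : (Measure.map (fun x : G => x⁻¹) (haarProb G)).IsHaarMeasure :=
    Measure.isHaarMeasure_of_isCompact_nonempty_interior _ Set.univ isCompact_univ (by simp)
      (by simp) (by simp)
  exact Measure.isHaarMeasure_eq_of_isProbabilityMeasure _ _

/-! ### Unitaries of shifts -/

theorem coeFn_shift (a b : κ → G) (ψ : L2 G κ) :
    (shift a b ψ : (κ → G) → ℂ) =ᵐ[configMeasure G κ] fun c => ψ fun k => (a k)⁻¹ * c k * b k :=
  Lp.coeFn_compMeasurePreserving ψ (shift_measurePreserving a b)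

theorem shift_shift (a b a' b' : κ → G) (ψ : L2 G κ) :
    shift a b (shift a' b' ψ) = shift (a * a') (b * b') ψ := by
  refine (Lp.compMeasurePreserving_comp_apply ψ (shift_measurePreserving a' b')
    (shift_measurePreserving a b)).symm.trans ?_
  change Lp.compMeasurePreserving _ _ ψ = Lp.compMeasurePreserving _ _ ψ
  congr 1
  congr 1
  ext c k
  simp [mul_assoc]

theorem shift_one (ψ : L2 G κ) : shift (1 : κ → G) 1 ψ = ψ := by
  apply Lp.ext
  filter_upwards [coeFn_shift 1 1 ψ] with c hc
  rw [hc]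
  simp

theorem shift_inv_shift (a b : κ → G) (ψ : L2 G κ) : shift a⁻¹ b⁻¹ (shift a b ψ) = ψ := by
  rw [shift_shift, inv_mul_cancel, inv_mul_cancel, shift_one]

theorem shift_shift_inv (a b : κ → G) (ψ : L2 G κ) : shift a b (shift a⁻¹ b⁻¹ ψ) = ψ := by
  rw [shift_shift, mul_inv_cancel, mul_inv_cancel, shift_one]

theorem inner_shift (a b : κ → G) (φ ψ : L2 G κ) :
    ⟪shift a b φ, ψ⟫_ℂ = ⟪φ, shift a⁻¹ b⁻¹ ψ⟫_ℂ := by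
  rw [← (shift a b).inner_map_map φ, shift_shift_inv]

/-- Joint strong continuity makes conjugates by gauge transformations and reorientations measurable
in the group element. It comes from continuity in Lp of composition with a continuously varying
measure-preserving map. -/
theorem continuous_shift {X : Type*} [TopologicalSpace X] {a b : X → κ → G} {ψ : X → L2 G κ}
    (ha : Continuous a) (hb : Continuous b) (hψ : Continuous ψ) :
    Continuous fun x => shift (a x) (b x) (ψ x) := by
  let m : C(X × (κ → G), κ → G) :=
    ⟨fun p k => (a p.1 k)⁻¹ * p.2 k * b p.1 k, by fun_prop⟩
  exact hψ.compMeasurePreservingLp m.curry.continuous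
    (fun x => shift_measurePreserving (a x) (b x)) (by simp)

/-! ### Splitting configurations -/

section Glue

variable {i : κ → ι} {j : μ → ι}

/-- The configuration with prescribed values on the two parts of the index set. -/
def glue (hij : Function.Bijective (Sum.elim i j)) (x : κ → G) (z : μ → G) (k : ι) : G :=
  Sum.elim x z ((Equiv.ofBijective _ hij).symm k)

theorem glue_left (hij : Function.Bijective (Sum.elim i j)) (x : κ → G) (z : μ → G) (k : κ) : glue hij x z (i k) = x k := by
  have : (Equiv.ofBijective _ hij).symm (i k) = Sum.inl k := by
    rw [Equiv.symm_apply_eq]; rfl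
  rw [glue, this, Sum.elim_inl]

theorem glue_right (hij : Function.Bijective (Sum.elim i j)) (x : κ → G) (z : μ → G) (k : μ) : glue hij x z (j k) = z k := by
  have : (Equiv.ofBijective _ hij).symm (j k) = Sum.inr k := by
    rw [Equiv.symm_apply_eq]; rfl
  rw [glue, this, Sum.elim_inr]

theorem glue_comp_left (hij : Function.Bijective (Sum.elim i j)) (x : κ → G) (z : μ → G) : glue hij x z ∘ i = x :=
  funext fun _ => glue_left hij _ _ _

theorem glue_comp_right (hij : Function.Bijective (Sum.elim i j)) (x : κ → G) (z : μ → G) : glue hij x z ∘ j = z :=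
  funext fun _ => glue_right hij _ _ _

theorem glue_ext (hij : Function.Bijective (Sum.elim i j)) {f f' : ι → G} (h1 : ∀ k, f (i k) = f' (i k)) (h2 : ∀ k, f (j k) = f' (j k)) :
    f = f' := by
  ext k
  obtain ⟨s, rfl⟩ := hij.2 k
  rcases s with s | s
  · exact h1 s
  · exact h2 s

theorem glue_comp (hij : Function.Bijective (Sum.elim i j)) (c : ι → G) : glue hij (c ∘ i) (c ∘ j) = c :=
  glue_ext hij (fun _ => glue_left hij _ _ _) fun _ => glue_right hij _ _ _

end Glue

section Split

variable {i : κ → ι} {j : μ → ι}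

theorem measurePreserving_glue (hij : Function.Bijective (Sum.elim i j)) :
    MeasurePreserving (fun p : (κ → G) × (μ → G) => glue hij p.1 p.2)
      ((configMeasure G κ).prod (configMeasure G μ)) (configMeasure G ι) := by
  have h1 := measurePreserving_sumPiEquivProdPi_symm (X := fun _ : κ ⊕ μ => G)
    (fun _ => haarProb G)
  have h2 := measurePreserving_piCongrLeft (α := fun _ : ι => G) (fun _ => haarProb G)
    (Equiv.ofBijective _ hij)
  convert h2.comp h1 using 1
  ext p k
  obtain ⟨s, rfl⟩ := (Equiv.ofBijective _ hij).surjective k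
  rw [Function.comp_apply, MeasurableEquiv.coe_piCongrLeft, Equiv.piCongrLeft_apply_apply, glue,
    Equiv.symm_apply_apply]
  rcases s with s | s <;> rfl

theorem measurableEmbedding_glue (hij : Function.Bijective (Sum.elim i j)) :
    MeasurableEmbedding (fun p : (κ → G) × (μ → G) => glue hij p.1 p.2) := by
  refine MeasurableEquiv.measurableEmbedding
    { toFun := fun p => glue hij p.1 p.2
      invFun := fun c => (c ∘ i, c ∘ j)
      left_inv := fun p => Prod.ext (glue_comp_left hij _ _) (glue_comp_right hij _ _)
      right_inv := fun c => glue_comp hij c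
      measurable_toFun := (measurePreserving_glue hij).measurable
      measurable_invFun := ?_ }
  exact Measurable.prodMk (measurable_pi_lambda _ fun k => measurable_pi_apply _)
    (measurable_pi_lambda _ fun k => measurable_pi_apply _)

theorem measurePreserving_split (hij : Function.Bijective (Sum.elim i j)) :
    MeasurePreserving (fun c : ι → G => (c ∘ i, c ∘ j)) (configMeasure G ι)
      ((configMeasure G κ).prod (configMeasure G μ)) := by
  have hm : Measurable (fun c : ι → G => (c ∘ i, c ∘ j)) :=
    Measurable.prodMk (measurable_pi_lambda _ fun k => measurable_pi_apply _)
    (measurable_pi_lambda _ fun k => measurable_pi_apply _)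
  refine ⟨hm, ?_⟩
  rw [← (measurePreserving_glue hij).map_eq,
    Measure.map_map hm (measurePreserving_glue hij).measurable]
  have h : (fun c : ι → G => (c ∘ i, c ∘ j)) ∘
      (fun p : (κ → G) × (μ → G) => glue hij p.1 p.2) = id :=
    funext fun p => Prod.ext (glue_comp_left hij p.1 p.2) (glue_comp_right hij p.1 p.2)
  rw [h, Measure.map_id]

theorem memLp_tens (hij : Function.Bijective (Sum.elim i j)) (f : L2 G κ) (k : L2 G μ) :
    MemLp (fun c : ι → G => f (c ∘ i) * k (c ∘ j)) 2 (configMeasure G ι) := by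
  have hs := measurePreserving_split (G := G) hij
  have hp : MemLp (fun p : (κ → G) × (μ → G) => f p.1 * k p.2) 2
      ((configMeasure G κ).prod (configMeasure G μ)) := by
    have hf := Lp.memLp f
    have hk := Lp.memLp k
    refine (memLp_two_iff_integrable_sq_norm
      (hf.1.comp_fst.mul hk.1.comp_snd)).2 ?_
    refine (((memLp_two_iff_integrable_sq_norm hf.1).1 hf).mul_prod
      ((memLp_two_iff_integrable_sq_norm hk.1).1 hk)).congr (ae_of_all _ fun p => ?_)
    simp [mul_pow]
  exact hp.comp_measurePreserving hs

/-- The product vector `f ⊗ k`. -/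
def tensFun (hij : Function.Bijective (Sum.elim i j)) (f : L2 G κ) (k : L2 G μ) : L2 G ι := (memLp_tens hij f k).toLp _

theorem coeFn_tensFun (hij : Function.Bijective (Sum.elim i j)) (f : L2 G κ) (k : L2 G μ) :
    (tensFun hij f k : (ι → G) → ℂ) =ᵐ[configMeasure G ι] fun c => f (c ∘ i) * k (c ∘ j) :=
  MemLp.coeFn_toLp _

theorem quasi_left (hij : Function.Bijective (Sum.elim i j)) :
    Measure.QuasiMeasurePreserving (fun c : ι → G => c ∘ i) (configMeasure G ι)
      (configMeasure G κ) :=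
  Measure.quasiMeasurePreserving_fst.comp (measurePreserving_split hij).quasiMeasurePreserving

theorem quasi_right (hij : Function.Bijective (Sum.elim i j)) :
    Measure.QuasiMeasurePreserving (fun c : ι → G => c ∘ j) (configMeasure G ι)
      (configMeasure G μ) :=
  Measure.quasiMeasurePreserving_snd.comp (measurePreserving_split hij).quasiMeasurePreserving

theorem L2_norm_sq_eq (ψ : L2 G ι) : ‖ψ‖ ^ 2 = ∫ c, ‖ψ c‖ ^ 2 ∂(configMeasure G ι) := by
  have h : ((‖ψ‖ ^ 2 : ℝ) : ℂ) = ((∫ c, ‖ψ c‖ ^ 2 ∂(configMeasure G ι) : ℝ) : ℂ) := by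
    have h1 := inner_self_eq_norm_sq_to_K (𝕜 := ℂ) ψ
    rw [L2.inner_def] at h1
    simp_rw [inner_self_eq_norm_sq_to_K] at h1
    rw [← integral_complex_ofReal]
    push_cast
    exact h1.symm
  exact_mod_cast h

theorem norm_tensFun (hij : Function.Bijective (Sum.elim i j)) (f : L2 G κ) (k : L2 G μ) : ‖tensFun hij f k‖ = ‖f‖ * ‖k‖ := by
  have h : ‖tensFun hij f k‖ ^ 2 = (‖f‖ * ‖k‖) ^ 2 := by
    rw [mul_pow, L2_norm_sq_eq, L2_norm_sq_eq, L2_norm_sq_eq, ← integral_prod_mul,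
      ← (measurePreserving_glue hij).integral_comp (measurableEmbedding_glue hij)]
    refine integral_congr_ae ?_
    filter_upwards [(measurePreserving_glue hij).quasiMeasurePreserving.ae
      (coeFn_tensFun hij f k)] with p hp
    rw [hp, norm_mul, mul_pow]
    rw [glue_comp_left, glue_comp_right]
  exact (pow_left_inj₀ (norm_nonneg _) (by positivity) two_ne_zero).1 h

/-- The bounded operator `f ↦ f ⊗ k`. -/
def tens (hij : Function.Bijective (Sum.elim i j)) (k : L2 G μ) : L2 G κ →L[ℂ] L2 G ι :=
  LinearMap.mkContinuous
    { toFun := fun f => tensFun hij f k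
      map_add' := fun f f' => by
        apply Lp.ext
        filter_upwards [coeFn_tensFun hij (f + f') k, coeFn_tensFun hij f k,
          coeFn_tensFun hij f' k, Lp.coeFn_add (tensFun hij f k) (tensFun hij f' k),
          (quasi_left hij).ae (Lp.coeFn_add f f')] with c h1 h2 h3 h4 h5
        rw [h1, h4, Pi.add_apply, h2, h3, h5, Pi.add_apply, add_mul]
      map_smul' := fun z f => by
        apply Lp.ext
        filter_upwards [coeFn_tensFun hij (z • f) k, coeFn_tensFun hij f k,
          Lp.coeFn_smul z (tensFun hij f k),
          (quasi_left hij).ae (Lp.coeFn_smul z f)] with c h1 h2 h4 h5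
        rw [h1, RingHom.id_apply, h4, Pi.smul_apply, h2, h5, Pi.smul_apply, smul_eq_mul,
          smul_eq_mul, mul_assoc] }
    ‖k‖ fun f => by
      rw [mul_comm]
      exact (norm_tensFun hij f k).le

theorem coeFn_tens (hij : Function.Bijective (Sum.elim i j)) (f : L2 G κ) (k : L2 G μ) :
    (tens hij k f : (ι → G) → ℂ) =ᵐ[configMeasure G ι] fun c => f (c ∘ i) * k (c ∘ j) :=
  coeFn_tensFun hij f k

theorem inner_tens (hij : Function.Bijective (Sum.elim i j)) (f : L2 G κ) (k : L2 G μ) (χ : L2 G ι) :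
    ⟪tens hij k f, χ⟫_ℂ =
      ∫ c : ι → G, conj (f (c ∘ i) * k (c ∘ j)) * χ c ∂(configMeasure G ι) := by
  rw [L2.inner_def]
  refine integral_congr_ae ?_
  filter_upwards [coeFn_tens hij f k] with c hc
  rw [hc, RCLike.inner_apply, mul_comm]

theorem shift_tens (hij : Function.Bijective (Sum.elim i j)) (a b : ι → G) (f : L2 G κ) (k : L2 G μ) :
    shift a b (tens hij k f) = tens hij (shift (a ∘ j) (b ∘ j) k) (shift (a ∘ i) (b ∘ i) f) := by
  apply Lp.ext
  filter_upwards [coeFn_shift a b (tens hij k f),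
    (shift_measurePreserving a b).quasiMeasurePreserving.ae (coeFn_tens hij f k),
    coeFn_tens hij (shift (a ∘ i) (b ∘ i) f) (shift (a ∘ j) (b ∘ j) k),
    (quasi_left hij).ae (coeFn_shift (a ∘ i) (b ∘ i) f),
    (quasi_right hij).ae (coeFn_shift (a ∘ j) (b ∘ j) k)] with c h1 h2 h3 h4 h5
  rw [h1, h2, h3, h4, h5]
  rfl

variable (hij : Function.Bijective (Sum.elim i j)) (K : Submodule ℂ (L2 G κ)) [CompleteSpace K]

/-- The partial inner product with a vector `k` in the second factor, projected to `K`. -/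
def pTens (k : L2 G μ) : L2 G ι →L[ℂ] K :=
  K.orthogonalProjectionOnto ∘L ContinuousLinearMap.adjoint (tens hij k)

theorem inner_pTens (f : K) (k : L2 G μ) (χ : L2 G ι) :
    ⟪f, pTens hij K k χ⟫_ℂ = ⟪tens hij k (f : L2 G κ), χ⟫_ℂ := by
  rw [pTens, ContinuousLinearMap.comp_apply,
    Submodule.inner_orthogonalProjectionOnto_eq_of_mem_left,
    ContinuousLinearMap.adjoint_inner_right]

/-- Replaces the test against product vectors by an identity between bounded linear images of χ and
χ', which is compatible with shifts and with integrals of operators. -/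
theorem actsAs_iff (A : K →L[ℂ] K) (χ χ' : L2 G ι) :
    ActsAs i j K A χ χ' ↔ ∀ k, pTens hij K k χ' = A (pTens hij K k χ) := by
  have key : ∀ (f : K) (k : L2 G μ),
      (∫ c : ι → G, conj ((f : L2 G κ) (c ∘ i) * k (c ∘ j)) * χ' c ∂(configMeasure G ι) =
        ∫ c : ι → G, conj ((ContinuousLinearMap.adjoint A f : L2 G κ) (c ∘ i) * k (c ∘ j)) * χ c
        ∂(configMeasure G ι)) ↔
      ⟪f, pTens hij K k χ'⟫_ℂ = ⟪f, A (pTens hij K k χ)⟫_ℂ := by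
    intro f k
    rw [inner_pTens, ← ContinuousLinearMap.adjoint_inner_left, inner_pTens, inner_tens, inner_tens]
  constructor
  · intro h k
    exact ext_inner_left ℂ fun f => (key f k).1 (h f k)
  · intro h f k
    rw [key, h]

/-- Shifts carry the action of `A` to the action of its conjugate. -/
theorem pTens_shift (a b : ι → G) (U : K → K)
    (hU : ∀ f : K, (U f : L2 G κ) = shift (a ∘ i) (b ∘ i) f)
    (U' : K → K) (hU' : ∀ f : K, (U' f : L2 G κ) = shift (a ∘ i)⁻¹ (b ∘ i)⁻¹ f)
    (k : L2 G μ) (χ : L2 G ι) :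
    pTens hij K k (shift a b χ) = U (pTens hij K (shift (a ∘ j)⁻¹ (b ∘ j)⁻¹ k) χ) := by
  refine ext_inner_left ℂ fun f => ?_
  have h1 := inner_shift a⁻¹ b⁻¹ (tens hij k (f : L2 G κ)) χ
  rw [inv_inv, inv_inv] at h1
  have h2 : ∀ p : K, ⟪f, U p⟫_ℂ = ⟪U' f, p⟫_ℂ := by
    intro p
    rw [Submodule.coe_inner, Submodule.coe_inner, hU, hU', inner_shift, inv_inv, inv_inv]
  rw [inner_pTens, h2, inner_pTens, ← h1, shift_tens, hU']
  rfl

end Split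

end Wave

end LGT

namespace LGT

/-! ### Averages of families of operators -/

/-- The average is taken vector by vector as a Bochner integral; the uniform bound makes it a
bounded operator. -/
theorem exists_integral_operator {H : Type*} [NormedAddCommGroup H] [NormedSpace ℂ H]
    [CompleteSpace H] {Ω : Type*} [MeasurableSpace Ω] (P : Measure Ω) [IsProbabilityMeasure P]
    (F : Ω → H →L[ℂ] H) (M : ℝ) (hM : ∀ ω, ‖F ω‖ ≤ M)
    (hF : ∀ y, AEStronglyMeasurable (fun ω => F ω y) P) :
    ∃ B : H →L[ℂ] H, ∀ y, Integrable (fun ω => F ω y) P ∧ B y = ∫ ω, F ω y ∂P := by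
  have hb : ∀ y ω, ‖F ω y‖ ≤ M * ‖y‖ := fun y ω =>
    ((F ω).le_opNorm y).trans (by gcongr; exact hM ω)
  have hi : ∀ y, Integrable (fun ω => F ω y) P := fun y =>
    Integrable.of_bound (hF y) (M * ‖y‖) (ae_of_all _ (hb y))
  refine ⟨LinearMap.mkContinuous
    { toFun := fun y => ∫ ω, F ω y ∂P
      map_add' := fun y z => by simp_rw [map_add]; exact integral_add (hi y) (hi z)
      map_smul' := fun c y => by simp_rw [map_smul]; exact integral_smul c _ }
    M fun y => ?_, fun y => ⟨hi y, rfl⟩⟩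
  have := norm_integral_le_of_norm_le_const (μ := P) (ae_of_all _ (hb y))
  simpa using this

/-! ### Slices of wave functions: A ⊗ 1 acts slice by slice. -/

section Slices

variable {G : Type*} [Group G] [TopologicalSpace G] [IsTopologicalGroup G] [CompactSpace G]
  [T2Space G] [SecondCountableTopology G] [MeasurableSpace G] [BorelSpace G]
variable {ι κ μ : Type*} [Fintype ι] [Fintype κ] [Fintype μ]
variable {i : κ → ι} {j : μ → ι} (hij : Function.Bijective (Sum.elim i j))

theorem memLp_glue (χ : L2 G ι) :
    MemLp (fun p : (κ → G) × (μ → G) => χ (glue hij p.1 p.2)) 2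
      ((configMeasure G κ).prod (configMeasure G μ)) :=
  (Lp.memLp χ).comp_measurePreserving (measurePreserving_glue hij)

theorem ae_memLp_slice (χ : L2 G ι) :
    ∀ᵐ z ∂(configMeasure G μ), MemLp (fun x => χ (glue hij x z)) 2 (configMeasure G κ) := by
  have h := memLp_glue hij χ
  have h1 := ((memLp_two_iff_integrable_sq_norm h.1).1 h).prod_left_ae
  have h2 := h.1.prod_swap.prodMk_left
  filter_upwards [h1, h2] with z hz1 hz2
  exact (memLp_two_iff_integrable_sq_norm hz2).2 hz1

theorem integrable_slice (f : L2 G κ) (χ : L2 G ι) :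
    Integrable (fun p : (κ → G) × (μ → G) => conj (f p.1) * χ (glue hij p.1 p.2))
      ((configMeasure G κ).prod (configMeasure G μ)) := by
  have hf : MemLp (fun p : (κ → G) × (μ → G) => f p.1) 2
      ((configMeasure G κ).prod (configMeasure G μ)) :=
    (Lp.memLp f).comp_measurePreserving measurePreserving_fst
  exact hf.star.integrable_mul (memLp_glue hij χ)

/-- The partial inner product of `f` with the slice of `χ` at `z`. -/
def sliceInner (f : L2 G κ) (χ : L2 G ι) (z : μ → G) : ℂ :=
  ∫ x, conj (f x) * χ (glue hij x z) ∂(configMeasure G κ)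

theorem integrable_sliceInner (f : L2 G κ) (χ : L2 G ι) :
    Integrable (sliceInner hij f χ) (configMeasure G μ) :=
  (integrable_slice hij f χ).integral_prod_right

theorem inner_tens_eq (f : L2 G κ) (k : L2 G μ) (χ : L2 G ι) :
    ⟪tens hij k f, χ⟫_ℂ = ∫ z, conj (k z) * sliceInner hij f χ z ∂(configMeasure G μ) := by
  have hint := (L2.integrable_inner (𝕜 := ℂ) (tens hij k f) χ)
  have hg := measurePreserving_glue (G := G) hij
  have hae : (fun p : (κ → G) × (μ → G) => conj (k p.2) * (conj (f p.1) * χ (glue hij p.1 p.2)))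
      =ᵐ[(configMeasure G κ).prod (configMeasure G μ)]
      fun p => ⟪tens hij k f (glue hij p.1 p.2), χ (glue hij p.1 p.2)⟫_ℂ := by
    filter_upwards [hg.quasiMeasurePreserving.ae (coeFn_tens hij f k)] with p hp
    rw [hp, glue_comp_left, glue_comp_right, RCLike.inner_apply, map_mul]
    ring
  rw [L2.inner_def, ← hg.integral_comp (measurableEmbedding_glue hij), ← integral_congr_ae hae,
    integral_prod_symm _ ((hg.integrable_comp_of_integrable hint).congr hae.symm)]
  refine integral_congr_ae (ae_of_all _ fun z => ?_)
  exact integral_const_mul (conj (k z)) fun x => conj (f x) * χ (glue hij x z)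

variable (K : Submodule ℂ (L2 G κ)) [CompleteSpace K]

/-- Indicators of measurable sets, as second factors k, yield the set integrals of the slice inner
products, and these determine an integrable function almost everywhere. -/
theorem actsAs_iff_slice (A : K →L[ℂ] K) (χ χ' : L2 G ι) :
    ActsAs i j K A χ χ' ↔ ∀ f : K, sliceInner hij (f : L2 G κ) χ' =ᵐ[configMeasure G μ]
      sliceInner hij (ContinuousLinearMap.adjoint A f : L2 G κ) χ := by
  have key : ActsAs i j K A χ χ' ↔ ∀ (f : K) (k : L2 G μ),
      ∫ z, conj (k z) * sliceInner hij (f : L2 G κ) χ' z ∂(configMeasure G μ) =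
      ∫ z, conj (k z) * sliceInner hij (ContinuousLinearMap.adjoint A f : L2 G κ) χ z
        ∂(configMeasure G μ) := by
    simp_rw [← inner_tens_eq, inner_tens]
    rfl
  rw [key]
  constructor
  · intro h f
    refine Integrable.ae_eq_of_forall_setIntegral_eq _ _ (integrable_sliceInner hij _ _)
      (integrable_sliceInner hij _ _) fun s hs hfin => ?_
    have h1 := h f (indicatorConstLp 2 hs hfin.ne 1)
    have h2 : ∀ F : (μ → G) → ℂ, ∫ z, conj ((indicatorConstLp 2 hs hfin.ne (1 : ℂ) :
        L2 G μ) z) * F z ∂(configMeasure G μ) = ∫ z in s, F z ∂(configMeasure G μ) := by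
      intro F
      rw [← integral_indicator hs]
      refine integral_congr_ae ?_
      filter_upwards [indicatorConstLp_coeFn (p := 2) (hs := hs) (hμs := hfin.ne) (c := (1 : ℂ))]
        with z hz
      rw [hz]
      by_cases hzs : z ∈ s <;> simp [hzs]
    rwa [h2, h2] at h1
  · intro h f k
    refine integral_congr_ae ?_
    filter_upwards [h f] with z hz
    rw [hz]

/-- Makes the exceptional null set independent of f: a dense sequence in K is handled first, and
almost every slice is square integrable, hence continuous as a functional of f. This is needed in
`mem_electricCenter`, where the test vector varies with the exterior configuration. -/
theorem ae_forall_sliceInner_eq (T : K →L[ℂ] K) (χ χ' : L2 G ι)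
    (h : ∀ f : K, sliceInner hij (f : L2 G κ) χ' =ᵐ[configMeasure G μ]
      sliceInner hij (T f : L2 G κ) χ) :
    ∀ᵐ z ∂(configMeasure G μ), ∀ f : K, sliceInner hij (f : L2 G κ) χ' z =
      sliceInner hij (T f : L2 G κ) χ z := by
  have : Nonempty K := ⟨0⟩
  have hK : TopologicalSpace.SeparableSpace K :=
    (TopologicalSpace.IsSeparable.of_separableSpace (K : Set (L2 G κ))).separableSpace
  have hs : ∀ᵐ z ∂(configMeasure G μ), ∀ n,
      sliceInner hij (TopologicalSpace.denseSeq K n : L2 G κ) χ' z =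
      sliceInner hij (T (TopologicalSpace.denseSeq K n) : L2 G κ) χ z :=
    ae_all_iff.2 fun n => h _
  have hcont : ∀ (η : L2 G ι) (z : μ → G),
      MemLp (fun x => η (glue hij x z)) 2 (configMeasure G κ) →
      Continuous fun f : L2 G κ => sliceInner hij f η z := by
    intro η z hz
    have : (fun f : L2 G κ => sliceInner hij f η z) = fun f : L2 G κ => ⟪f, hz.toLp _⟫_ℂ := by
      ext f
      rw [L2.inner_def]
      refine integral_congr_ae ?_
      filter_upwards [hz.coeFn_toLp] with x hx
      rw [hx, RCLike.inner_apply, mul_comm]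
    rw [this]
    fun_prop
  filter_upwards [hs, ae_memLp_slice hij χ, ae_memLp_slice hij χ'] with z h1 h2 h3 f
  refine congrFun ((TopologicalSpace.denseRange_denseSeq K).equalizer
    ((hcont χ' z h3).comp continuous_subtype_val)
    ((hcont χ z h2).comp (continuous_subtype_val.comp T.continuous)) (funext h1)) f

end Slices

/-! ### Gauge transformations -/

namespace Lattice

variable {V E : Type*} (Λ : Lattice V E) [Fintype E]
variable {G : Type*} [Group G] [TopologicalSpace G] [IsTopologicalGroup G] [CompactSpace G]
  [T2Space G] [SecondCountableTopology G] [MeasurableSpace G] [BorelSpace G]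
variable {κ : Type*} [Fintype κ] (i : κ → E)

theorem gauge_gauge (h h' : V → G) (ψ : L2 G κ) :
    Λ.gauge i h (Λ.gauge i h' ψ) = Λ.gauge i (h * h') ψ :=
  shift_shift _ _ _ _ ψ

theorem gauge_inv_gauge (h : V → G) (ψ : L2 G κ) : Λ.gauge i h⁻¹ (Λ.gauge i h ψ) = ψ :=
  shift_inv_shift _ _ ψ

theorem gauge_gauge_inv (h : V → G) (ψ : L2 G κ) : Λ.gauge i h (Λ.gauge i h⁻¹ ψ) = ψ :=
  shift_shift_inv _ _ ψ

theorem gauge_mem_invariants {P : Set (V → G)} {u : V → G} (hu : ∀ h ∈ P, Commute h u)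
    {ψ : L2 G κ} (hψ : ψ ∈ Λ.invariants i P) : Λ.gauge i u ψ ∈ Λ.invariants i P := by
  intro h hh
  rw [gauge_gauge, (hu h hh).eq, ← gauge_gauge, hψ h hh]

/-- A gauge transformation that commutes with those in `P`, on the vectors invariant under `P`. -/
def gaugeIso (P : Set (V → G)) (u : V → G) (hu : ∀ h ∈ P, Commute h u) :
    Λ.invariants i P ≃ₗᵢ[ℂ] Λ.invariants i P where
  toFun f := ⟨Λ.gauge i u f, Λ.gauge_mem_invariants i hu f.2⟩
  invFun f := ⟨Λ.gauge i u⁻¹ f, Λ.gauge_mem_invariants i (fun h hh => (hu h hh).inv_right) f.2⟩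
  map_add' _ _ := Subtype.ext (map_add (Λ.gauge i u) _ _)
  map_smul' z _ := Subtype.ext (map_smul (Λ.gauge i u) z _)
  left_inv f := Subtype.ext (Λ.gauge_inv_gauge i u f)
  right_inv f := Subtype.ext (Λ.gauge_gauge_inv i u f)
  norm_map' f := (Λ.gauge i u).norm_map f

theorem commute_offCornerGauge_cornerGauge {h u : V → G} (hh : h ∈ Λ.offCornerGauge G)
    (hu : u ∈ Λ.cornerGauge G) : Commute h u := by
  ext v
  by_cases hv : v ∈ Λ.corner
  · simp [hh v (Or.inr hv)]
  · simp [hu v hv]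

end Lattice

end LGT

namespace LGT

namespace Lattice

variable {V E : Type*} {Λ : Lattice V E}

/-! ### Paths and holonomies -/

/-- Running through an edge twice in the same direction repeats its end vertex; in opposite
directions, it returns to the vertex where the first passage started. -/
theorem IsPath.nodup_edges {v w : V} {l : List (Step E)} (h : Λ.IsPath v l w) :
    (l.map Prod.fst).Nodup := by
  induction l generalizing v with
  | nil => simp
  | cons s l ih =>
    obtain ⟨⟨hs, hw⟩, hn⟩ := h
    rw [List.map_cons, List.nodup_cons] at hn
    rw [List.map_cons, List.nodup_cons]
    refine ⟨fun hmem => ?_, ih ⟨hw, hn.2⟩⟩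
    obtain ⟨t, ht, hts⟩ := List.mem_map.1 hmem
    have htm : Λ.stepTgt t ∈ l.map Λ.stepTgt := List.mem_map_of_mem ht
    by_cases hb : t.2 = s.2
    · have : t = s := Prod.ext hts hb
      rw [this] at htm
      exact (List.nodup_cons.1 hn.2).1 htm
    · have : Λ.stepTgt t = v := by
        rw [← hs, stepTgt, stepSrc, hts]
        cases h1 : t.2 <;> cases h2 : s.2 <;> simp_all
      rw [this] at htm
      exact hn.1 (List.mem_cons_of_mem _ htm)

section Group

variable {G : Type*} [Group G]

theorem hol_congr {c c' : E → G} {l : List (Step E)} (h : ∀ s ∈ l, c s.1 = c' s.1) :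
    hol c l = hol c' l := by
  induction l with
  | nil => rfl
  | cons s l ih =>
    rw [hol, hol, ih fun t ht => h t (List.mem_cons_of_mem _ ht), stepHol, stepHol,
      h s List.mem_cons_self]

theorem hol_append_singleton (c : E → G) (l : List (Step E)) (s : Step E) :
    hol c (l ++ [s]) = stepHol c s * hol c l := by
  induction l with
  | nil => simp [hol]
  | cons t l ih => rw [List.cons_append, hol, ih, hol, mul_assoc]

end Group

namespace ExtrinsicFrame

variable [Fintype E] (Φ : Λ.ExtrinsicFrame)

theorem line_ne_nil {v : V} (hv : v ∈ Λ.corner) : Φ.line v ≠ [] := by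
  intro h
  have h1 := (Φ.isPath v hv).1
  rw [h] at h1
  have h2 := Φ.anchor_mem v hv
  rw [show Φ.anchor v = v from h1] at h2
  exact Finset.disjoint_left.1 Λ.corner_disjoint_bdry hv h2

theorem eq_of_mem_line {v w : V} (hv : v ∈ Λ.corner) (hw : w ∈ Λ.corner) {s t : Step E}
    (hs : s ∈ Φ.line v) (ht : t ∈ Φ.line w) (h : s.1 = t.1) : v = w := by
  by_contra hne
  exact Φ.edge_disjoint v hv w hw hne s hs t ht h

theorem exists_last (r : Φ.lastEdges) :
    ∃ v ∈ Λ.corner, ∃ b : Bool, (Φ.line v).getLast? = some ((r : E), b) := by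
  have := r.2
  simpa only [lastEdges, Finset.mem_filter, Finset.mem_univ, true_and] using this

/-- The corner vertex whose Wilson line ends with the given edge. -/
def lastVertex (r : Φ.lastEdges) : V := (Φ.exists_last r).choose

theorem lastVertex_mem (r : Φ.lastEdges) : Φ.lastVertex r ∈ Λ.corner :=
  (Φ.exists_last r).choose_spec.1

/-- The direction in which a Wilson line runs through its last edge. -/
def lastDir (r : Φ.lastEdges) : Bool := (Φ.exists_last r).choose_spec.2.choose

theorem getLast?_line (r : Φ.lastEdges) :
    (Φ.line (Φ.lastVertex r)).getLast? = some ((r : E), Φ.lastDir r) :=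
  (Φ.exists_last r).choose_spec.2.choose_spec

theorem exists_lastVertex {v : V} (hv : v ∈ Λ.corner) : ∃ r, Φ.lastVertex r = v := by
  have h := List.getLast?_eq_some_getLast (Φ.line_ne_nil hv)
  set s := (Φ.line v).getLast (Φ.line_ne_nil hv)
  have hr : s.1 ∈ Φ.lastEdges := by
    simp only [lastEdges, Finset.mem_filter, Finset.mem_univ, true_and]
    exact ⟨v, hv, s.2, h⟩
  refine ⟨⟨s.1, hr⟩, ?_⟩
  exact Φ.eq_of_mem_line (Φ.lastVertex_mem _) hv
    (List.mem_of_getLast? (Φ.getLast?_line ⟨s.1, hr⟩)) (List.mem_of_getLast? h) rfl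

/-- Makes the passage to frame variables triangular: each line contains exactly one removed link,
its own last one. By edge-disjointness an edge of this line can only be the last edge of this line,
and a path uses it once. -/
theorem notMem_lastEdges_of_mem_dropLast {v : V} (hv : v ∈ Λ.corner) {t : Step E}
    (ht : t ∈ (Φ.line v).dropLast) : t.1 ∉ Φ.lastEdges := by
  intro hr
  have hl := Φ.getLast?_line ⟨t.1, hr⟩
  have hvw : v = Φ.lastVertex ⟨t.1, hr⟩ :=
    Φ.eq_of_mem_line hv (Φ.lastVertex_mem _) (List.mem_of_mem_dropLast ht)
      (List.mem_of_getLast? hl) rfl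
  rw [← hvw] at hl
  have hn := (Φ.isPath v hv).nodup_edges
  rw [← List.dropLast_append_getLast? _ hl, List.map_append, List.nodup_append] at hn
  exact hn.2.2 _ (List.mem_map_of_mem ht) _ (by simp) rfl

section Group

variable {G : Type*} [Group G]

theorem hol_line_lastVertex (c : E → G) (r : Φ.lastEdges) :
    hol c (Φ.line (Φ.lastVertex r)) =
      (if Φ.lastDir r then c r else (c r)⁻¹) * hol c (Φ.line (Φ.lastVertex r)).dropLast := by
  conv_lhs => rw [← List.dropLast_append_getLast? _ (Φ.getLast?_line r)]
  rw [hol_append_singleton]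
  rfl

/-! ### Reorientations -/

theorem reorientAt_of_head {h : Λ.corner → G} {v : Λ.corner} {e : E} {b : Bool}
    (hv : (Φ.line v).head? = some (e, b)) : Φ.reorientAt h b e = h v := by
  have hex : ∃ v : Λ.corner, (Φ.line v).head? = some (e, b) := ⟨v, hv⟩
  rw [reorientAt, dif_pos hex]
  congr 1
  exact Subtype.ext (Φ.eq_of_mem_line hex.choose.2 v.2 (List.mem_of_mem_head? hex.choose_spec)
    (List.mem_of_mem_head? hv) rfl)

theorem reorientAt_eq_one {h : Λ.corner → G} {e : E} {b : Bool}
    (hv : ∀ v : Λ.corner, (Φ.line v).head? ≠ some (e, b)) : Φ.reorientAt h b e = 1 := by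
  rw [reorientAt, dif_neg]
  rintro ⟨v, h⟩
  exact hv v h

theorem reorientAt_of_mem_region {h : Λ.corner → G} {e : E} (he : e ∈ Λ.region) (b : Bool) :
    Φ.reorientAt h b e = 1 :=
  Φ.reorientAt_eq_one fun v hv => Φ.exterior v v.2 _ (List.mem_of_mem_head? hv) he

/-- The translated end of a first edge is an anchor, in the global boundary. Small gauge
transformations and dressings are trivial there, so their parameters commute with those of
reorientations. -/
theorem anchor_of_reorientAt_ne_one {h : Λ.corner → G} {e : E} {b : Bool}
    (hne : Φ.reorientAt h b e ≠ 1) : (if b then Λ.src e else Λ.tgt e) ∈ Λ.bdry := by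
  by_contra hb
  apply hne
  refine Φ.reorientAt_eq_one fun v hv => hb ?_
  have h1 := (Φ.isPath v v.2).1
  obtain ⟨l, hl⟩ : ∃ l, Φ.line v = (e, b) :: l := by
    cases hline : Φ.line v with
    | nil => rw [hline] at hv; simp at hv
    | cons s l => rw [hline] at hv; exact ⟨l, by simpa using hv⟩
  rw [hl] at h1
  have h2 : (if b then Λ.src e else Λ.tgt e) = Φ.anchor v := h1.1
  rw [h2]
  exact Φ.anchor_mem v v.2

theorem reorientAt_inv (h : Λ.corner → G) (b : Bool) :
    Φ.reorientAt h⁻¹ b = (Φ.reorientAt h b)⁻¹ := by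
  ext e
  rw [Pi.inv_apply]
  unfold reorientAt
  split_ifs <;> simp

/-- The action of a reorientation on configurations. -/
def reorientConfig (h : Λ.corner → G) (c : E → G) (e : E) : G :=
  (Φ.reorientAt h false e)⁻¹ * c e * Φ.reorientAt h true e

/-- The factor is `h v` and not its inverse, because a unitary acts on wave functions through the
inverse map on configurations. -/
theorem hol_reorientConfig (h : Λ.corner → G) (c : E → G) (v : Λ.corner) :
    hol (Φ.reorientConfig h c) (Φ.line v) = hol c (Φ.line v) * h v := by
  obtain ⟨s, l, hl⟩ : ∃ s l, Φ.line v = s :: l := by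
    cases hline : Φ.line v with
    | nil => exact absurd hline (Φ.line_ne_nil v.2)
    | cons s l => exact ⟨s, l, rfl⟩
  have hn := (Φ.isPath v v.2).nodup_edges
  rw [hl, List.map_cons, List.nodup_cons] at hn
  have hs : s ∈ Φ.line v := by rw [hl]; exact List.mem_cons_self
  -- A line beginning at an edge of the line of v shares that edge with it, so it is the line of v
  -- itself, and that one begins with the step s.
  have hother : ∀ t ∈ Φ.line v, ∀ b, t.1 ≠ s.1 ∨ b ≠ s.2 → Φ.reorientAt h b t.1 = 1 := by
    intro t ht b hor
    refine Φ.reorientAt_eq_one fun w hw => ?_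
    have hwv : (w : V) = v := Φ.eq_of_mem_line w.2 v.2 (List.mem_of_mem_head? hw) ht rfl
    rw [hwv, hl, List.head?_cons, Option.some.injEq] at hw
    rcases hor with h1 | h1
    · exact h1 (congrArg Prod.fst hw).symm
    · exact h1 (congrArg Prod.snd hw).symm
  have hself : Φ.reorientAt h s.2 s.1 = h v := Φ.reorientAt_of_head (by rw [hl]; rfl)
  have hrest : hol (Φ.reorientConfig h c) l = hol c l := by
    refine hol_congr fun t ht => ?_
    have hne : t.1 ≠ s.1 := fun he => hn.1 (he ▸ List.mem_map_of_mem ht)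
    have htv : t ∈ Φ.line v := by rw [hl]; exact List.mem_cons_of_mem _ ht
    rw [reorientConfig, hother t htv false (Or.inl hne), hother t htv true (Or.inl hne)]
    simp
  have hfirst : stepHol (Φ.reorientConfig h c) s = stepHol c s * h v := by
    obtain ⟨e, b⟩ := s
    cases b
    · have h1 : Φ.reorientAt h true e = 1 := hother _ hs true (Or.inr (by simp))
      have h2 : Φ.reorientAt h false e = h v := hself
      simp [stepHol, reorientConfig, h1, h2]
    · have h1 : Φ.reorientAt h false e = 1 := hother _ hs false (Or.inr (by simp))
      have h2 : Φ.reorientAt h true e = h v := hself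
      simp [stepHol, reorientConfig, h1, h2]
  rw [hl, hol, hol, hrest, hfirst, mul_assoc]

open scoped Classical in
/-- The corner gauge transformation that is induced in the perspective of the frame by a
reorientation. -/
def cornerParam (g : V → G) (h : Λ.corner → G) (v : V) : G :=
  if hv : v ∈ Λ.corner then g v * h ⟨v, hv⟩ * (g v)⁻¹ else 1

theorem cornerParam_mem (g : V → G) (h : Λ.corner → G) :
    cornerParam g h ∈ Λ.cornerGauge G := fun v hv => by
  rw [cornerParam, dif_neg hv]

theorem cornerParam_mul (g : V → G) (h h' : Λ.corner → G) :
    cornerParam g (h * h') = cornerParam g h * cornerParam g h' := by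
  ext v
  rw [Pi.mul_apply]
  unfold cornerParam
  split_ifs <;> simp

theorem cornerParam_inv (g : V → G) (h : Λ.corner → G) :
    cornerParam g h⁻¹ = (cornerParam g h)⁻¹ := by
  ext v
  rw [Pi.inv_apply]
  unfold cornerParam
  split_ifs <;> simp [mul_assoc]

theorem exists_cornerParam (g : V → G) {u : V → G} (hu : u ∈ Λ.cornerGauge G) :
    ∃ h : Λ.corner → G, cornerParam g h = u := by
  refine ⟨fun v => (g v)⁻¹ * u v * g v, ?_⟩
  ext v
  unfold cornerParam
  split_ifs with hv
  · simp [mul_assoc]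
  · exact (hu v hv).symm

theorem dressing_reorientConfig (g : V → G) (h : Λ.corner → G) (c : E → G) (v : V) :
    Λ.dressing Φ.line g (Φ.reorientConfig h c) v =
      (cornerParam g h v)⁻¹ * Λ.dressing Φ.line g c v := by
  unfold dressing cornerParam
  split_ifs with hv
  · rw [Φ.hol_reorientConfig h c ⟨v, hv⟩]
    group
  · simp

theorem dressing_of_bdry {line : V → List (Step E)} {g : V → G} {c : E → G} {v : V}
    (hv : v ∈ Λ.bdry) : Λ.dressing line g c v = 1 := by
  rw [dressing, if_neg]
  exact fun h => Finset.disjoint_left.1 Λ.corner_disjoint_bdry h hv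

/-- After dressing, a reorientation is again a shift: the corner gauge transformation g h g⁻¹
combined with the translation of the first links, which lie outside the region. The factors can be
reordered since dressing is trivial at the anchors. -/
theorem dressed_reorientConfig (g : V → G) (h : Λ.corner → G) (c : E → G)
    (e : {e : E // e ∉ Φ.lastEdges}) :
    Λ.dressed Φ.line Φ.lastEdges g (Φ.reorientConfig h c) e =
      (Φ.reorientAt h false e * cornerParam g h (Λ.tgt e))⁻¹ *
        Λ.dressed Φ.line Φ.lastEdges g c e *
        (Φ.reorientAt h true e * cornerParam g h (Λ.src e)) := by
  have h1 : Commute (Λ.dressing Φ.line g c (Λ.tgt e)) (Φ.reorientAt h false e)⁻¹ := by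
    by_cases hr : Φ.reorientAt h false e = 1
    · rw [hr]; simp
    · have := Φ.anchor_of_reorientAt_ne_one hr
      rw [dressing_of_bdry (by simpa using this)]
      exact Commute.one_left _
  have h2 : Commute (Λ.dressing Φ.line g c (Λ.src e))⁻¹ (Φ.reorientAt h true e) := by
    by_cases hr : Φ.reorientAt h true e = 1
    · rw [hr]; simp
    · have := Φ.anchor_of_reorientAt_ne_one hr
      rw [dressing_of_bdry (by simpa using this), inv_one]
      exact Commute.one_left _
  rw [dressed, dressed, dressing_reorientConfig, dressing_reorientConfig, reorientConfig]
  calc _ = (cornerParam g h (Λ.tgt e))⁻¹ *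
        (Λ.dressing Φ.line g c (Λ.tgt e) * (Φ.reorientAt h false e)⁻¹) * c e *
        (Φ.reorientAt h true e * (Λ.dressing Φ.line g c (Λ.src e))⁻¹) *
        cornerParam g h (Λ.src e) := by group
    _ = _ := by rw [h1.eq, ← h2.eq]; group

end Group

end ExtrinsicFrame

end Lattice

end LGT

/-! ### Extrinsic frames: dressing preserves Haar measure. -/

namespace LGT

namespace Lattice

open scoped Classical

variable {V E : Type*} {Λ : Lattice V E} [Fintype E]
variable {G : Type*} [Group G] [TopologicalSpace G] [IsTopologicalGroup G] [CompactSpace G]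
  [T2Space G] [SecondCountableTopology G] [MeasurableSpace G] [BorelSpace G]

theorem bijective_elim_subtype {α : Type*} (p : α → Prop) :
    Function.Bijective (Sum.elim (fun a : {a // p a} => (a : α)) fun a : {a // ¬ p a} => (a : α)) := by
  classical
  exact (Equiv.sumCompl p).bijective

theorem continuous_dressing (line : V → List (Step E)) (g : V → G) (v : V) :
    Continuous fun c : E → G => Λ.dressing line g c v := by
  unfold dressing
  split_ifs
  · exact continuous_const.mul (continuous_hol _).inv
  · exact continuous_const

theorem continuous_dressed (line : V → List (Step E)) (R : Finset E) (g : V → G) :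
    Continuous fun c : E → G => Λ.dressed line R g c :=
  continuous_pi fun _ => ((continuous_dressing line g _).mul (continuous_apply _)).mul
    (continuous_dressing line g _).inv

theorem bijective_elim_notMem (R : Finset E) :
    Function.Bijective (Sum.elim (fun a : {e : E // e ∉ R} => (a : E)) fun a : R => (a : E)) := by
  classical
  have h := ((Equiv.sumComm _ _).trans (Equiv.sumCompl (fun e : E => e ∈ R))).bijective
  convert h using 1
  ext s
  rcases s with s | s <;> rfl

namespace ExtrinsicFrame

variable (Φ : Λ.ExtrinsicFrame)

open scoped Classical in
/-- The dressing transformation as a function of the values of the frame variables. -/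
def frameDressing (g : V → G) (φ : Φ.lastEdges → G) (v : V) : G :=
  if h : ∃ r, Φ.lastVertex r = v then g v * (φ h.choose)⁻¹ else 1

theorem frameDressing_eq (g : V → G) (φ : Φ.lastEdges → G) (c : E → G)
    (hφ : ∀ r, φ r = hol c (Φ.line (Φ.lastVertex r))) (v : V) :
    Φ.frameDressing g φ v = Λ.dressing Φ.line g c v := by
  rw [frameDressing, dressing]
  by_cases hv : v ∈ Λ.corner
  · have hex := Φ.exists_lastVertex hv
    rw [dif_pos hex, if_pos hv, hφ, hex.choose_spec]
  · rw [dif_neg, if_neg hv]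
    rintro ⟨r, rfl⟩
    exact hv (Φ.lastVertex_mem r)

theorem continuous_frameDressing (g : V → G) (v : V) :
    Continuous fun φ : Φ.lastEdges → G => Φ.frameDressing g φ v := by
  unfold frameDressing
  split_ifs
  · exact continuous_const.mul (continuous_apply _).inv
  · exact continuous_const

theorem continuous_glue {ι κ μ : Type*} {i : κ → ι} {j : μ → ι}
    (hij : Function.Bijective (Sum.elim i j)) :
    Continuous fun p : (κ → G) × (μ → G) => glue hij p.1 p.2 := by
  refine continuous_pi fun k => ?_
  unfold glue
  rcases (Equiv.ofBijective _ hij).symm k with s | s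
  · exact (continuous_apply s).comp continuous_fst
  · exact (continuous_apply s).comp continuous_snd

/-- The change of variables that replaces the last links by the frame variables. -/
theorem measurePreserving_frameVariables :
    MeasurePreserving (fun p : ({e : E // e ∉ Φ.lastEdges} → G) × (Φ.lastEdges → G) =>
      (p.1, fun r : Φ.lastEdges => hol (glue (bijective_elim_notMem Φ.lastEdges) p.1 p.2)
        (Φ.line (Φ.lastVertex r))))
      ((configMeasure G _).prod (configMeasure G _))
      ((configMeasure G _).prod (configMeasure G _)) := by
  have hb := bijective_elim_notMem Φ.lastEdges
  refine (MeasurePreserving.id _).skew_product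
    (g := fun (q : {e : E // e ∉ Φ.lastEdges} → G) (p : Φ.lastEdges → G) (r : Φ.lastEdges) =>
      hol (glue hb q p) (Φ.line (Φ.lastVertex r))) ?_ (ae_of_all _ fun q => ?_)
  · exact (continuous_pi fun r => (continuous_hol _).comp (continuous_glue hb)).measurable
  -- For fixed remaining links q, each frame variable is its own last link, or the inverse of that
  -- link, times a constant. The constant involves no removed link, so these may be set to 1 in it.
  · have heq : (fun (p : Φ.lastEdges → G) (r : Φ.lastEdges) =>
        hol (glue hb q p) (Φ.line (Φ.lastVertex r))) = fun p r =>
        (if Φ.lastDir r then p r else (p r)⁻¹) *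
          hol (glue hb q 1) (Φ.line (Φ.lastVertex r)).dropLast := by
      ext p r
      rw [hol_line_lastVertex, glue_right]
      congr 1
      refine hol_congr fun t ht => ?_
      have := Φ.notMem_lastEdges_of_mem_dropLast (Φ.lastVertex_mem r) ht
      exact (glue_left hb q p ⟨t.1, this⟩).trans (glue_left hb q 1 ⟨t.1, this⟩).symm
    rw [heq]
    refine (measurePreserving_pi (fun _ : Φ.lastEdges => haarProb G) (fun _ => haarProb G)
      (f := fun r x => (if Φ.lastDir r then x else x⁻¹) *
        hol (glue hb q 1) (Φ.line (Φ.lastVertex r)).dropLast) fun r => ?_).map_eq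
    split_ifs
    · exact haarProb_map_mul_right _
    · exact (haarProb_map_mul_right _).comp haarProb_map_inv

/-- Replacing the last links by the frame variables preserves the measure; for fixed frame
variables, dressing is a left and right translation of the remaining links. This is what makes
`extend` an isometry. -/
theorem measurePreserving_dressed (g : V → G) :
    MeasurePreserving (Λ.dressed Φ.line Φ.lastEdges g) (configMeasure G E)
      (configMeasure G {e : E // e ∉ Φ.lastEdges}) := by
  have hb := bijective_elim_notMem Φ.lastEdges
  have h1 := measurePreserving_split (G := G) hb
  have h2 := Φ.measurePreserving_frameVariables (G := G)
  have h3 : MeasurePreserving (fun p : (Φ.lastEdges → G) × ({e : E // e ∉ Φ.lastEdges} → G) =>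
      (p.1, fun e : {e : E // e ∉ Φ.lastEdges} => Φ.frameDressing g p.1 (Λ.tgt e) * p.2 e *
        (Φ.frameDressing g p.1 (Λ.src e))⁻¹))
      ((configMeasure G _).prod (configMeasure G _))
      ((configMeasure G _).prod (configMeasure G _)) := by
    refine (MeasurePreserving.id _).skew_product
      (g := fun (φ : Φ.lastEdges → G) (q : {e : E // e ∉ Φ.lastEdges} → G)
        (e : {e : E // e ∉ Φ.lastEdges}) =>
        Φ.frameDressing g φ (Λ.tgt e) * q e * (Φ.frameDressing g φ (Λ.src e))⁻¹)
      ?_ (ae_of_all _ fun φ => ?_)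
    · refine (continuous_pi fun e => ?_).measurable
      exact (((Φ.continuous_frameDressing g _).comp continuous_fst).mul
        ((continuous_apply e).comp continuous_snd)).mul
        ((Φ.continuous_frameDressing g _).comp continuous_fst).inv
    · have := (shift_measurePreserving (G := G)
        (fun e : {e : E // e ∉ Φ.lastEdges} => (Φ.frameDressing g φ (Λ.tgt e))⁻¹)
        (fun e => (Φ.frameDressing g φ (Λ.src e))⁻¹)).map_eq
      simpa only [inv_inv] using this
  convert measurePreserving_snd.comp (h3.comp (Measure.measurePreserving_swap.comp (h2.comp h1)))
    using 1
  ext c e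
  simp only [Function.comp_apply, Prod.swap]
  rw [Φ.frameDressing_eq g _ c (fun r => ?_), Φ.frameDressing_eq g _ c (fun r => ?_)]
  · rfl
  all_goals exact congrArg (fun c' => hol c' _) (glue_comp hb c)

end ExtrinsicFrame

end Lattice

end LGT

/-! ### Electric twirl of physical operators and of operators on the region. -/

namespace LGT

namespace Lattice

open scoped Classical

variable {V E : Type*} {Λ : Lattice V E} [Fintype E]
variable {G : Type*} [Group G] [TopologicalSpace G] [IsTopologicalGroup G] [CompactSpace G]
  [T2Space G] [SecondCountableTopology G] [MeasurableSpace G] [BorelSpace G]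

theorem bijective_elim_sub {S R : Finset E} (hSR : ∀ e ∈ S, e ∉ R) :
    Function.Bijective (Sum.elim
      (fun e : S => (⟨e, hSR e e.2⟩ : {e : E // e ∉ R}))
      (fun e : {e : E // e ∉ S ∧ e ∉ R} => (⟨e, e.2.2⟩ : {e : E // e ∉ R}))) := by
  constructor
  · rintro (a | a) (b | b) h <;> simp only [Sum.elim_inl, Sum.elim_inr, Subtype.mk.injEq] at h
    · exact congrArg _ (Subtype.ext h)
    · exact absurd (h ▸ a.2) b.2.1
    · exact absurd (h ▸ b.2) a.2.1
    · exact congrArg _ (Subtype.ext h)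
  · intro e
    by_cases he : (e : E) ∈ S
    · exact ⟨Sum.inl ⟨e, he⟩, rfl⟩
    · exact ⟨Sum.inr ⟨e, he, e.2⟩, rfl⟩

theorem bijective_elim_finset (S : Finset E) :
    Function.Bijective (Sum.elim (fun a : S => (a : E)) fun a : {e : E // e ∉ S} => (a : E)) :=
  bijective_elim_subtype fun e => e ∈ S

theorem commute_gauge {h u : V → G} (hh : h ∈ Λ.offCornerGauge G) (hu : u ∈ Λ.cornerGauge G) :
    Commute h u := Λ.commute_offCornerGauge_cornerGauge hh hu

namespace ExtrinsicFrame

variable (Φ : Λ.ExtrinsicFrame) (g : V → G)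

/-- The gauge-invariant extension of wave functions in the perspective of the frame. -/
def extend : L2 G {e : E // e ∉ Φ.lastEdges} →ₗᵢ[ℂ] L2 G E :=
  Lp.compMeasurePreservingₗᵢ ℂ _ (Φ.measurePreserving_dressed g)

theorem coeFn_extend (χ : L2 G {e : E // e ∉ Φ.lastEdges}) :
    (Φ.extend g χ : (E → G) → ℂ) =ᵐ[configMeasure G E]
      fun c => χ (Λ.dressed Φ.line Φ.lastEdges g c) :=
  Lp.coeFn_compMeasurePreserving χ (Φ.measurePreserving_dressed g)

theorem isReduction_iff (ψ : L2 G E) (χ : L2 G {e : E // e ∉ Φ.lastEdges}) :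
    Λ.IsReduction Φ.line Φ.lastEdges g ψ χ ↔ ψ = Φ.extend g χ := by
  constructor
  · intro h
    exact Lp.ext (h.trans (Φ.coeFn_extend g χ).symm)
  · rintro rfl
    exact Φ.coeFn_extend g χ

theorem reorient_extend (h : Λ.corner → G) (χ : L2 G {e : E // e ∉ Φ.lastEdges}) :
    Φ.reorient h (Φ.extend g χ) = Φ.extend g
      (shift (fun e : {e : E // e ∉ Φ.lastEdges} => Φ.reorientAt h false e * cornerParam g h (Λ.tgt e))
        (fun e => Φ.reorientAt h true e * cornerParam g h (Λ.src e)) χ) := by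
  apply Lp.ext
  have hD := (Φ.measurePreserving_dressed g).quasiMeasurePreserving
  filter_upwards [coeFn_shift (Φ.reorientAt h false) (Φ.reorientAt h true) (Φ.extend g χ),
    (shift_measurePreserving (Φ.reorientAt h false)
      (Φ.reorientAt h true)).quasiMeasurePreserving.ae (Φ.coeFn_extend g χ),
    Φ.coeFn_extend g (shift (fun e : {e : E // e ∉ Φ.lastEdges} => Φ.reorientAt h false e * cornerParam g h (Λ.tgt e))
        (fun e => Φ.reorientAt h true e * cornerParam g h (Λ.src e)) χ),
    hD.ae (coeFn_shift (fun e : {e : E // e ∉ Φ.lastEdges} =>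
      Φ.reorientAt h false e * cornerParam g h (Λ.tgt e))
        (fun e => Φ.reorientAt h true e * cornerParam g h (Λ.src e)) χ)] with c h1 h2 h3 h4
  rw [reorient, h1, h2, h3, h4]
  congr 1
  ext e
  exact Φ.dressed_reorientConfig g h c e

theorem reorient_mem (h : Λ.corner → G) {ψ : L2 G E} (hψ : ψ ∈ Λ.Hphys G) :
    Φ.reorient h ψ ∈ Λ.Hphys G := by
  intro u hu
  have hc : ∀ (b : Bool) (e : E), Commute (u (if b then Λ.src e else Λ.tgt e))
      (Φ.reorientAt h b e) := by
    intro b e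
    by_cases hr : Φ.reorientAt h b e = 1
    · rw [hr]; exact Commute.one_right _
    · rw [hu _ (Φ.anchor_of_reorientAt_ne_one hr)]; exact Commute.one_left _
  conv_rhs => rw [← hψ u hu]
  rw [gauge, reorient, shift_shift, shift_shift]
  congr 2
  · ext e; exact hc false e
  · ext e; exact hc true e

/-- The reorientation on the physical Hilbert space. -/
def reorientPhys (h : Λ.corner → G) : Λ.Hphys G →L[ℂ] Λ.Hphys G :=
  ((Φ.reorient h).toContinuousLinearMap ∘L (Λ.Hphys G).subtypeL).codRestrict _
    fun ψ => Φ.reorient_mem h ψ.2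

theorem coe_reorientPhys (h : Λ.corner → G) (ψ : Λ.Hphys G) :
    (Φ.reorientPhys h ψ : L2 G E) = Φ.reorient h ψ := rfl

theorem norm_reorientPhys (h : Λ.corner → G) (ψ : Λ.Hphys G) : ‖Φ.reorientPhys h ψ‖ = ‖ψ‖ :=
  (Φ.reorient h).norm_map ψ

theorem continuous_reorientAt (b : Bool) :
    Continuous fun h : Λ.corner → G => Φ.reorientAt h b := by
  refine continuous_pi fun e => ?_
  unfold reorientAt
  split_ifs
  · exact continuous_apply _
  · exact continuous_const

theorem continuous_reorientPhys {X : Type*} [TopologicalSpace X] {h : X → Λ.corner → G}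
    {ψ : X → Λ.Hphys G} (hh : Continuous h) (hψ : Continuous ψ) :
    Continuous fun x => Φ.reorientPhys (h x) (ψ x) := by
  refine Continuous.subtype_mk (continuous_shift ((Φ.continuous_reorientAt _).comp hh)
    ((Φ.continuous_reorientAt _).comp hh) (continuous_subtype_val.comp hψ)) _

/-- The conjugation of an operator by a reorientation. -/
def reorientConj (ρ : Λ.Hphys G →L[ℂ] Λ.Hphys G) (h : Λ.corner → G) :
    Λ.Hphys G →L[ℂ] Λ.Hphys G :=
  Φ.reorientPhys h ∘L ρ ∘L Φ.reorientPhys h⁻¹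

theorem exists_twirl (ρ : Λ.Hphys G →L[ℂ] Λ.Hphys G) :
    ∃ ρE : Λ.Hphys G →L[ℂ] Λ.Hphys G, ∀ ψ,
      Integrable (fun h => Φ.reorientConj ρ h ψ) (configMeasure G Λ.corner) ∧
      ρE ψ = ∫ h, Φ.reorientConj ρ h ψ ∂(configMeasure G Λ.corner) := by
  refine exists_integral_operator _ _ ‖ρ‖ (fun h => ?_) fun ψ => ?_
  · refine ContinuousLinearMap.opNorm_le_bound _ ρ.opNorm_nonneg fun ψ => ?_
    calc ‖Φ.reorientConj ρ h ψ‖ = ‖ρ (Φ.reorientPhys h⁻¹ ψ)‖ := Φ.norm_reorientPhys _ _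
      _ ≤ ‖ρ‖ * ‖Φ.reorientPhys h⁻¹ ψ‖ := ρ.le_opNorm _
      _ = ‖ρ‖ * ‖ψ‖ := by rw [norm_reorientPhys]
  · exact (Φ.continuous_reorientPhys continuous_id
      (ρ.continuous.comp (Φ.continuous_reorientPhys continuous_inv
        continuous_const))).aestronglyMeasurable

theorem toKin_coe (T : Λ.Hphys G →L[ℂ] Λ.Hphys G) (ψ : Λ.Hphys G) :
    Λ.toKin T (ψ : L2 G E) = T ψ := by
  rw [toKin, ContinuousLinearMap.comp_apply, ContinuousLinearMap.comp_apply,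
    Submodule.orthogonalProjectionOnto_mem_subspace_eq_self]
  rfl

theorem isElectricTwirl {ρ ρE : Λ.Hphys G →L[ℂ] Λ.Hphys G}
    (hE : ∀ ψ, Integrable (fun h => Φ.reorientConj ρ h ψ) (configMeasure G Λ.corner) ∧
      ρE ψ = ∫ h, Φ.reorientConj ρ h ψ ∂(configMeasure G Λ.corner)) :
    Φ.IsElectricTwirl ρ ρE := by
  intro ψ φ
  have h1 : ∀ h : Λ.corner → G,
      ⟪(φ : L2 G E), Φ.reorient h (Λ.toKin ρ (Φ.reorient h⁻¹ ψ))⟫_ℂ =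
      ⟪φ, Φ.reorientConj ρ h ψ⟫_ℂ := by
    intro h
    rw [← coe_reorientPhys, toKin_coe, ← coe_reorientPhys, ← Submodule.coe_inner]
    rfl
  simp_rw [h1]
  refine ⟨(hE ψ).1.const_inner φ, ?_⟩
  rw [(hE ψ).2, integral_inner (hE ψ).1]

/-! ### The corresponding average in the perspective of the frame -/

/-- The corner gauge transformation of the region that is induced by a reorientation. -/
def cornerIso (h : Λ.corner → G) : Λ.HRegion G Λ.region ≃ₗᵢ[ℂ] Λ.HRegion G Λ.region :=
  Λ.gaugeIso _ _ (cornerParam g h) fun _ hh => commute_gauge hh (cornerParam_mem g h)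

theorem coe_cornerIso (h : Λ.corner → G) (f : Λ.HRegion G Λ.region) :
    (cornerIso g h f : L2 G Λ.region) =
      Λ.gauge (fun e : Λ.region => (e : E)) (cornerParam g h) f := rfl

theorem coe_cornerIso_symm (h : Λ.corner → G) (f : Λ.HRegion G Λ.region) :
    ((cornerIso g h).symm f : L2 G Λ.region) =
      Λ.gauge (fun e : Λ.region => (e : E)) (cornerParam g h)⁻¹ f := rfl

theorem continuous_cornerParam (g : V → G) (v : V) :
    Continuous fun h : Λ.corner → G => cornerParam g h v := by
  unfold cornerParam
  split_ifs
  · exact (continuous_const.mul (continuous_apply _)).mul continuous_const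
  · exact continuous_const

theorem continuous_cornerIso {X : Type*} [TopologicalSpace X] {h : X → Λ.corner → G}
    {f : X → Λ.HRegion G Λ.region} (hh : Continuous h) (hf : Continuous f) :
    Continuous fun x => cornerIso g (h x) (f x) :=
  Continuous.subtype_mk (continuous_shift
    (continuous_pi fun _ => (continuous_cornerParam g _).comp hh)
    (continuous_pi fun _ => (continuous_cornerParam g _).comp hh)
    (continuous_subtype_val.comp hf)) _

theorem continuous_cornerIso_symm {X : Type*} [TopologicalSpace X] {h : X → Λ.corner → G}
    {f : X → Λ.HRegion G Λ.region} (hh : Continuous h) (hf : Continuous f) :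
    Continuous fun x => (cornerIso g (h x)).symm (f x) :=
  Continuous.subtype_mk (continuous_shift
    (continuous_pi fun _ => ((continuous_cornerParam g _).comp hh).inv)
    (continuous_pi fun _ => ((continuous_cornerParam g _).comp hh).inv)
    (continuous_subtype_val.comp hf)) _

/-- The conjugation of an operator by the corner gauge transformation of a reorientation. -/
def cornerConj (A : Λ.HRegion G Λ.region →L[ℂ] Λ.HRegion G Λ.region) (h : Λ.corner → G) :
    Λ.HRegion G Λ.region →L[ℂ] Λ.HRegion G Λ.region :=
  (cornerIso g h : Λ.HRegion G Λ.region →L[ℂ] Λ.HRegion G Λ.region) ∘L A ∘L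
    ((cornerIso g h).symm : Λ.HRegion G Λ.region →L[ℂ] Λ.HRegion G Λ.region)

theorem cornerConj_apply (A : Λ.HRegion G Λ.region →L[ℂ] Λ.HRegion G Λ.region)
    (h : Λ.corner → G) (f : Λ.HRegion G Λ.region) :
    cornerConj g A h f = cornerIso g h (A ((cornerIso g h).symm f)) := rfl

theorem exists_corner_twirl (A : Λ.HRegion G Λ.region →L[ℂ] Λ.HRegion G Λ.region) :
    ∃ AE : Λ.HRegion G Λ.region →L[ℂ] Λ.HRegion G Λ.region, ∀ f,
      Integrable (fun h => cornerConj g A h f) (configMeasure G Λ.corner) ∧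
      AE f = ∫ h, cornerConj g A h f ∂(configMeasure G Λ.corner) := by
  refine exists_integral_operator _ _ ‖A‖ (fun h => ?_) fun f => ?_
  · refine ContinuousLinearMap.opNorm_le_bound _ A.opNorm_nonneg fun f => ?_
    rw [cornerConj_apply, LinearIsometryEquiv.norm_map]
    refine (A.le_opNorm _).trans_eq ?_
    rw [LinearIsometryEquiv.norm_map]
  · exact (continuous_cornerIso g continuous_id (A.continuous.comp
      (continuous_cornerIso_symm g continuous_id continuous_const))).aestronglyMeasurable

theorem cornerIso_mul (h h' : Λ.corner → G) (f : Λ.HRegion G Λ.region) :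
    cornerIso g (h * h') f = cornerIso g h (cornerIso g h' f) := by
  apply Subtype.ext
  rw [coe_cornerIso, coe_cornerIso, coe_cornerIso, gauge_gauge, cornerParam_mul]

/-- The averaged operator commutes with the corner gauge transformations. -/
theorem cornerIso_corner_twirl {A AE : Λ.HRegion G Λ.region →L[ℂ] Λ.HRegion G Λ.region}
    (hE : ∀ f, Integrable (fun h => cornerConj g A h f) (configMeasure G Λ.corner) ∧
      AE f = ∫ h, cornerConj g A h f ∂(configMeasure G Λ.corner))
    (h : Λ.corner → G) (f : Λ.HRegion G Λ.region) :
    AE (cornerIso g h f) = cornerIso g h (AE f) := by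
  have key : ∀ k, cornerConj g A (h * k) (cornerIso g h f) =
      cornerIso g h (cornerConj g A k f) := by
    intro k
    have h1 : (cornerIso g (h * k)).symm (cornerIso g h f) = (cornerIso g k).symm f := by
      rw [LinearIsometryEquiv.symm_apply_eq, cornerIso_mul, LinearIsometryEquiv.apply_symm_apply]
    rw [cornerConj_apply, cornerConj_apply, h1, cornerIso_mul]
  -- Left invariance of Haar measure absorbs h into the integration variable.
  rw [(hE _).2, (hE _).2, ← integral_mul_left_eq_self _ h]
  simp_rw [key]
  exact ContinuousLinearMap.integral_comp_comm
    (cornerIso g h : Λ.HRegion G Λ.region →L[ℂ] Λ.HRegion G Λ.region) (hE f).1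

theorem isDensity_corner_twirl {A AE : Λ.HRegion G Λ.region →L[ℂ] Λ.HRegion G Λ.region}
    (hE : ∀ f, Integrable (fun h => cornerConj g A h f) (configMeasure G Λ.corner) ∧
      AE f = ∫ h, cornerConj g A h f ∂(configMeasure G Λ.corner))
    (hA : QEntropy.IsDensity A) :
    QEntropy.IsDensity AE ∧ QEntropy.vonNeumannEntropy A ≤ QEntropy.vonNeumannEntropy AE := by
  have hK : TopologicalSpace.SeparableSpace (Λ.HRegion G Λ.region) :=
    (TopologicalSpace.IsSeparable.of_separableSpace
      (Λ.HRegion G Λ.region : Set (L2 G Λ.region))).separableSpace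
  refine QEntropy.isDensity_twirl (P := configMeasure G Λ.corner)
    (W := fun h => (cornerIso g h).symm)
    (fun f => (continuous_cornerIso_symm g continuous_id continuous_const).aestronglyMeasurable)
    hA fun f => ?_
  rw [(hE f).2, ← integral_inner (hE f).1]
  refine integral_congr_ae (ae_of_all _ fun h => ?_)
  change ⟪f, cornerConj g A h f⟫_ℂ = _
  rw [cornerConj_apply, ← (cornerIso g h).symm.inner_map_map, LinearIsometryEquiv.symm_apply_apply]

end ExtrinsicFrame

end Lattice

end LGT

/-! ### The electric twirl is relational and lies in the electric center. -/

namespace LGT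

namespace Lattice

open scoped Classical

variable {V E : Type*} {Λ : Lattice V E} [Fintype E]
variable {G : Type*} [Group G] [TopologicalSpace G] [IsTopologicalGroup G] [CompactSpace G]
  [T2Space G] [SecondCountableTopology G] [MeasurableSpace G] [BorelSpace G]

namespace ExtrinsicFrame

variable (Φ : Λ.ExtrinsicFrame) (g : V → G)

theorem represents_iff (T : Λ.Hphys G →L[ℂ] Λ.Hphys G)
    (A : Λ.HRegion G Λ.region →L[ℂ] Λ.HRegion G Λ.region) :
    Φ.Represents g T A ↔ ∀ ψ : Λ.Hphys G, ∃ χ χ' : Λ.HPersp (G := G) Φ.lastEdges ∅,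
      (ψ : L2 G E) = Φ.extend g χ ∧ (T ψ : L2 G E) = Φ.extend g χ' ∧
      ∀ k, pTens (bijective_elim_sub Φ.notMem_lastEdges) (Λ.HRegion G Λ.region) k
        (χ' : L2 G {e : E // e ∉ Φ.lastEdges}) =
        A (pTens (bijective_elim_sub Φ.notMem_lastEdges) (Λ.HRegion G Λ.region) k
          (χ : L2 G {e : E // e ∉ Φ.lastEdges})) := by
  unfold Represents IsRelational
  simp only [Set.mem_empty_iff_false, false_imp_iff, implies_true, true_and, isReduction_iff,
    actsAs_iff (bijective_elim_sub Φ.notMem_lastEdges)]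

theorem commute_reorientAt_cornerParam (h h' : Λ.corner → G) (b : Bool) (e : E) :
    Commute (Φ.reorientAt h b e) (cornerParam g h' (if b then Λ.src e else Λ.tgt e)) := by
  by_cases hr : Φ.reorientAt h b e = 1
  · rw [hr]; exact Commute.one_left _
  · rw [cornerParam_mem g h' _ fun hc => Finset.disjoint_left.1 Λ.corner_disjoint_bdry hc
      (Φ.anchor_of_reorientAt_ne_one hr)]
    exact Commute.one_right _

variable {Φ g} {ρ ρE : Λ.Hphys G →L[ℂ] Λ.Hphys G}
  {A AE : Λ.HRegion G Λ.region →L[ℂ] Λ.HRegion G Λ.region}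

/-- Both reorientations are shifts in the perspective of the frame. On the region they conjugate A
by the corner gauge transformation; on the other links they are mutually inverse and cancel on k. -/
theorem pTens_reorientConj (hrep : Φ.Represents g ρ A) (h : Λ.corner → G) (ψ : Λ.Hphys G)
    (χ χ' : L2 G {e : E // e ∉ Φ.lastEdges}) (hχ : (ψ : L2 G E) = Φ.extend g χ)
    (hχ' : (Φ.reorientConj ρ h ψ : L2 G E) = Φ.extend g χ')
    (k : L2 G {e : E // e ∉ Λ.region ∧ e ∉ Φ.lastEdges}) :
    pTens (bijective_elim_sub Φ.notMem_lastEdges) (Λ.HRegion G Λ.region) k χ' =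
      cornerConj g A h
        (pTens (bijective_elim_sub Φ.notMem_lastEdges) (Λ.HRegion G Λ.region) k χ) := by
  rw [represents_iff] at hrep
  obtain ⟨χ₁, χ₁', h1, h2, h3⟩ := hrep (Φ.reorientPhys h⁻¹ ψ)
  have hreg : ∀ (h : Λ.corner → G) (b : Bool) (e : Λ.region), Φ.reorientAt h b e = 1 :=
    fun h b e => Φ.reorientAt_of_mem_region e.2 b
  have hsh : ∀ (h : Λ.corner → G) (χ : L2 G {e : E // e ∉ Φ.lastEdges})
      (k : L2 G {e : E // e ∉ Λ.region ∧ e ∉ Φ.lastEdges}),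
      pTens (bijective_elim_sub Φ.notMem_lastEdges) (Λ.HRegion G Λ.region) k
        (shift (fun e : {e : E // e ∉ Φ.lastEdges} =>
          Φ.reorientAt h false e * cornerParam g h (Λ.tgt e))
        (fun e => Φ.reorientAt h true e * cornerParam g h (Λ.src e)) χ) = _ := fun h χ k =>
    pTens_shift (bijective_elim_sub Φ.notMem_lastEdges) (Λ.HRegion G Λ.region) _ _
      (cornerIso g h) (fun f => by
        rw [coe_cornerIso, gauge]
        congr 2 <;> ext e <;> simp [hreg])
      (cornerIso g h).symm (fun f => by
        rw [coe_cornerIso_symm, gauge]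
        congr 2 <;> ext e <;> simp [hreg]) k χ
  have e1 : (χ₁ : L2 G {e : E // e ∉ Φ.lastEdges}) = shift (fun e : {e : E // e ∉ Φ.lastEdges} =>
      Φ.reorientAt h⁻¹ false e * cornerParam g h⁻¹ (Λ.tgt e))
      (fun e => Φ.reorientAt h⁻¹ true e * cornerParam g h⁻¹ (Λ.src e)) χ := by
    apply (Φ.extend g).injective
    rw [← h1, coe_reorientPhys, hχ, reorient_extend]
  have e2 : χ' = shift (fun e : {e : E // e ∉ Φ.lastEdges} =>
      Φ.reorientAt h false e * cornerParam g h (Λ.tgt e))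
      (fun e => Φ.reorientAt h true e * cornerParam g h (Λ.src e))
      (χ₁' : L2 G {e : E // e ∉ Φ.lastEdges}) := by
    apply (Φ.extend g).injective
    rw [← hχ', ← reorient_extend, ← h2]
    rfl
  rw [e2, hsh, h3, e1, hsh, cornerConj_apply]
  have hinv : ∀ f, cornerIso g h⁻¹ f = (cornerIso g h).symm f := by
    intro f
    apply Subtype.ext
    rw [coe_cornerIso, coe_cornerIso_symm, cornerParam_inv]
  rw [hinv, shift_shift]
  refine congrArg (fun k' => cornerIso g h (A ((cornerIso g h).symm (pTens
    (bijective_elim_sub Φ.notMem_lastEdges) (Λ.HRegion G Λ.region) k' χ)))) ?_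
  refine Eq.trans ?_ (shift_one k)
  congr 2
  · ext e
    have hc : Commute (Φ.reorientAt h false (e : E)) (cornerParam g h (Λ.tgt e)) := by
      simpa using Φ.commute_reorientAt_cornerParam g h h false e
    simp only [Pi.mul_apply, Pi.inv_apply, Function.comp_apply, reorientAt_inv, cornerParam_inv,
      Pi.one_apply, hc.eq]
    group
  · ext e
    have hc : Commute (Φ.reorientAt h true (e : E)) (cornerParam g h (Λ.src e)) := by
      simpa using Φ.commute_reorientAt_cornerParam g h h true e
    simp only [Pi.mul_apply, Pi.inv_apply, Function.comp_apply, reorientAt_inv, cornerParam_inv,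
      Pi.one_apply, hc.eq]
    group

/-- The twirled operator is represented by the averaged operator. -/
theorem represents_twirl (hrep : Φ.Represents g ρ A)
    (hρE : ∀ ψ, Integrable (fun h => Φ.reorientConj ρ h ψ) (configMeasure G Λ.corner) ∧
      ρE ψ = ∫ h, Φ.reorientConj ρ h ψ ∂(configMeasure G Λ.corner))
    (hAE : ∀ f, Integrable (fun h => cornerConj g A h f) (configMeasure G Λ.corner) ∧
      AE f = ∫ h, cornerConj g A h f ∂(configMeasure G Λ.corner)) :
    Φ.Represents g ρE AE := by
  -- Reductions exist for all physical states because `Represents` for ρ supplies one for every ψ.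
  have hex : ∀ ψ : Λ.Hphys G, ∃ χ : Λ.HPersp (G := G) Φ.lastEdges ∅,
      (ψ : L2 G E) = Φ.extend g χ := fun ψ => by
    obtain ⟨χ, -, h, -⟩ := (represents_iff Φ g ρ A).1 hrep ψ
    exact ⟨χ, h⟩
  rw [represents_iff]
  intro ψ
  obtain ⟨χ, hχ⟩ := hex ψ
  obtain ⟨χ', hχ'⟩ := hex (ρE ψ)
  refine ⟨χ, χ', hχ, hχ', fun k => ?_⟩
  set p := pTens (bijective_elim_sub Φ.notMem_lastEdges) (Λ.HRegion G Λ.region) k with hp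
  -- The reduction map: the adjoint of the isometry `extend` inverts it on its range. Being bounded
  -- and linear, it passes under the integral.
  let J : Λ.Hphys G →L[ℂ] L2 G {e : E // e ∉ Φ.lastEdges} :=
    ContinuousLinearMap.adjoint (Φ.extend g).toContinuousLinearMap ∘L (Λ.Hphys G).subtypeL
  have hJ : ∀ (φ : Λ.Hphys G) (η : L2 G {e : E // e ∉ Φ.lastEdges}),
      (φ : L2 G E) = Φ.extend g η → J φ = η := by
    intro φ η h
    refine ext_inner_left ℂ fun ξ => ?_
    rw [ContinuousLinearMap.comp_apply, ContinuousLinearMap.adjoint_inner_right]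
    change ⟪Φ.extend g ξ, (φ : L2 G E)⟫_ℂ = _
    rw [h, LinearIsometry.inner_map_map]
  have h1 : p (J (ρE ψ)) = ∫ h, p (J (Φ.reorientConj ρ h ψ)) ∂(configMeasure G Λ.corner) := by
    rw [(hρE ψ).2]
    exact ((p ∘L J).integral_comp_comm (hρE ψ).1).symm
  rw [← hJ _ _ hχ', h1, (hAE _).2]
  refine integral_congr_ae (ae_of_all _ fun h => ?_)
  obtain ⟨η, hη⟩ := hex (Φ.reorientConj ρ h ψ)
  change p (J (Φ.reorientConj ρ h ψ)) = cornerConj g A h (p χ)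
  rw [hJ _ _ hη]
  exact pTens_reorientConj hrep h ψ _ _ hχ hη k

/-! ### The electric center -/

theorem dressing_congr {c c' : E → G} (h : ∀ e ∉ Λ.region, c e = c' e) (v : V) :
    Λ.dressing Φ.line g c v = Λ.dressing Φ.line g c' v := by
  unfold dressing
  split_ifs with hv
  · rw [hol_congr fun s hs => h s.1 (Φ.exterior v hv s hs)]
  · rfl

theorem dressing_mem_cornerGauge {line : V → List (Step E)} (g : V → G) (c : E → G) :
    Λ.dressing line g c ∈ Λ.cornerGauge G := fun v hv => by
  rw [dressing, if_neg hv]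

variable (Φ g)

/-- The configuration that extends a configuration outside of the region by `1`. -/
def exteriorConfig (y : {e : E // e ∉ Λ.region} → G) : E → G :=
  glue (bijective_elim_finset Λ.region) 1 y

/-- The dressed values of the links outside of the region. -/
def dressedExterior (y : {e : E // e ∉ Λ.region} → G)
    (e : {e : E // e ∉ Λ.region ∧ e ∉ Φ.lastEdges}) : G :=
  Λ.dressed Φ.line Φ.lastEdges g (exteriorConfig y) ⟨e, e.2.2⟩

theorem dressed_glue (x : Λ.region → G) (y : {e : E // e ∉ Λ.region} → G) :
    Λ.dressed Φ.line Φ.lastEdges g (glue (bijective_elim_finset Λ.region) x y) =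
      glue (bijective_elim_sub Φ.notMem_lastEdges)
        (fun e => Λ.dressing Φ.line g (exteriorConfig y) (Λ.tgt e) * x e *
          (Λ.dressing Φ.line g (exteriorConfig y) (Λ.src e))⁻¹) (Φ.dressedExterior g y) := by
  have hb := bijective_elim_finset Λ.region
  have hc : ∀ e ∉ Λ.region, glue hb x y e = exteriorConfig y e := fun e he =>
    (glue_right hb x y ⟨e, he⟩).trans (glue_right hb 1 y ⟨e, he⟩).symm
  refine glue_ext (bijective_elim_sub Φ.notMem_lastEdges) (fun e => ?_) fun e => ?_
  · rw [glue_left, dressed, dressing_congr hc, dressing_congr hc]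
    congr 2
    exact glue_left hb x y e
  · rw [glue_right, dressed, dressing_congr hc, dressing_congr hc, dressedExterior, dressed,
      hc _ e.2.1]

theorem measurePreserving_dressedExterior :
    MeasurePreserving (Φ.dressedExterior (G := G) g) (configMeasure G _) (configMeasure G _) := by
  have h1 : MeasurePreserving (fun c : E → G => c ∘ fun e : {e : E // e ∉ Λ.region} => (e : E))
      (configMeasure G E) (configMeasure G _) :=
    measurePreserving_snd.comp (measurePreserving_split (bijective_elim_finset Λ.region))
  have h2 : MeasurePreserving (fun c : {e : E // e ∉ Φ.lastEdges} → G =>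
      c ∘ fun e : {e : E // e ∉ Λ.region ∧ e ∉ Φ.lastEdges} => ⟨e, e.2.2⟩)
      (configMeasure G _) (configMeasure G _) :=
    measurePreserving_snd.comp (measurePreserving_split (bijective_elim_sub Φ.notMem_lastEdges))
  have hm : Measurable (Φ.dressedExterior (G := G) g) := by
    refine Continuous.measurable (continuous_pi fun e => ?_)
    have hc : Continuous fun y : {e : E // e ∉ Λ.region} → G => exteriorConfig y :=
      (continuous_glue (bijective_elim_finset Λ.region)).comp (continuous_const.prodMk continuous_id)
    exact (continuous_apply _).comp ((continuous_dressed _ _ g).comp hc)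
  refine ⟨hm, ?_⟩
  -- Dressing commutes with restriction to the exterior by `dressed_glue`, so the claim reduces to
  -- invariance of the measure under the full dressing.
  rw [← h1.map_eq, Measure.map_map hm h1.measurable,
    ← (h2.comp (Φ.measurePreserving_dressed g)).map_eq]
  congr 1
  ext c e
  have h := Φ.dressed_glue g (c ∘ fun e : Λ.region => (e : E))
    (c ∘ fun e : {e : E // e ∉ Λ.region} => (e : E))
  rw [glue_comp] at h
  simp only [Function.comp_apply] at h ⊢
  rw [h]
  exact (glue_right (bijective_elim_sub Φ.notMem_lastEdges) _ _ e).symm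

/-- For fixed exterior links y, dressing acts on the region by one fixed gauge transformation, which
invariance of Haar measure moves onto the test vector. -/
theorem sliceInner_extend (χ : L2 G {e : E // e ∉ Φ.lastEdges}) :
    ∀ᵐ y ∂(configMeasure G {e : E // e ∉ Λ.region}), ∀ f : L2 G Λ.region,
      sliceInner (bijective_elim_finset Λ.region) f (Φ.extend g χ) y =
      sliceInner (bijective_elim_sub Φ.notMem_lastEdges)
        (Λ.gauge (fun e : Λ.region => (e : E)) (Λ.dressing Φ.line g (exteriorConfig y)) f) χ
        (Φ.dressedExterior g y) := by
  have hb := bijective_elim_finset Λ.region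
  have h1 := (measurePreserving_glue (G := G) hb).quasiMeasurePreserving.ae (Φ.coeFn_extend g χ)
  have h2 := Measure.ae_ae_of_ae_prod
    (Measure.measurePreserving_swap.quasiMeasurePreserving.ae h1)
  filter_upwards [h2] with y hy f
  set u := Λ.dressing Φ.line g (exteriorConfig y)
  have hs := shift_measurePreserving (G := G) (fun e : Λ.region => u (Λ.tgt e))
    (fun e : Λ.region => u (Λ.src e))
  have hme : MeasurableEmbedding (fun (c : Λ.region → G) (k : Λ.region) =>
      (u (Λ.tgt k))⁻¹ * c k * u (Λ.src k)) :=
    (Homeomorph.mk ⟨fun (c : Λ.region → G) (k : Λ.region) => (u (Λ.tgt k))⁻¹ * c k * u (Λ.src k),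
      fun c (k : Λ.region) => u (Λ.tgt k) * c k * (u (Λ.src k))⁻¹, fun c => by ext; simp [mul_assoc],
      fun c => by ext; simp [mul_assoc]⟩ (by fun_prop) (by fun_prop)).measurableEmbedding
  unfold sliceInner
  rw [← hs.integral_comp hme]
  refine integral_congr_ae ?_
  filter_upwards [hs.quasiMeasurePreserving.ae hy,
    coeFn_shift (fun e : Λ.region => u (Λ.tgt e)) (fun e : Λ.region => u (Λ.src e)) f] with x hx hf
  rw [gauge, hf]
  congr 1
  refine Eq.trans hx ?_
  rw [Prod.swap, dressed_glue]
  congr 2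
  ext e
  simp [u, mul_assoc]

/-- Slice by slice, ψ and its reduction differ by a corner gauge transformation of the region
depending only on the exterior links. B commutes with it, and so does its adjoint, so B ⊗ 1 acts on
ψ as it does on the reduction. -/
theorem mem_electricCenter {T : Λ.Hphys G →L[ℂ] Λ.Hphys G}
    {B : Λ.HRegion G Λ.region →L[ℂ] Λ.HRegion G Λ.region} (hrep : Φ.Represents g T B)
    (hB : ∀ (h : Λ.corner → G) (f : Λ.HRegion G Λ.region),
      B (cornerIso g h f) = cornerIso g h (B f)) :
    T ∈ Λ.electricCenter G := by
  refine ⟨B, fun u hu f f' hf => ?_, fun ψ => ?_⟩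
  · obtain ⟨h, rfl⟩ := exists_cornerParam g hu
    have : f' = cornerIso g h f := Subtype.ext hf
    rw [this, hB]
    rfl
  · have hadj : ∀ (h : Λ.corner → G) (f : Λ.HRegion G Λ.region),
        ContinuousLinearMap.adjoint B (cornerIso g h f) =
          cornerIso g h (ContinuousLinearMap.adjoint B f) := by
      intro h f
      refine ext_inner_right ℂ fun p => ?_
      obtain ⟨q, rfl⟩ := (cornerIso g h).surjective p
      rw [ContinuousLinearMap.adjoint_inner_left, hB, LinearIsometryEquiv.inner_map_map,
        LinearIsometryEquiv.inner_map_map, ContinuousLinearMap.adjoint_inner_left]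
    obtain ⟨-, hrep⟩ := hrep
    obtain ⟨χ, χ', h1, h2, h3⟩ := hrep ψ
    rw [isReduction_iff] at h1 h2
    rw [actsAs_iff_slice (bijective_elim_sub Φ.notMem_lastEdges)] at h3
    have h4 := (Φ.measurePreserving_dressedExterior (G := G) g).quasiMeasurePreserving.ae
      (ae_forall_sliceInner_eq _ _ _ _ _ h3)
    rw [actsAs_iff_slice (bijective_elim_finset Λ.region)]
    intro f
    rw [h1, h2]
    filter_upwards [h4, Φ.sliceInner_extend g χ, Φ.sliceInner_extend g χ'] with y h5 h6 h7
    obtain ⟨h, hh⟩ := exists_cornerParam g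
      (dressing_mem_cornerGauge (Λ := Λ) (line := Φ.line) g (exteriorConfig y))
    rw [h6, h7, ← hh, ← coe_cornerIso, ← coe_cornerIso, h5, hadj]

/-- The electric twirl of a state: existence, membership in the electric center algebra and in the
extrinsic relational algebra, and increase of the entropy. -/
theorem exists_electricTwirl_entropy_le (hrep : Φ.Represents g ρ A) (hA : QEntropy.IsDensity A) :
    ∃ (ρE : Λ.Hphys G →L[ℂ] Λ.Hphys G) (AE : Λ.HRegion G Λ.region →L[ℂ] Λ.HRegion G Λ.region),
      Φ.IsElectricTwirl ρ ρE ∧ ρE ∈ Λ.electricCenter G ∧ Φ.Represents g ρE AE ∧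
      QEntropy.IsDensity AE ∧ QEntropy.vonNeumannEntropy A ≤ QEntropy.vonNeumannEntropy AE := by
  obtain ⟨ρE, hρE⟩ := Φ.exists_twirl ρ
  obtain ⟨AE, hAE⟩ := exists_corner_twirl g A
  have hr := represents_twirl hrep hρE hAE
  exact ⟨ρE, AE, Φ.isElectricTwirl hρE, mem_electricCenter Φ g hr (cornerIso_corner_twirl g hAE), hr,
    isDensity_corner_twirl g hAE hA⟩

end ExtrinsicFrame

end Lattice

end LGT

namespace LGT

/-! ### Wave functions for a finite group -/

section FiniteGroup

variable {G : Type*} [Group G] [TopologicalSpace G] [IsTopologicalGroup G] [CompactSpace G]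
  [T2Space G] [SecondCountableTopology G] [MeasurableSpace G] [BorelSpace G] [Finite G]
variable {ι κ μ : Type*} [Fintype ι] [Fintype κ] [Fintype μ]

/-- A finite Hausdorff group is discrete and its Haar measure charges every point, so wave functions
may be evaluated at configurations. -/
theorem ae_eq_iff_of_finite {f f' : (κ → G) → ℂ} :
    f =ᵐ[configMeasure G κ] f' ↔ f = f' :=
  Continuous.ae_eq_iff_eq _ continuous_of_discreteTopology continuous_of_discreteTopology

theorem L2_ext {f f' : L2 G κ} (h : ∀ c, f c = f' c) : f = f' :=
  Lp.ext (Filter.Eventually.of_forall h)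

theorem L2_add_apply (f f' : L2 G κ) (c : κ → G) : (f + f') c = f c + f' c :=
  congrFun (ae_eq_iff_of_finite.1 (Lp.coeFn_add f f')) c

theorem L2_smul_apply (z : ℂ) (f : L2 G κ) (c : κ → G) : (z • f) c = z * f c :=
  congrFun (ae_eq_iff_of_finite.1 (Lp.coeFn_smul z f)) c

theorem coe_add_apply {K : Submodule ℂ (L2 G κ)} (f f' : K) (c : κ → G) :
    ((f + f' : K) : L2 G κ) c = (f : L2 G κ) c + (f' : L2 G κ) c := L2_add_apply _ _ c

theorem coe_smul_apply {K : Submodule ℂ (L2 G κ)} (z : ℂ) (f : K) (c : κ → G) :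
    ((z • f : K) : L2 G κ) c = z * (f : L2 G κ) c := L2_smul_apply _ _ c

theorem L2_zero_apply (c : κ → G) : (0 : L2 G κ) c = 0 :=
  congrFun (ae_eq_iff_of_finite.1 (Lp.coeFn_zero ℂ 2 (configMeasure G κ))) c

/-- Evaluation of wave functions at a configuration. -/
def evalAt (c : κ → G) : L2 G κ →ₗ[ℂ] ℂ where
  toFun f := f c
  map_add' f f' := L2_add_apply f f' c
  map_smul' z f := L2_smul_apply z f c

theorem evalAt_apply (c : κ → G) (f : L2 G κ) : evalAt c f = f c := rfl

theorem L2_sum_apply {α : Type*} (s : Finset α) (f : α → L2 G κ) (c : κ → G) :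
    (∑ a ∈ s, f a : L2 G κ) c = ∑ a ∈ s, f a c := map_sum (evalAt c) f s

theorem memLp_of_finite (f : (κ → G) → ℂ) : MemLp f 2 (configMeasure G κ) := by
  obtain ⟨C, hC⟩ := (Set.finite_range fun c => ‖f c‖).bddAbove
  exact MemLp.of_bound continuous_of_discreteTopology.aestronglyMeasurable C
    (ae_of_all _ fun c => hC ⟨c, rfl⟩)

/-- The wave function with given values. -/
def ofFun (f : (κ → G) → ℂ) : L2 G κ := (memLp_of_finite f).toLp f

theorem ofFun_apply (f : (κ → G) → ℂ) (c : κ → G) : ofFun f c = f c :=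
  congrFun (ae_eq_iff_of_finite.1 (MemLp.coeFn_toLp (memLp_of_finite f))) c

instance : FiniteDimensional ℂ (L2 G κ) :=
  FiniteDimensional.of_injective (LinearMap.pi fun c : κ → G => evalAt c) fun _ _ h =>
    L2_ext fun c => congrFun h c

theorem shift_apply (a b : κ → G) (ψ : L2 G κ) (c : κ → G) :
    shift a b ψ c = ψ fun k => (a k)⁻¹ * c k * b k :=
  congrFun (ae_eq_iff_of_finite.1 (coeFn_shift a b ψ)) c

theorem phaseMul_apply (m : C(κ → G, Circle)) (ψ : L2 G κ) (c : κ → G) :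
    phaseMul m ψ c = m c * ψ c :=
  congrFun (ae_eq_iff_of_finite.1 (MemLp.coeFn_toLp (memLp_phase_mul m ψ))) c

theorem inner_ofFun_slice {i : κ → ι} {j : μ → ι} (hij : Function.Bijective (Sum.elim i j))
    (f : L2 G κ) (χ : L2 G ι) (z : μ → G) :
    sliceInner hij f χ z = ⟪f, ofFun fun x => χ (glue hij x z)⟫_ℂ := by
  rw [L2.inner_def, sliceInner]
  refine integral_congr_ae (ae_of_all _ fun x => ?_)
  simp only [ofFun_apply, RCLike.inner_apply]
  rw [mul_comm]

theorem actsAs_iff_forall_slice {i : κ → ι} {j : μ → ι} (hij : Function.Bijective (Sum.elim i j))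
    (K : Submodule ℂ (L2 G κ)) [CompleteSpace K] (A : K →L[ℂ] K) (χ χ' : L2 G ι)
    (h : ∀ z, (ofFun fun x => χ (glue hij x z)) ∈ K)
    (h' : ∀ z, (ofFun fun x => χ' (glue hij x z)) ∈ K) :
    ActsAs i j K A χ χ' ↔ ∀ z, (⟨_, h' z⟩ : K) = A ⟨_, h z⟩ := by
  rw [actsAs_iff_slice hij]
  simp_rw [ae_eq_iff_of_finite, funext_iff, inner_ofFun_slice]
  constructor
  · intro H z
    refine ext_inner_left ℂ fun f => ?_
    rw [← ContinuousLinearMap.adjoint_inner_left]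
    exact H f z
  · intro H f z
    change ⟪f, (⟨_, h' z⟩ : K)⟫_ℂ = ⟪ContinuousLinearMap.adjoint A f, (⟨_, h z⟩ : K)⟫_ℂ
    rw [H z, ContinuousLinearMap.adjoint_inner_left]

namespace Lattice

open scoped Classical

variable {V E : Type*} (Λ : Lattice V E) [Fintype E]

/-- The action of a gauge transformation on configurations. -/
def gaugeConfig {κ G : Type*} [Group G] (i : κ → E) (h : V → G) (c : κ → G) (k : κ) : G :=
  h (Λ.tgt (i k)) * c k * (h (Λ.src (i k)))⁻¹

theorem gaugeConfig_mul {κ G : Type*} [Group G] (i : κ → E) (h h' : V → G) (c : κ → G) :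
    Λ.gaugeConfig i h (Λ.gaugeConfig i h' c) = Λ.gaugeConfig i (h * h') c := by
  ext k
  simp [gaugeConfig, mul_assoc]

theorem gaugeConfig_one {κ G : Type*} [Group G] (i : κ → E) (c : κ → G) :
    Λ.gaugeConfig i 1 c = c := by
  ext k
  simp [gaugeConfig]

theorem gauge_apply (i : κ → E) (h : V → G) (ψ : L2 G κ) (c : κ → G) :
    Λ.gauge i h ψ c = ψ (Λ.gaugeConfig i h⁻¹ c) := by
  rw [gauge, shift_apply]
  congr 1
  ext k
  simp [gaugeConfig]

variable {Λ} in
theorem apply_gaugeConfig {i : κ → E} {P : Set (V → G)} {ψ : L2 G κ} (hψ : ψ ∈ Λ.invariants i P)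
    {h : V → G} (hh : h ∈ P) (c : κ → G) : ψ (Λ.gaugeConfig i h c) = ψ c := by
  conv_lhs => rw [← hψ h hh]
  rw [gauge_apply, gaugeConfig_mul, inv_mul_cancel, gaugeConfig_one]

theorem mem_invariants_of_forall {i : κ → E} {P : Set (V → G)} {ψ : L2 G κ}
    (hψ : ∀ h ∈ P, ∀ c, ψ (Λ.gaugeConfig i h c) = ψ c) : ψ ∈ Λ.invariants i P := by
  intro h hh
  refine L2_ext fun c => ?_
  rw [gauge_apply, ← hψ h hh, gaugeConfig_mul, mul_inv_cancel, gaugeConfig_one]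

end Lattice

end FiniteGroup

/-! ### Intrinsic frames -/

namespace Lattice

open scoped Classical

variable {V E : Type*} {Λ : Lattice V E}

section Group

variable {G : Type*} [Group G]

theorem hol_gaugeConfig (h : V → G) (c : E → G) {v w : V} {l : List (Step E)}
    (hl : Λ.IsWalk v l w) : hol (Λ.gaugeConfig id h c) l = h w * hol c l * (h v)⁻¹ := by
  induction l generalizing v with
  | nil =>
    obtain rfl : v = w := hl
    simp [hol]
  | cons s l ih =>
    obtain ⟨hs, hl⟩ := hl
    rw [hol, ih hl, hol, ← hs]
    obtain ⟨e, b⟩ := s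
    cases b <;> simp [stepHol, stepSrc, stepTgt, gaugeConfig, mul_assoc]

theorem hol_one (l : List (Step E)) : hol (1 : E → G) l = 1 := by
  induction l with
  | nil => rfl
  | cons s l ih => simp [hol, ih, stepHol]

namespace IntrinsicFrame

variable (F : Λ.IntrinsicFrame)

theorem tgt_mem_corner {e : E} (he : e ∈ F.tree) : Λ.tgt e ∈ Λ.corner :=
  (Λ.cornerEdges_ends e (F.tree_subset he)).2

theorem src_mem_corner {e : E} (he : e ∈ F.tree) : Λ.src e ∈ Λ.corner :=
  (Λ.cornerEdges_ends e (F.tree_subset he)).1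

theorem tree_subset_region {e : E} (he : e ∈ F.tree) : e ∈ Λ.region :=
  Λ.cornerEdges_subset (F.tree_subset he)

/-- Along a line on which the configuration is pure gauge, the holonomy telescopes. -/
theorem hol_of_coboundary {c : E → G} {u : V → G}
    (h : ∀ e ∈ F.tree, c e = u (Λ.tgt e) * (u (Λ.src e))⁻¹) {v : V} (hv : v ∈ Λ.corner) :
    hol c (F.line v) = u v * (u F.root)⁻¹ := by
  have h1 : hol c (F.line v) = hol (Λ.gaugeConfig id u 1) (F.line v) := by
    refine hol_congr fun s hs => ?_
    rw [h _ (F.line_tree v hv s hs), gaugeConfig, Pi.one_apply, mul_one]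
    rfl
  rw [h1, hol_gaugeConfig u 1 (F.isPath v hv).1, hol_one, mul_one]

/-- A configuration on the tree is determined by the Wilson lines of the frame. -/
theorem tree_eq [Finite G] (c : E → G) {e : E} (he : e ∈ F.tree) :
    c e = hol c (F.line (Λ.tgt e)) * (hol c (F.line (Λ.src e)))⁻¹ := by
  have := Fintype.ofFinite G
  let X := {v : V // v ∈ Λ.corner.erase F.root}
  let ext : (X → G) → V → G := fun u v => if hv : v ∈ Λ.corner.erase F.root then u ⟨v, hv⟩ else 1
  have hroot : ∀ u, ext u F.root = 1 := fun u => dif_neg (Finset.notMem_erase _ _)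
  -- Sends vertex values, normalized to 1 at the root, to pure gauge configurations on the tree.
  -- Wilson lines recover the vertex values, so the map is injective; the tree has one edge fewer
  -- than the corner has vertices, so counting makes it bijective. Hence every tree configuration is
  -- pure gauge.
  let Ψ : (X → G) → F.tree → G := fun u e => ext u (Λ.tgt e) * (ext u (Λ.src e))⁻¹
  have hΨ : ∀ (u : X → G) (c : E → G), (∀ e : F.tree, c e = Ψ u e) → ∀ v ∈ Λ.corner,
      hol c (F.line v) = ext u v := by
    intro u c h v hv
    rw [F.hol_of_coboundary (u := ext u) (fun e he => h ⟨e, he⟩) hv, hroot, inv_one, mul_one]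
  have hinj : Function.Injective Ψ := by
    intro u u' h
    let c : E → G := fun e => if he : e ∈ F.tree then Ψ u ⟨e, he⟩ else 1
    have hc : ∀ e : F.tree, c e = Ψ u e := fun e => dif_pos e.2
    ext v
    have hv := Finset.mem_of_mem_erase v.2
    have h1 := (hΨ u c hc v hv).symm.trans (hΨ u' c (fun e => (hc e).trans (congrFun h e)) v hv)
    simpa only [ext, dif_pos v.2] using h1
  have hbij : Function.Bijective Ψ := by
    rw [Fintype.bijective_iff_injective_and_card]
    refine ⟨hinj, ?_⟩
    rw [Fintype.card_fun, Fintype.card_fun]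
    congr 1
    have h1 := F.card_tree
    have h2 := Finset.card_erase_of_mem F.root_mem
    simp only [X, Fintype.card_coe]
    omega
  obtain ⟨u, hu⟩ := hbij.2 fun e => c e
  have hu' : ∀ e : F.tree, c e = Ψ u e := fun e => (congrFun hu e).symm
  rw [hΨ u c hu' _ (F.tgt_mem_corner he), hΨ u c hu' _ (F.src_mem_corner he)]
  exact hu' ⟨e, he⟩

end IntrinsicFrame

end Group

end Lattice

end LGT

/-! ### Intrinsic frames: fixing the tree and acting on fibres. -/

namespace LGT

namespace Lattice

open scoped Classical

variable {V E : Type*} {Λ : Lattice V E} [Fintype E]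

theorem cornerGauge_subset_bulkGauge {G : Type*} [Group G] {u : V → G}
    (hu : u ∈ Λ.cornerGauge G) : u ∈ Λ.bulkGauge G := fun v hv =>
  hu v fun h => Finset.disjoint_left.1 Λ.corner_disjoint_bdry h hv

theorem offCornerGauge_subset_bulkGauge {G : Type*} [Group G] {u : V → G}
    (hu : u ∈ Λ.offCornerGauge G) : u ∈ Λ.bulkGauge G := fun v hv => hu v (Or.inl hv)

/-- The part of a gauge transformation at the interior vertices of the region. -/
def interiorPart {G : Type*} [Group G] (Λ : Lattice V E) (h : V → G) (v : V) : G :=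
  if v ∈ Λ.interior then h v else 1

/-- On links of the region the interior part of h acts as h does when h is trivial on the corner;
exterior links it leaves alone, as all edges at interior vertices belong to the region. So
invariance of a physical state passes to its fibres. -/
theorem interiorPart_mem {G : Type*} [Group G] (h : V → G) :
    Λ.interiorPart h ∈ Λ.offCornerGauge G := by
  rintro v (hv | hv)
  · exact if_neg fun hi => Finset.disjoint_left.1 Λ.interior_disjoint_bdry hi hv
  · exact if_neg fun hi => Finset.disjoint_left.1 Λ.interior_disjoint_corner hi hv

theorem interiorPart_tgt {G : Type*} [Group G] {h : V → G} (hh : h ∈ Λ.offCornerGauge G) {e : E}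
    (he : e ∈ Λ.region) : Λ.interiorPart h (Λ.tgt e) = h (Λ.tgt e) := by
  unfold interiorPart
  split_ifs with hi
  · rfl
  · exact (hh _ (Or.inr ((Λ.region_ends e he).2.resolve_left hi))).symm

theorem interiorPart_src {G : Type*} [Group G] {h : V → G} (hh : h ∈ Λ.offCornerGauge G) {e : E}
    (he : e ∈ Λ.region) : Λ.interiorPart h (Λ.src e) = h (Λ.src e) := by
  unfold interiorPart
  split_ifs with hi
  · rfl
  · exact (hh _ (Or.inr ((Λ.region_ends e he).1.resolve_left hi))).symm

theorem interiorPart_tgt_of_notMem {G : Type*} [Group G] (h : V → G) {e : E}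
    (he : e ∉ Λ.region) : Λ.interiorPart h (Λ.tgt e) = 1 :=
  if_neg fun hi => he (Λ.mem_region_of_interior e (Or.inr hi))

theorem interiorPart_src_of_notMem {G : Type*} [Group G] (h : V → G) {e : E}
    (he : e ∉ Λ.region) : Λ.interiorPart h (Λ.src e) = 1 :=
  if_neg fun hi => he (Λ.mem_region_of_interior e (Or.inl hi))

variable {G : Type*} [Group G]

namespace IntrinsicFrame

variable (F : Λ.IntrinsicFrame) (g : V → G)

theorem mem_regionEdges {e : E} : e ∈ F.regionEdges ↔ e ∈ Λ.region ∧ e ∉ F.tree := by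
  rw [regionEdges, Finset.mem_sdiff]

/-- The configuration in which the frame is in the orientation `g`, with given values on the
remaining edges of the region and outside of the region. -/
def config (x : F.regionEdges → G) (z : E → G) (e : E) : G :=
  if e ∈ F.tree then g (Λ.tgt e) * (g (Λ.src e))⁻¹
  else if h : e ∈ F.regionEdges then x ⟨e, h⟩ else z e

theorem config_tree (x : F.regionEdges → G) (z : E → G) {e : E} (he : e ∈ F.tree) :
    F.config g x z e = g (Λ.tgt e) * (g (Λ.src e))⁻¹ := if_pos he

theorem config_regionEdges (x : F.regionEdges → G) (z : E → G) (e : F.regionEdges) :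
    F.config g x z e = x e := by
  rw [config, if_neg (F.mem_regionEdges.1 e.2).2, dif_pos e.2]

theorem config_exterior (x : F.regionEdges → G) (z : E → G) {e : E} (he : e ∉ Λ.region) :
    F.config g x z e = z e := by
  rw [config, if_neg fun h => he (F.tree_subset_region h),
    dif_neg fun h => he (F.mem_regionEdges.1 h).1]

theorem eq_config {c : E → G} {x : F.regionEdges → G} {z : E → G}
    (h1 : ∀ e ∈ F.tree, c e = g (Λ.tgt e) * (g (Λ.src e))⁻¹)
    (h2 : ∀ e : F.regionEdges, c e = x e) (h3 : ∀ e ∉ Λ.region, c e = z e) :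
    c = F.config g x z := by
  ext e
  by_cases he : e ∈ F.tree
  · rw [h1 e he, config_tree _ _ _ _ he]
  · by_cases hr : e ∈ Λ.region
    · have hS : e ∈ F.regionEdges := F.mem_regionEdges.2 ⟨hr, he⟩
      rw [h2 ⟨e, hS⟩, ← F.config_regionEdges g x z ⟨e, hS⟩]
    · rw [h3 e hr, config_exterior _ _ _ _ hr]

theorem hol_config (hg : F.IsOrientation g) (x : F.regionEdges → G) (z : E → G) {v : V}
    (hv : v ∈ Λ.corner) : hol (F.config g x z) (F.line v) = g v := by
  rw [F.hol_of_coboundary (u := g) (fun e he => F.config_tree g x z he) hv,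
    show g F.root = 1 from hg, inv_one, mul_one]

theorem dressing_config (hg : F.IsOrientation g) (x : F.regionEdges → G) (z : E → G) :
    Λ.dressing F.line g (F.config g x z) = 1 := by
  ext v
  unfold dressing
  split_ifs with hv
  · rw [F.hol_config g hg x z hv, mul_inv_cancel, Pi.one_apply]
  · rfl

/-- The dressing transformation, applied to the configuration that it depends on. -/
theorem gaugeConfig_dressing [Finite G] (c : E → G) :
    Λ.gaugeConfig id (Λ.dressing F.line g c) c =
      F.config g (fun e => Λ.gaugeConfig id (Λ.dressing F.line g c) c e)
        (Λ.gaugeConfig id (Λ.dressing F.line g c) c) := by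
  refine F.eq_config g (fun e he => ?_) (fun e => rfl) fun e he => rfl
  rw [gaugeConfig, id, F.tree_eq c he]
  simp only [dressing, if_pos (F.tgt_mem_corner he), if_pos (F.src_mem_corner he)]
  group

theorem isotropy_subset_cornerGauge {u : V → G} (hu : u ∈ F.isotropy g) :
    u ∈ Λ.cornerGauge G := by
  obtain ⟨h, hu⟩ := hu
  intro v hv
  rw [hu, if_neg hv]

/-- The tree values g_tgt g_src⁻¹ survive: transformations trivial on the corner do not touch them,
and for g_v k g_v⁻¹ the two factors k cancel. -/
theorem gaugeConfig_config {h : V → G} (hh : h ∈ Λ.offCornerGauge G ∪ F.isotropy g)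
    (x : F.regionEdges → G) (z : E → G) :
    Λ.gaugeConfig id h (F.config g x z) = F.config g
      (Λ.gaugeConfig (fun e : F.regionEdges => (e : E)) h x) (Λ.gaugeConfig id h z) := by
  refine F.eq_config g (fun e he => ?_) (fun e => ?_) fun e he => ?_
  · rw [gaugeConfig, id, F.config_tree g x z he]
    rcases hh with hh | ⟨k, hk⟩
    · rw [hh _ (Or.inr (F.tgt_mem_corner he)), hh _ (Or.inr (F.src_mem_corner he))]
      group
    · rw [hk, hk, if_pos (F.tgt_mem_corner he), if_pos (F.src_mem_corner he)]
      group
  · rw [gaugeConfig, id, F.config_regionEdges g x z]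
    rfl
  · rw [gaugeConfig, id, F.config_exterior g x z he]
    rfl

variable [TopologicalSpace G] [IsTopologicalGroup G] [CompactSpace G]
  [T2Space G] [SecondCountableTopology G] [MeasurableSpace G] [BorelSpace G] [Finite G]

theorem apply_eq_apply_config (ψ : Λ.Hphys G) (c : E → G) :
    (ψ : L2 G E) c = (ψ : L2 G E)
      (F.config g (fun e => Λ.gaugeConfig id (Λ.dressing F.line g c) c e)
        (Λ.gaugeConfig id (Λ.dressing F.line g c) c)) := by
  rw [← gaugeConfig_dressing, apply_gaugeConfig ψ.2]
  exact cornerGauge_subset_bulkGauge fun v hv => by rw [dressing, if_neg hv]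

/-- A physical state in the perspective of the frame, as a wave function of the remaining links of
the region for given values of the links outside of the region. -/
def fiber (ψ : Λ.Hphys G) (z : E → G) : Λ.HRegion G F.regionEdges :=
  ⟨ofFun fun x => (ψ : L2 G E) (F.config g x z), mem_invariants_of_forall _ fun h hh x => by
    rw [ofFun_apply, ofFun_apply, ← apply_gaugeConfig ψ.2
      (offCornerGauge_subset_bulkGauge (interiorPart_mem h)) (F.config g x z)]
    congr 1
    rw [gaugeConfig_config _ _ (Or.inl (interiorPart_mem h))]
    refine F.eq_config g (fun e he => F.config_tree _ _ _ he)
      (fun e => (F.config_regionEdges _ _ _ e).trans ?_)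
      fun e he => (F.config_exterior _ _ _ he).trans ?_
    · have he := (F.mem_regionEdges.1 e.2).1
      rw [gaugeConfig, gaugeConfig, interiorPart_tgt hh he, interiorPart_src hh he]
    · rw [gaugeConfig, id, interiorPart_tgt_of_notMem h he, interiorPart_src_of_notMem h he]
      simp⟩

theorem fiber_apply (ψ : Λ.Hphys G) (z : E → G) (x : F.regionEdges → G) :
    (F.fiber g ψ z : L2 G F.regionEdges) x = (ψ : L2 G E) (F.config g x z) := ofFun_apply _ _

theorem fiber_congr (ψ : Λ.Hphys G) {z z' : E → G} (h : ∀ e ∉ Λ.region, z e = z' e) :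
    F.fiber g ψ z = F.fiber g ψ z' := by
  refine Subtype.ext (L2_ext fun x => ?_)
  rw [fiber_apply, fiber_apply]
  congr 1
  exact F.eq_config g (fun e he => F.config_tree _ _ _ he) (F.config_regionEdges g x z)
    fun e he => (F.config_exterior _ _ _ he).trans (h e he)

/-- The extension of a configuration of the links outside the tree. -/
def extendConfig (y : {e : E // e ∉ F.tree} → G) : E → G :=
  F.config g (fun e => y ⟨e, F.notMem_tree e e.2⟩) fun e => if he : e ∈ F.tree then 1 else y ⟨e, he⟩

theorem extendConfig_apply (y : {e : E // e ∉ F.tree} → G) (e : {e : E // e ∉ F.tree}) :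
    F.extendConfig g y e = y e := by
  by_cases hr : (e : E) ∈ Λ.region
  · exact F.config_regionEdges g _ _ ⟨e, F.mem_regionEdges.2 ⟨hr, e.2⟩⟩
  · rw [extendConfig, config_exterior _ _ _ _ hr, dif_neg e.2]

theorem extendConfig_tree (y : {e : E // e ∉ F.tree} → G) {e : E} (he : e ∈ F.tree) :
    F.extendConfig g y e = g (Λ.tgt e) * (g (Λ.src e))⁻¹ := F.config_tree g _ _ he

theorem eq_extendConfig {c : E → G} {y : {e : E // e ∉ F.tree} → G}
    (h1 : ∀ e ∈ F.tree, c e = g (Λ.tgt e) * (g (Λ.src e))⁻¹)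
    (h2 : ∀ e : {e : E // e ∉ F.tree}, c e = y e) : c = F.extendConfig g y := by
  ext e
  by_cases he : e ∈ F.tree
  · rw [h1 e he, extendConfig_tree _ _ _ he]
  · rw [h2 ⟨e, he⟩, ← F.extendConfig_apply g y ⟨e, he⟩]

/-- The reduction of a physical state to the perspective of the frame. -/
def reduction (ψ : Λ.Hphys G) : Λ.HPersp F.tree (F.isotropy g) :=
  ⟨ofFun fun y => (ψ : L2 G E) (F.extendConfig g y), mem_invariants_of_forall _ fun h hh y => by
    have hb : h ∈ Λ.bulkGauge G := by
      rcases hh with hh | hh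
      · exact offCornerGauge_subset_bulkGauge hh
      · exact cornerGauge_subset_bulkGauge (F.isotropy_subset_cornerGauge g hh)
    rw [ofFun_apply, ofFun_apply, ← apply_gaugeConfig ψ.2 hb (F.extendConfig g y)]
    congr 1
    refine (F.eq_extendConfig g (fun e he => ?_) fun e => ?_).symm
    · rw [extendConfig, gaugeConfig_config _ _ hh, config_tree _ _ _ _ he]
    · rw [gaugeConfig, id, extendConfig_apply]
      rfl⟩

theorem reduction_apply (ψ : Λ.Hphys G) (y : {e : E // e ∉ F.tree} → G) :
    (F.reduction g ψ : L2 G {e : E // e ∉ F.tree}) y = (ψ : L2 G E) (F.extendConfig g y) :=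
  ofFun_apply _ _

/-- Uniqueness: dressing is trivial at configurations already in orientation g, and these exhaust
the arguments of χ. Existence: gauge invariance carries every configuration to one of these. -/
theorem isReduction_iff (hg : F.IsOrientation g) (ψ : Λ.Hphys G)
    (χ : L2 G {e : E // e ∉ F.tree}) :
    Λ.IsReduction F.line F.tree g ψ χ ↔ χ = F.reduction g ψ := by
  unfold IsReduction
  rw [ae_eq_iff_of_finite]
  constructor
  · intro h
    refine L2_ext fun y => ?_
    rw [reduction_apply, congrFun h]
    congr 1
    ext e
    rw [dressed, extendConfig, F.dressing_config g hg, ← extendConfig, extendConfig_apply]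
    simp
  · rintro rfl
    ext c
    rw [reduction_apply, F.apply_eq_apply_config g ψ c, ← gaugeConfig_dressing]
    congr 1
    refine F.eq_extendConfig g (fun e he => ?_) fun e => rfl
    rw [gaugeConfig_dressing, config_tree _ _ _ _ he]

theorem represents_iff (hg : F.IsOrientation g) (T : Λ.Hphys G →L[ℂ] Λ.Hphys G)
    (A : Λ.HRegion G F.regionEdges →L[ℂ] Λ.HRegion G F.regionEdges) :
    F.Represents g T A ↔
      (∀ u ∈ F.isotropy g, ∀ f f' : Λ.HRegion G F.regionEdges,
        (f' : L2 G F.regionEdges) = Λ.gauge (fun e : F.regionEdges => (e : E)) u f →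
        (A f' : L2 G F.regionEdges) = Λ.gauge (fun e : F.regionEdges => (e : E)) u (A f)) ∧
      ∀ ψ z, F.fiber g (T ψ) z = A (F.fiber g ψ z) := by
  have hb := bijective_elim_sub F.notMem_tree
  -- The default value 1 is harmless, as fibres depend only on the links outside the region.
  let Z : ({e : E // e ∉ F.regionEdges ∧ e ∉ F.tree} → G) → E → G := fun z e =>
    if h : e ∉ F.regionEdges ∧ e ∉ F.tree then z ⟨e, h⟩ else 1
  have hZ : ∀ z e (h : e ∉ F.regionEdges ∧ e ∉ F.tree), Z z e = z ⟨e, h⟩ := fun z e h => by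
    simp only [Z]
    rw [dif_pos h]
  have hglue : ∀ x z, F.extendConfig g (glue hb x z) = F.config g x (Z z) := by
    intro x z
    refine F.eq_config g (fun e he => F.extendConfig_tree g _ he) (fun e => ?_) fun e he => ?_
    · exact (F.extendConfig_apply g _ ⟨e, F.notMem_tree e e.2⟩).trans (glue_left hb x z e)
    · have he' : e ∉ F.regionEdges ∧ e ∉ F.tree :=
        ⟨fun h => he (F.mem_regionEdges.1 h).1, fun h => he (F.tree_subset_region h)⟩
      refine (F.extendConfig_apply g _ ⟨e, he'.2⟩).trans ((glue_right hb x z ⟨e, he'⟩).trans ?_)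
      exact (hZ z e he').symm
  have hsl : ∀ ψ z, (ofFun fun x => (F.reduction g ψ : L2 G {e : E // e ∉ F.tree}) (glue hb x z)) =
      (F.fiber g ψ (Z z) : L2 G F.regionEdges) := by
    intro ψ z
    refine L2_ext fun x => ?_
    rw [ofFun_apply, reduction_apply, hglue, fiber_apply]
  have hact : ∀ ψ ψ' : Λ.Hphys G, ActsAs (fun e : F.regionEdges =>
        (⟨e, F.notMem_tree e e.2⟩ : {e : E // e ∉ F.tree}))
      (fun e : {e : E // e ∉ F.regionEdges ∧ e ∉ F.tree} => (⟨e, e.2.2⟩ : {e : E // e ∉ F.tree}))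
      (Λ.HRegion G F.regionEdges) A (F.reduction g ψ) (F.reduction g ψ') ↔
      ∀ z, F.fiber g ψ' z = A (F.fiber g ψ z) := by
    intro ψ ψ'
    rw [actsAs_iff_forall_slice hb _ _ _ _ (fun z => by rw [hsl]; exact (F.fiber g ψ (Z z)).2)
      (fun z => by rw [hsl]; exact (F.fiber g ψ' (Z z)).2)]
    simp_rw [hsl]
    constructor
    · intro h z
      have hz : ∀ e ∉ Λ.region, z e = Z (fun e => z e) e := fun e he =>
        (hZ (fun e => z e) e ⟨fun h => he (F.mem_regionEdges.1 h).1,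
          fun h => he (F.tree_subset_region h)⟩).symm
      rw [F.fiber_congr g ψ hz, F.fiber_congr g ψ' hz]
      exact h fun e => z e
    · exact fun h z => h _
  unfold Represents IsRelational
  refine and_congr_right fun _ => forall_congr' fun ψ => ?_
  constructor
  · rintro ⟨χ, χ', h1, h2, h3⟩
    rw [isReduction_iff F g hg] at h1 h2
    rw [h1, h2] at h3
    exact (hact _ _).1 h3
  · intro h
    exact ⟨F.reduction g ψ, F.reduction g (T ψ), (F.isReduction_iff g hg _ _).2 rfl,
      (F.isReduction_iff g hg _ _).2 rfl, (hact _ _).2 h⟩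

end IntrinsicFrame

end Lattice

end LGT

namespace LGT

/-! ### Characters of a finite Abelian group -/

section Characters

variable {G : Type*} [CommGroup G] [TopologicalSpace G] [DiscreteTopology G] [CompactSpace G]
  [Finite G]

/-- A character as an additive character with complex values. -/
def toAddChar (χ : PontryaginDual G) : AddChar (Additive G) ℂ where
  toFun a := (χ a.toMul : ℂ)
  map_zero_eq_one' := by
    rw [toMul_zero, map_one, Circle.coe_one]
  map_add_eq_mul' a b := by
    rw [toMul_add, map_mul, Circle.coe_mul]

theorem toAddChar_apply (χ : PontryaginDual G) (a : G) :
    toAddChar χ (Additive.ofMul a) = χ a := rfl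

theorem bijective_toAddChar :
    Function.Bijective (toAddChar : PontryaginDual G → AddChar (Additive G) ℂ) := by
  constructor
  · intro χ χ' h
    refine PontryaginDual.ext fun a => Circle.ext ?_
    rw [← toAddChar_apply, ← toAddChar_apply, h]
  · intro θ
    let η := AddChar.circleEquivComplex.symm θ
    let f : G →ₜ* Circle := ⟨⟨⟨fun a => η (Additive.ofMul a), by
      rw [ofMul_one, AddChar.map_zero_eq_one]⟩, fun a b => by
      change η _ = η _ * η _
      rw [ofMul_mul, AddChar.map_add_eq_mul]⟩, continuous_of_discreteTopology⟩
    refine ⟨f, ?_⟩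
    ext a
    rfl

theorem card_pontryaginDual : Fintype.card (PontryaginDual G) = Nat.card G := by
  have := Fintype.ofFinite G
  rw [Fintype.card_of_bijective bijective_toAddChar, AddChar.card_eq, Nat.card_eq_fintype_card]
  exact Fintype.card_congr Additive.toMul

theorem sum_pontryaginDual {a : G} (ha : a ≠ 1) : ∑ χ : PontryaginDual G, (χ a : ℂ) = 0 := by
  classical
  have := Fintype.ofFinite G
  have h : ∑ χ : PontryaginDual G, (χ a : ℂ) =
      ∑ θ : AddChar (Additive G) ℂ, θ (Additive.ofMul a) :=
    Fintype.sum_bijective toAddChar bijective_toAddChar _ _ fun _ => rfl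
  rw [h, AddChar.sum_apply_eq_ite, if_neg]
  rwa [ofMul_eq_zero]

theorem sum_prod_pontryaginDual {κ : Type*} [Fintype κ] [DecidableEq κ] {a : κ → G} {k : κ} (ha : a k ≠ 1) :
    ∑ χ : κ → PontryaginDual G, ∏ k, (χ k (a k) : ℂ) = 0 := by
  rw [← Fintype.piFinset_univ,
    ← Finset.prod_univ_sum (fun _ => Finset.univ) fun k (χ : PontryaginDual G) => (χ (a k) : ℂ)]
  exact Finset.prod_eq_zero (Finset.mem_univ k) (sum_pontryaginDual ha)

end Characters

/-! ### Corner Wilson loops and the dual magnetic twirl. -/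

namespace Lattice

open scoped Classical

variable {V E : Type*} {Λ : Lattice V E} [Fintype E]
variable {G : Type*} [CommGroup G]

namespace IntrinsicFrame

variable (F : Λ.IntrinsicFrame) (g : V → G)

theorem mem_loopEdges {e : E} : e ∈ F.loopEdges ↔ e ∈ Λ.cornerEdges ∧ e ∉ F.tree := by
  rw [loopEdges, Finset.mem_sdiff]

theorem loopEdges_subset {e : E} (he : e ∈ F.loopEdges) : e ∈ F.regionEdges :=
  F.mem_regionEdges.2 ⟨Λ.cornerEdges_subset (F.mem_loopEdges.1 he).1, (F.mem_loopEdges.1 he).2⟩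

theorem tgt_mem_corner_of_loopEdges {e : E} (he : e ∈ F.loopEdges) : Λ.tgt e ∈ Λ.corner :=
  (Λ.cornerEdges_ends e (F.mem_loopEdges.1 he).1).2

theorem src_mem_corner_of_loopEdges {e : E} (he : e ∈ F.loopEdges) : Λ.src e ∈ Λ.corner :=
  (Λ.cornerEdges_ends e (F.mem_loopEdges.1 he).1).1

/-- A gauge transformation conjugates a based loop by its value at the root, which does nothing in
an Abelian group. -/
theorem loopHol_gaugeConfig (h : V → G) (c : E → G) {e : E} (he : e ∈ F.loopEdges) :
    F.loopHol e (Λ.gaugeConfig id h c) = F.loopHol e c := by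
  rw [loopHol, hol_gaugeConfig h c (F.isPath _ (F.tgt_mem_corner_of_loopEdges he)).1,
    hol_gaugeConfig h c (F.isPath _ (F.src_mem_corner_of_loopEdges he)).1, gaugeConfig, id]
  have h1 : ∀ a b d p q r : G, (a * p * d⁻¹)⁻¹ * (a * q * b⁻¹) * (b * r * d⁻¹) =
      d * (p⁻¹ * q * r) * d⁻¹ := by intros; group
  rw [h1, mul_comm, inv_mul_cancel_left, loopHol]

/-- The loop holonomies in the orientation `g` of the frame. -/
def loopVal (x : F.regionEdges → G) (e : F.loopEdges) : G :=
  (g (Λ.tgt e))⁻¹ * x ⟨e, F.loopEdges_subset e.2⟩ * g (Λ.src e)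

theorem loopHol_config (hg : F.IsOrientation g) (x : F.regionEdges → G) (z : E → G)
    (e : F.loopEdges) : F.loopHol e (F.config g x z) = F.loopVal g x e := by
  rw [loopHol, F.hol_config g hg _ _ (F.tgt_mem_corner_of_loopEdges e.2),
    F.hol_config g hg _ _ (F.src_mem_corner_of_loopEdges e.2), loopVal]
  congr 2
  exact F.config_regionEdges g x z ⟨e, F.loopEdges_subset e.2⟩

theorem mem_isotropy_iff {u : V → G} :
    u ∈ F.isotropy g ↔ ∃ k : G, ∀ v, u v = if v ∈ Λ.corner then k else 1 := by
  refine exists_congr fun k => forall_congr' fun v => ?_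
  rw [mul_comm (g v) k, mul_inv_cancel_right]

theorem inv_mem_isotropy {u : V → G} (hu : u ∈ F.isotropy g) : u⁻¹ ∈ F.isotropy g := by
  obtain ⟨k, hk⟩ := (F.mem_isotropy_iff g).1 hu
  refine (F.mem_isotropy_iff g).2 ⟨k⁻¹, fun v => ?_⟩
  rw [Pi.inv_apply, hk]
  split_ifs
  · rfl
  · exact inv_one

theorem loopVal_gaugeConfig {h : V → G} (hh : h ∈ Λ.offCornerGauge G ∪ F.isotropy g)
    (x : F.regionEdges → G) :
    F.loopVal g (Λ.gaugeConfig (fun e : F.regionEdges => (e : E)) h x) = F.loopVal g x := by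
  ext e
  unfold loopVal gaugeConfig
  have h1 := F.tgt_mem_corner_of_loopEdges e.2
  have h2 := F.src_mem_corner_of_loopEdges e.2
  rcases hh with hh | hh
  · simp only [hh _ (Or.inr h1), hh _ (Or.inr h2), one_mul, inv_one, mul_one]
  · obtain ⟨k, hk⟩ := (F.mem_isotropy_iff g).1 hh
    simp only [hk, if_pos h1, if_pos h2, mul_comm k, mul_inv_cancel_right]

variable [TopologicalSpace G] [IsTopologicalGroup G] [CompactSpace G]
  [T2Space G] [SecondCountableTopology G] [MeasurableSpace G] [BorelSpace G] [Finite G]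

/-- The product of characters of the loop holonomies, in the perspective of the frame. -/
def regionCharacter (χ : F.loopEdges → PontryaginDual G) : C(F.regionEdges → G, Circle) where
  toFun x := ∏ e, χ e (F.loopVal g x e)
  continuous_toFun := continuous_of_discreteTopology

theorem regionCharacter_apply (χ : F.loopEdges → PontryaginDual G) (x : F.regionEdges → G) :
    F.regionCharacter g χ x = ∏ e, χ e (F.loopVal g x e) := rfl

theorem regionCharacter_inv_apply (χ : F.loopEdges → PontryaginDual G) (x : F.regionEdges → G) :
    F.regionCharacter g χ⁻¹ x = (F.regionCharacter g χ x)⁻¹ := by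
  rw [regionCharacter_apply, regionCharacter_apply, ← Finset.prod_inv_distrib]
  rfl

theorem loopCharacter_config (hg : F.IsOrientation g) (χ : F.loopEdges → PontryaginDual G)
    (x : F.regionEdges → G) (z : E → G) :
    F.loopCharacter χ (F.config g x z) = F.regionCharacter g χ x := by
  refine Finset.prod_congr rfl fun e _ => ?_
  rw [F.loopHol_config g hg]

theorem loopCharacter_gaugeConfig (χ : F.loopEdges → PontryaginDual G) (h : V → G) (c : E → G) :
    F.loopCharacter χ (Λ.gaugeConfig id h c) = F.loopCharacter χ c := by
  refine Finset.prod_congr rfl fun e _ => ?_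
  rw [F.loopHol_gaugeConfig h c e.2]

/-- Corner Wilson loops on physical states. -/
def wilsonPhys (χ : F.loopEdges → PontryaginDual G) (ψ : Λ.Hphys G) : Λ.Hphys G :=
  ⟨F.wilsonLoop χ ψ, mem_invariants_of_forall _ fun h hh c => by
    rw [wilsonLoop, phaseMul_apply, phaseMul_apply, loopCharacter_gaugeConfig,
      apply_gaugeConfig ψ.2 hh]⟩

theorem coe_wilsonPhys (χ : F.loopEdges → PontryaginDual G) (ψ : Λ.Hphys G) :
    (F.wilsonPhys χ ψ : L2 G E) = F.wilsonLoop χ ψ := rfl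

theorem phaseMul_regionCharacter_mem (χ : F.loopEdges → PontryaginDual G)
    (f : Λ.HRegion G F.regionEdges) :
    phaseMul (F.regionCharacter g χ) (f : L2 G F.regionEdges) ∈ Λ.HRegion G F.regionEdges :=
  mem_invariants_of_forall _ fun h hh x => by
    rw [phaseMul_apply, phaseMul_apply, regionCharacter_apply, regionCharacter_apply,
      F.loopVal_gaugeConfig g (Or.inl hh), apply_gaugeConfig f.2 hh]

theorem phaseMul_regionCharacter_inv (χ : F.loopEdges → PontryaginDual G)
    (f : L2 G F.regionEdges) :
    phaseMul (F.regionCharacter g χ⁻¹) (phaseMul (F.regionCharacter g χ) f) = f := by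
  refine L2_ext fun x => ?_
  rw [phaseMul_apply, phaseMul_apply, regionCharacter_inv_apply, ← mul_assoc, ← Circle.coe_mul,
    inv_mul_cancel, Circle.coe_one, one_mul]

/-- Corner Wilson loops in the perspective of the frame. -/
def characterIso (χ : F.loopEdges → PontryaginDual G) :
    Λ.HRegion G F.regionEdges ≃ₗᵢ[ℂ] Λ.HRegion G F.regionEdges where
  toFun f := ⟨_, F.phaseMul_regionCharacter_mem g χ f⟩
  invFun f := ⟨_, F.phaseMul_regionCharacter_mem g χ⁻¹ f⟩
  map_add' _ _ := Subtype.ext (map_add (phaseMul _) _ _)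
  map_smul' z _ := Subtype.ext (map_smul (phaseMul _) z _)
  left_inv f := Subtype.ext (F.phaseMul_regionCharacter_inv g χ f)
  right_inv f := Subtype.ext (by
    have h := F.phaseMul_regionCharacter_inv g χ⁻¹ f
    rwa [inv_inv] at h)
  norm_map' f := (phaseMul (F.regionCharacter g χ)).norm_map f

theorem characterIso_apply (χ : F.loopEdges → PontryaginDual G) (f : Λ.HRegion G F.regionEdges)
    (x : F.regionEdges → G) :
    (F.characterIso g χ f : L2 G F.regionEdges) x =
      F.regionCharacter g χ x * (f : L2 G F.regionEdges) x := phaseMul_apply _ _ _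

theorem characterIso_symm (χ : F.loopEdges → PontryaginDual G) :
    (F.characterIso g χ).symm = F.characterIso g χ⁻¹ :=
  LinearIsometryEquiv.ext fun _ => rfl

theorem fiber_wilsonPhys (hg : F.IsOrientation g) (χ : F.loopEdges → PontryaginDual G)
    (ψ : Λ.Hphys G) (z : E → G) :
    F.fiber g (F.wilsonPhys χ ψ) z = F.characterIso g χ (F.fiber g ψ z) := by
  refine Subtype.ext (L2_ext fun x => ?_)
  rw [fiber_apply, characterIso_apply, fiber_apply, coe_wilsonPhys, wilsonLoop, phaseMul_apply,
    F.loopCharacter_config g hg]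

/-- Wilson loops preserve gauge invariance, so the compression in `toPhys` has no effect. -/
theorem magneticTwirl_apply (T : Λ.Hphys G →L[ℂ] Λ.Hphys G) (ψ : Λ.Hphys G) :
    F.magneticTwirl T ψ = ((Nat.card G : ℂ) ^ F.loopEdges.card)⁻¹ •
      ∑ χ : F.loopEdges → PontryaginDual G, F.wilsonPhys χ (T (F.wilsonPhys χ⁻¹ ψ)) := by
  rw [magneticTwirl, finsum_eq_sum_of_fintype, smul_apply,
    sum_apply]
  congr 1
  refine Finset.sum_congr rfl fun χ _ => ?_
  change (Λ.Hphys G).orthogonalProjectionOnto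
    (F.wilsonLoop χ (Λ.toKin T (F.wilsonPhys χ⁻¹ ψ : L2 G E))) = _
  rw [ExtrinsicFrame.toKin_coe]
  exact Submodule.orthogonalProjectionOnto_mem_subspace_eq_self
    (F.wilsonPhys χ (T (F.wilsonPhys χ⁻¹ ψ)))

/-- The average of an operator over the conjugates by corner Wilson loops, in the perspective of
the frame. -/
def regionTwirl (A : Λ.HRegion G F.regionEdges →L[ℂ] Λ.HRegion G F.regionEdges) :
    Λ.HRegion G F.regionEdges →L[ℂ] Λ.HRegion G F.regionEdges :=
  ((Nat.card G : ℂ) ^ F.loopEdges.card)⁻¹ • ∑ χ : F.loopEdges → PontryaginDual G,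
    (F.characterIso g χ).toContinuousLinearEquiv.toContinuousLinearMap ∘L A ∘L
      (F.characterIso g χ).symm.toContinuousLinearEquiv.toContinuousLinearMap

theorem regionTwirl_apply (A : Λ.HRegion G F.regionEdges →L[ℂ] Λ.HRegion G F.regionEdges)
    (f : Λ.HRegion G F.regionEdges) :
    F.regionTwirl g A f = ((Nat.card G : ℂ) ^ F.loopEdges.card)⁻¹ •
      ∑ χ : F.loopEdges → PontryaginDual G,
        F.characterIso g χ (A ((F.characterIso g χ).symm f)) := by
  rw [regionTwirl, smul_apply, sum_apply]
  rfl

theorem fiber_smul_sum {α : Type*} (s : Finset α) (a : ℂ) (ψ : α → Λ.Hphys G) (z : E → G) :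
    F.fiber g (a • ∑ i ∈ s, ψ i) z = a • ∑ i ∈ s, F.fiber g (ψ i) z := by
  refine Subtype.ext (L2_ext fun x => ?_)
  rw [fiber_apply, Submodule.coe_smul, Submodule.coe_smul, Submodule.coe_sum, Submodule.coe_sum,
    L2_smul_apply, L2_smul_apply, L2_sum_apply, L2_sum_apply]
  simp_rw [fiber_apply]

theorem characterIso_gauge (χ : F.loopEdges → PontryaginDual G) {u : V → G}
    (hu : u ∈ F.isotropy g) {f f' : Λ.HRegion G F.regionEdges}
    (h : (f' : L2 G F.regionEdges) = Λ.gauge (fun e : F.regionEdges => (e : E)) u f) :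
    (F.characterIso g χ f' : L2 G F.regionEdges) =
      Λ.gauge (fun e : F.regionEdges => (e : E)) u (F.characterIso g χ f : L2 G F.regionEdges) := by
  refine L2_ext fun x => ?_
  rw [characterIso_apply, h, gauge_apply, gauge_apply, characterIso_apply, regionCharacter_apply,
    regionCharacter_apply, F.loopVal_gaugeConfig g (Or.inr (F.inv_mem_isotropy g hu))]

variable {g} in
theorem represents_magneticTwirl (hg : F.IsOrientation g) {T : Λ.Hphys G →L[ℂ] Λ.Hphys G}
    {A : Λ.HRegion G F.regionEdges →L[ℂ] Λ.HRegion G F.regionEdges} (h : F.Represents g T A) :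
    F.Represents g (F.magneticTwirl T) (F.regionTwirl g A) := by
  rw [F.represents_iff g hg] at h ⊢
  refine ⟨fun u hu f f' hf => ?_, fun ψ z => ?_⟩
  · rw [regionTwirl_apply, regionTwirl_apply, Submodule.coe_smul, Submodule.coe_smul,
      Submodule.coe_sum, Submodule.coe_sum, map_smul, map_sum]
    congr 1
    refine Finset.sum_congr rfl fun χ _ => F.characterIso_gauge g χ hu (h.1 u hu _ _ ?_)
    rw [characterIso_symm]
    exact F.characterIso_gauge g χ⁻¹ hu hf
  · rw [magneticTwirl_apply, fiber_smul_sum, regionTwirl_apply]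
    congr 1
    refine Finset.sum_congr rfl fun χ _ => ?_
    rw [F.fiber_wilsonPhys g hg, h.2, F.fiber_wilsonPhys g hg, characterIso_symm]

theorem isDensity_regionTwirl {A : Λ.HRegion G F.regionEdges →L[ℂ] Λ.HRegion G F.regionEdges}
    (hA : QEntropy.IsDensity A) :
    QEntropy.IsDensity (F.regionTwirl g A) ∧
      QEntropy.vonNeumannEntropy A ≤ QEntropy.vonNeumannEntropy (F.regionTwirl g A) := by
  let _ : MeasurableSpace (F.loopEdges → PontryaginDual G) := ⊤
  have hK : TopologicalSpace.SeparableSpace (Λ.HRegion G F.regionEdges) :=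
    (TopologicalSpace.IsSeparable.of_separableSpace
      (Λ.HRegion G F.regionEdges : Set (L2 G F.regionEdges))).separableSpace
  refine QEntropy.isDensity_twirl
    (P := (PMF.uniformOfFintype (F.loopEdges → PontryaginDual G)).toMeasure)
    (W := fun χ => (F.characterIso g χ).symm)
    (fun f => StronglyMeasurable.of_discrete.aestronglyMeasurable) hA fun f => ?_
  rw [PMF.integral_eq_sum, regionTwirl_apply]
  refine (inner_smul_right (𝕜 := ℂ) f _ _).trans ?_
  rw [inner_sum, Finset.mul_sum]
  refine Finset.sum_congr rfl fun χ _ => ?_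
  -- There are |G|^|C| families of characters, so the twirl is the mean for the uniform
  -- distribution.
  rw [PMF.uniformOfFintype_apply, Fintype.card_fun, card_pontryaginDual, Fintype.card_coe]
  have h1 : ⟪(F.characterIso g χ).symm f, A ((F.characterIso g χ).symm f)⟫_ℂ =
      ⟪f, F.characterIso g χ (A ((F.characterIso g χ).symm f))⟫_ℂ := by
    rw [← (F.characterIso g χ).inner_map_map, LinearIsometryEquiv.apply_symm_apply]
  rw [h1, Complex.real_smul]
  congr 1
  simp

theorem regionCharacter_mul_inv (χ : F.loopEdges → PontryaginDual G) (a x : F.regionEdges → G) :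
    (F.regionCharacter g χ a * F.regionCharacter g χ⁻¹ x : ℂ) =
      ∏ e, (χ e (F.loopVal g a e * (F.loopVal g x e)⁻¹) : ℂ) := by
  rw [regionCharacter_inv_apply, ← Circle.coe_mul, regionCharacter_apply, regionCharacter_apply,
    ← Finset.prod_inv_distrib, ← Finset.prod_mul_distrib]
  refine (map_prod Circle.coeHom _ _).trans (Finset.prod_congr rfl fun e _ => ?_)
  rw [map_mul (χ e), map_inv (χ e)]
  rfl

theorem sum_regionCharacter_mul_inv {a x : F.regionEdges → G} (h : F.loopVal g x ≠ F.loopVal g a) :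
    ∑ χ : F.loopEdges → PontryaginDual G,
      (F.regionCharacter g χ a * F.regionCharacter g χ⁻¹ x : ℂ) = 0 := by
  obtain ⟨e, he⟩ := Function.ne_iff.1 h
  have h2 : F.loopVal g a e * (F.loopVal g x e)⁻¹ ≠ 1 := fun h => he (mul_inv_eq_one.1 h).symm
  refine (Finset.sum_congr rfl fun χ _ => F.regionCharacter_mul_inv g χ a x).trans ?_
  exact sum_prod_pontryaginDual (a := fun e => F.loopVal g a e * (F.loopVal g x e)⁻¹) h2

/-- Up to normalization, the sum over χ restricts f to the configurations with the loop values of a,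
by orthogonality of characters. -/
theorem sum_smul_characterIso_symm {f : Λ.HRegion G F.regionEdges} {a : F.regionEdges → G}
    (h : ∀ x, F.loopVal g x = F.loopVal g a → (f : L2 G F.regionEdges) x = 0) :
    ∑ χ : F.loopEdges → PontryaginDual G,
      (F.regionCharacter g χ a : ℂ) • (F.characterIso g χ).symm f = 0 := by
  refine Subtype.ext (L2_ext fun x => ?_)
  rw [Submodule.coe_sum, L2_sum_apply, Submodule.coe_zero, L2_zero_apply]
  have h1 : ∀ χ : F.loopEdges → PontryaginDual G,
      (((F.regionCharacter g χ a : ℂ) • (F.characterIso g χ).symm f :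
        Λ.HRegion G F.regionEdges) : L2 G F.regionEdges) x =
      (F.regionCharacter g χ a * F.regionCharacter g χ⁻¹ x : ℂ) * (f : L2 G F.regionEdges) x := by
    intro χ
    rw [Submodule.coe_smul, L2_smul_apply, characterIso_symm, characterIso_apply, ← mul_assoc]
  rw [Finset.sum_congr rfl fun χ _ => h1 χ, ← Finset.sum_mul]
  by_cases hx : F.loopVal g x = F.loopVal g a
  · rw [h x hx, mul_zero]
  · rw [F.sum_regionCharacter_mul_inv g hx, zero_mul]

theorem coe_regionTwirl_apply (A : Λ.HRegion G F.regionEdges →L[ℂ] Λ.HRegion G F.regionEdges)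
    (f : Λ.HRegion G F.regionEdges) (a : F.regionEdges → G) :
    (F.regionTwirl g A f : L2 G F.regionEdges) a = ((Nat.card G : ℂ) ^ F.loopEdges.card)⁻¹ *
      (A (∑ χ : F.loopEdges → PontryaginDual G,
        (F.regionCharacter g χ a : ℂ) • (F.characterIso g χ).symm f) : L2 G F.regionEdges) a := by
  rw [regionTwirl_apply, Submodule.coe_smul, L2_smul_apply, Submodule.coe_sum, L2_sum_apply,
    map_sum, Submodule.coe_sum, L2_sum_apply]
  congr 1
  refine Finset.sum_congr rfl fun χ _ => ?_
  rw [characterIso_apply, map_smul, Submodule.coe_smul, L2_smul_apply]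

/-- The twirled operator is local in the loop holonomies. -/
theorem regionTwirl_congr (A : Λ.HRegion G F.regionEdges →L[ℂ] Λ.HRegion G F.regionEdges)
    {f f' : Λ.HRegion G F.regionEdges} {a : F.regionEdges → G}
    (h : ∀ x, F.loopVal g x = F.loopVal g a →
      (f : L2 G F.regionEdges) x = (f' : L2 G F.regionEdges) x) :
    (F.regionTwirl g A f : L2 G F.regionEdges) a =
      (F.regionTwirl g A f' : L2 G F.regionEdges) a := by
  have h2 : ∀ x, ((f - f' : Λ.HRegion G F.regionEdges) : L2 G F.regionEdges) x =
      (f : L2 G F.regionEdges) x - (f' : L2 G F.regionEdges) x := fun x => by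
    rw [← evalAt_apply, Submodule.coe_sub, map_sub, evalAt_apply, evalAt_apply]
  have h0 : (F.regionTwirl g A (f - f') : L2 G F.regionEdges) a = 0 := by
    rw [coe_regionTwirl_apply, F.sum_smul_characterIso_symm g fun x hx => by
      rw [h2, h x hx, sub_self], map_zero, Submodule.coe_zero, L2_zero_apply, mul_zero]
  rw [map_sub, Submodule.coe_sub, ← evalAt_apply, map_sub, sub_eq_zero] at h0
  exact h0

end IntrinsicFrame

end Lattice

end LGT

/-! ### Change of intrinsic frame and the magnetic center. -/

namespace LGT

namespace Lattice

open scoped Classical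

variable {V E : Type*} {Λ : Lattice V E} [Fintype E]
variable {G : Type*} [CommGroup G]

theorem gaugeConfig_comm {κ : Type*} (i : κ → E) (h h' : V → G) (c : κ → G) :
    Λ.gaugeConfig i h (Λ.gaugeConfig i h' c) = Λ.gaugeConfig i h' (Λ.gaugeConfig i h c) := by
  rw [gaugeConfig_mul, gaugeConfig_mul, mul_comm]

namespace IntrinsicFrame

variable (F F' : Λ.IntrinsicFrame) (g g' : V → G)

theorem dressing_gaugeConfig {h : V → G} (hh : h ∈ Λ.offCornerGauge G ∪ F.isotropy g) (c : E → G) :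
    Λ.dressing F.line g (Λ.gaugeConfig id h c) = Λ.dressing F.line g c := by
  ext v
  unfold dressing
  split_ifs with hv
  · rw [hol_gaugeConfig h c (F.isPath v hv).1]
    rcases hh with hh | hh
    · rw [hh _ (Or.inr hv), hh _ (Or.inr F.root_mem), one_mul, inv_one, mul_one]
    · obtain ⟨k, hk⟩ := (F.mem_isotropy_iff g).1 hh
      rw [hk, hk, if_pos hv, if_pos F.root_mem, mul_comm k, mul_inv_cancel_right]
  · rfl

theorem dressing_congr {c c' : E → G} (h : ∀ e ∈ Λ.region, c e = c' e) :
    Λ.dressing F.line g c = Λ.dressing F.line g c' := by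
  ext v
  unfold dressing
  split_ifs with hv
  · rw [hol_congr fun s hs => h _ (F.tree_subset_region (F.line_tree v hv s hs))]
  · rfl

/-- In an Abelian group conjugation by g drops out: both groups consist of the transformations
constant on the corner. -/
theorem isotropy_eq : F'.isotropy g' = F.isotropy g := by
  ext u
  rw [mem_isotropy_iff, mem_isotropy_iff]

theorem config_congr (x : F.regionEdges → G) (z z' : E → G) {e : E} (he : e ∈ Λ.region) :
    F.config g x z e = F.config g x z' e := by
  unfold config
  split_ifs with h2 h3
  · rfl
  · rfl
  · exact absurd (F.mem_regionEdges.2 ⟨he, h2⟩) h3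

variable [TopologicalSpace G] [IsTopologicalGroup G] [CompactSpace G]
  [T2Space G] [SecondCountableTopology G] [MeasurableSpace G] [BorelSpace G] [Finite G]

/-- The transformation between the perspectives of two frames that are related by the corner gauge
transformation `d`. -/
def changeFrameFun (d : V → G) (f : Λ.HRegion G F'.regionEdges) : Λ.HRegion G F.regionEdges :=
  -- The exterior values 1 are arbitrary, since only links of the region are read.
  ⟨ofFun fun x => (f : L2 G F'.regionEdges) fun e =>
      Λ.gaugeConfig id d⁻¹ (F.config g x 1) e, mem_invariants_of_forall _ fun h hh x => by
    rw [ofFun_apply, ofFun_apply]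
    refine Eq.trans ?_ (apply_gaugeConfig f.2 hh _)
    congr 1
    ext e
    have h1 := F.gaugeConfig_config g (Or.inl hh) x 1
    have he := (F'.mem_regionEdges.1 e.2).1
    change _ = Λ.gaugeConfig id h (Λ.gaugeConfig id d⁻¹ (F.config g x 1)) e
    rw [gaugeConfig_comm, h1]
    unfold gaugeConfig
    simp only [id]
    rw [F.config_congr g _ 1 _ he]⟩

theorem changeFrameFun_apply (d : V → G) (f : Λ.HRegion G F'.regionEdges) (x : F.regionEdges → G) :
    (F.changeFrameFun F' g d f : L2 G F.regionEdges) x =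
      (f : L2 G F'.regionEdges) fun e => Λ.gaugeConfig id d⁻¹ (F.config g x 1) e := ofFun_apply _ _

/-- The linear transformation between the perspectives of two frames. -/
def changeFrame (d : V → G) : Λ.HRegion G F'.regionEdges →ₗ[ℂ] Λ.HRegion G F.regionEdges where
  toFun := F.changeFrameFun F' g d
  map_add' f f' := Subtype.ext (L2_ext fun x => by
    rw [coe_add_apply, changeFrameFun_apply, changeFrameFun_apply, changeFrameFun_apply,
      coe_add_apply])
  map_smul' z f := Subtype.ext (L2_ext fun x => by
    rw [RingHom.id_apply, coe_smul_apply, changeFrameFun_apply, changeFrameFun_apply,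
      coe_smul_apply])

theorem changeFrame_apply (d : V → G) (f : Λ.HRegion G F'.regionEdges) (x : F.regionEdges → G) :
    (F.changeFrame F' g d f : L2 G F.regionEdges) x =
      (f : L2 G F'.regionEdges) fun e => Λ.gaugeConfig id d⁻¹ (F.config g x 1) e := ofFun_apply _ _

theorem changeFrame_gauge (d : V → G) {u : V → G} (hu : u ∈ F.isotropy g)
    {f f' : Λ.HRegion G F'.regionEdges}
    (h : (f' : L2 G F'.regionEdges) = Λ.gauge (fun e : F'.regionEdges => (e : E)) u f) :
    (F.changeFrame F' g d f' : L2 G F.regionEdges) =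
      Λ.gauge (fun e : F.regionEdges => (e : E)) u
        (F.changeFrame F' g d f : L2 G F.regionEdges) := by
  refine L2_ext fun x => ?_
  rw [gauge_apply, changeFrame_apply, changeFrame_apply, h, gauge_apply]
  congr 1
  ext e
  change Λ.gaugeConfig id u⁻¹ (Λ.gaugeConfig id d⁻¹ (F.config g x 1)) e = _
  rw [gaugeConfig_comm, F.gaugeConfig_config g (Or.inr (F.inv_mem_isotropy g hu))]
  unfold gaugeConfig
  simp only [id]
  rw [F.config_congr g _ _ 1 (F'.mem_regionEdges.1 e.2).1]

/-- The configuration of the region in the perspective of the frame `F'`, in the perspective of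
the frame `F`. -/
def changeConfig (y : F'.regionEdges → G) (e : F.regionEdges) : G :=
  Λ.gaugeConfig id (Λ.dressing F.line g (F'.config g' y 1)) (F'.config g' y 1) e

theorem changeConfig_gaugeConfig {h : V → G} (hh : h ∈ Λ.offCornerGauge G ∪ F.isotropy g)
    (y : F'.regionEdges → G) :
    F.changeConfig F' g g' (Λ.gaugeConfig (fun e : F'.regionEdges => (e : E)) h y) =
      Λ.gaugeConfig (fun e : F.regionEdges => (e : E)) h (F.changeConfig F' g g' y) ∧
    Λ.dressing F.line g (F'.config g'
      (Λ.gaugeConfig (fun e : F'.regionEdges => (e : E)) h y) 1) =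
      Λ.dressing F.line g (F'.config g' y 1) := by
  have hh' : h ∈ Λ.offCornerGauge G ∪ F'.isotropy g' := by rwa [F.isotropy_eq F' g g']
  have h1 : ∀ e ∈ Λ.region, F'.config g' (Λ.gaugeConfig (fun e : F'.regionEdges => (e : E)) h y) 1 e
      = Λ.gaugeConfig id h (F'.config g' y 1) e := fun e he => by
    rw [F'.gaugeConfig_config g' hh', F'.config_congr g' _ 1 _ he]
  have h2 : Λ.dressing F.line g (F'.config g'
      (Λ.gaugeConfig (fun e : F'.regionEdges => (e : E)) h y) 1) =
      Λ.dressing F.line g (F'.config g' y 1) := by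
    rw [F.dressing_congr g h1, F.dressing_gaugeConfig g hh]
  refine ⟨?_, h2⟩
  ext e
  unfold changeConfig
  rw [h2]
  have h3 : ∀ d : V → G, Λ.gaugeConfig id d (F'.config g'
      (Λ.gaugeConfig (fun e : F'.regionEdges => (e : E)) h y) 1) e =
      Λ.gaugeConfig id h (Λ.gaugeConfig id d (F'.config g' y 1)) e := by
    intro d
    rw [gaugeConfig_comm, gaugeConfig, id, h1 e (F.mem_regionEdges.1 e.2).1]
    rfl
  rw [h3]
  rfl

/-- An operator in the perspective of the frame `F`, in the perspective of the frame `F'`. -/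
def changeOperator (A : Λ.HRegion G F.regionEdges →L[ℂ] Λ.HRegion G F.regionEdges) :
    Λ.HRegion G F'.regionEdges →ₗ[ℂ] Λ.HRegion G F'.regionEdges where
  -- The dressing from F' to F depends on y; it is frozen at its value for y while A acts. This is a
  -- linear operator for every A, but the agreement with the original observable relies on A being
  -- local in the loop values.
  toFun f := ⟨ofFun fun y => (A (F.changeFrame F' g
      (Λ.dressing F.line g (F'.config g' y 1)) f) : L2 G F.regionEdges)
        (F.changeConfig F' g g' y), mem_invariants_of_forall _ fun h hh y => by
    obtain ⟨h1, h2⟩ := F.changeConfig_gaugeConfig F' g g' (Or.inl hh) y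
    rw [ofFun_apply, ofFun_apply, h1, h2, apply_gaugeConfig (A _).2 hh]⟩
  map_add' f f' := Subtype.ext (L2_ext fun x => by
    rw [Submodule.coe_add, L2_add_apply]
    simp only [ofFun_apply]
    rw [map_add, map_add, Submodule.coe_add, L2_add_apply])
  map_smul' z f := Subtype.ext (L2_ext fun x => by
    rw [RingHom.id_apply, Submodule.coe_smul, L2_smul_apply]
    simp only [ofFun_apply]
    rw [map_smul, map_smul, Submodule.coe_smul, L2_smul_apply])

theorem changeOperator_apply (A : Λ.HRegion G F.regionEdges →L[ℂ] Λ.HRegion G F.regionEdges)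
    (f : Λ.HRegion G F'.regionEdges) (y : F'.regionEdges → G) :
    (F.changeOperator F' g g' A f : L2 G F'.regionEdges) y =
      (A (F.changeFrame F' g (Λ.dressing F.line g (F'.config g' y 1)) f) : L2 G F.regionEdges)
        (F.changeConfig F' g g' y) := ofFun_apply _ _

theorem changeOperator_gauge {A : Λ.HRegion G F.regionEdges →L[ℂ] Λ.HRegion G F.regionEdges}
    (hA : ∀ u ∈ F.isotropy g, ∀ f f' : Λ.HRegion G F.regionEdges,
      (f' : L2 G F.regionEdges) = Λ.gauge (fun e : F.regionEdges => (e : E)) u f →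
      (A f' : L2 G F.regionEdges) = Λ.gauge (fun e : F.regionEdges => (e : E)) u (A f))
    {u : V → G} (hu : u ∈ F.isotropy g) {f f' : Λ.HRegion G F'.regionEdges}
    (h : (f' : L2 G F'.regionEdges) = Λ.gauge (fun e : F'.regionEdges => (e : E)) u f) :
    (F.changeOperator F' g g' A f' : L2 G F'.regionEdges) =
      Λ.gauge (fun e : F'.regionEdges => (e : E)) u
        (F.changeOperator F' g g' A f : L2 G F'.regionEdges) := by
  refine L2_ext fun y => ?_
  obtain ⟨h1, h2⟩ := F.changeConfig_gaugeConfig F' g g' (Or.inr (F.inv_mem_isotropy g hu)) y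
  rw [gauge_apply, changeOperator_apply, changeOperator_apply, h1, h2, ← gauge_apply]
  exact congrArg (fun p : L2 G F.regionEdges => p (F.changeConfig F' g g' y))
    (hA u hu _ _ (F.changeFrame_gauge F' g _ hu h))

theorem fiber_changeConfig (ψ : Λ.Hphys G) (y : F'.regionEdges → G) (z : E → G) :
    (F'.fiber g' ψ z : L2 G F'.regionEdges) y =
      (F.fiber g ψ (Λ.gaugeConfig id (Λ.dressing F.line g (F'.config g' y 1)) z) :
        L2 G F.regionEdges) (F.changeConfig F' g g' y) := by
  have hd : Λ.dressing F.line g (F'.config g' y z) = Λ.dressing F.line g (F'.config g' y 1) :=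
    F.dressing_congr g fun e he => F'.config_congr g' _ _ _ he
  rw [fiber_apply, fiber_apply, F.apply_eq_apply_config g ψ, hd]
  congr 1
  refine F.eq_config g (fun e he => F.config_tree g _ _ he)
    (fun e => (F.config_regionEdges g _ _ e).trans ?_)
    fun e he => (F.config_exterior g _ _ he).trans ?_
  · unfold changeConfig gaugeConfig
    simp only [id]
    rw [F'.config_congr g' y z 1 (F.mem_regionEdges.1 e.2).1]
  · unfold gaugeConfig
    simp only [id]
    rw [F'.config_exterior g' y z he]

/-- If x has the loop values belonging to y, all links of ∂Σ agree with those of the dressed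
configuration of F'. Undoing the frozen dressing then puts the tree of F' back into orientation g',
so the frozen change of frame is correct on this sector. -/
theorem changeFrame_fiber {y : F'.regionEdges → G} {x : F.regionEdges → G}
    (hx : F.loopVal g x = F.loopVal g (F.changeConfig F' g g' y)) (ψ : Λ.Hphys G) (z : E → G) :
    (F.fiber g ψ (Λ.gaugeConfig id (Λ.dressing F.line g (F'.config g' y 1)) z) :
      L2 G F.regionEdges) x =
    (F.changeFrame F' g (Λ.dressing F.line g (F'.config g' y 1)) (F'.fiber g' ψ z) :
      L2 G F.regionEdges) x := by
  set d := Λ.dressing F.line g (F'.config g' y 1) with hd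
  have hdb : d⁻¹ ∈ Λ.bulkGauge G := by
    refine cornerGauge_subset_bulkGauge fun v hv => ?_
    rw [Pi.inv_apply, hd, dressing, if_neg hv, inv_one]
  rw [changeFrame_apply, fiber_apply, fiber_apply, ← apply_gaugeConfig ψ.2 hdb]
  congr 1
  have hc := F.gaugeConfig_dressing g (F'.config g' y 1)
  rw [← hd] at hc
  refine F'.eq_config g' (fun e he => ?_) (fun e => ?_) fun e he => ?_
  · have h1 : F.config g x (Λ.gaugeConfig id d z) e = Λ.gaugeConfig id d (F'.config g' y 1) e := by
      by_cases ht : e ∈ F.tree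
      · rw [hc, F.config_tree g _ _ ht, F.config_tree g _ _ ht]
      -- An edge of the tree of F' outside the tree of F closes a corner loop for F, and the loop
      -- value determines its link.
      · have hl : e ∈ F.loopEdges := F.mem_loopEdges.2 ⟨F'.tree_subset he, ht⟩
        have h2 := congrFun hx ⟨e, hl⟩
        unfold loopVal at h2
        rw [mul_left_inj, mul_right_inj] at h2
        exact (F.config_regionEdges g x _ ⟨e, F.loopEdges_subset hl⟩).trans h2
    have h3 : Λ.gaugeConfig id d⁻¹ (F.config g x (Λ.gaugeConfig id d z)) e =
        Λ.gaugeConfig id d⁻¹ (Λ.gaugeConfig id d (F'.config g' y 1)) e := by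
      unfold gaugeConfig at h1 ⊢
      simp only [id] at h1 ⊢
      rw [h1]
    rw [h3, gaugeConfig_mul, inv_mul_cancel, gaugeConfig_one, F'.config_tree g' _ _ he]
  · unfold gaugeConfig
    simp only [id]
    rw [F.config_congr g x _ 1 (F'.mem_regionEdges.1 e.2).1]
  · have h3 : Λ.gaugeConfig id d⁻¹ (F.config g x (Λ.gaugeConfig id d z)) e =
        Λ.gaugeConfig id d⁻¹ (Λ.gaugeConfig id d z) e := by
      conv_lhs => unfold gaugeConfig
      simp only [id]
      rw [F.config_exterior g x _ he]
      rfl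
    rw [h3, gaugeConfig_mul, inv_mul_cancel, gaugeConfig_one]

variable {g} in
theorem magneticTwirl_mem_magneticCenter (hg : F.IsOrientation g) {T : Λ.Hphys G →L[ℂ] Λ.Hphys G}
    {A : Λ.HRegion G F.regionEdges →L[ℂ] Λ.HRegion G F.regionEdges} (h : F.Represents g T A) :
    F.magneticTwirl T ∈ Λ.magneticCenter G := by
  intro F' g' hg'
  obtain ⟨h1, h2⟩ := (F.represents_iff g hg _ _).1 (F.represents_magneticTwirl hg h)
  refine ⟨(F.changeOperator F' g g' (F.regionTwirl g A)).toContinuousLinearMap,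
    (F'.represents_iff g' hg' _ _).2 ⟨fun u hu f f' hf => ?_, fun ψ z => ?_⟩⟩
  · rw [F.isotropy_eq F' g g'] at hu
    exact F.changeOperator_gauge F' g g' h1 hu hf
  · refine Subtype.ext (L2_ext fun y => ?_)
    rw [LinearMap.coe_toContinuousLinearMap', changeOperator_apply,
      F.fiber_changeConfig F' g g', h2]
    -- The twirled operator sees the fibre only at x with the loop values belonging to y, where the
    -- frozen dressing is the right one.
    exact F.regionTwirl_congr g A fun x hx => F.changeFrame_fiber F' g g' hx ψ z

variable {g} in
/-- The dual magnetic twirl of a state: membership in the magnetic center algebra and in the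
intrinsic relational algebra, and increase of the entropy. -/
theorem exists_magneticTwirl_entropy_le (hg : F.IsOrientation g) {T : Λ.Hphys G →L[ℂ] Λ.Hphys G}
    {A : Λ.HRegion G F.regionEdges →L[ℂ] Λ.HRegion G F.regionEdges} (h : F.Represents g T A)
    (hA : QEntropy.IsDensity A) :
    F.magneticTwirl T ∈ Λ.magneticCenter G ∧
      ∃ AM : Λ.HRegion G F.regionEdges →L[ℂ] Λ.HRegion G F.regionEdges,
        F.Represents g (F.magneticTwirl T) AM ∧ QEntropy.IsDensity AM ∧
        QEntropy.vonNeumannEntropy A ≤ QEntropy.vonNeumannEntropy AM :=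
  ⟨F.magneticTwirl_mem_magneticCenter hg h, F.regionTwirl g A,
    F.represents_magneticTwirl hg h, F.isDensity_regionTwirl g hA⟩

end IntrinsicFrame

end Lattice

end LGT

theorem mainTheorem5 {V E : Type*} [Fintype E] (Λ : LGT.Lattice V E)
    {G : Type*} [Group G] [TopologicalSpace G] [IsTopologicalGroup G] [CompactSpace G] [T2Space G]
    [SecondCountableTopology G] [MeasurableSpace G] [BorelSpace G] :
    (∀ (Φ : Λ.ExtrinsicFrame) (g : V → G) (ρ : Λ.Hphys G →L[ℂ] Λ.Hphys G)
        (A : Λ.HRegion G Λ.region →L[ℂ] Λ.HRegion G Λ.region),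
      Φ.Represents g ρ A → QEntropy.IsDensity A →
      ∃ (ρE : Λ.Hphys G →L[ℂ] Λ.Hphys G)
        (AE : Λ.HRegion G Λ.region →L[ℂ] Λ.HRegion G Λ.region),
        Φ.IsElectricTwirl ρ ρE ∧ ρE ∈ Λ.electricCenter G ∧
        Φ.Represents g ρE AE ∧ QEntropy.IsDensity AE ∧
        QEntropy.vonNeumannEntropy A ≤ QEntropy.vonNeumannEntropy AE) ∧
    (Finite G → (∀ a b : G, a * b = b * a) →
      ∀ (F : Λ.IntrinsicFrame) (g : V → G), F.IsOrientation g →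
      ∀ (ρ : Λ.Hphys G →L[ℂ] Λ.Hphys G)
        (A : Λ.HRegion G F.regionEdges →L[ℂ] Λ.HRegion G F.regionEdges),
      F.Represents g ρ A → QEntropy.IsDensity A →
      F.magneticTwirl ρ ∈ Λ.magneticCenter G ∧
      ∃ AM : Λ.HRegion G F.regionEdges →L[ℂ] Λ.HRegion G F.regionEdges,
        F.Represents g (F.magneticTwirl ρ) AM ∧ QEntropy.IsDensity AM ∧
        QEntropy.vonNeumannEntropy A ≤ QEntropy.vonNeumannEntropy AM) := by
  refine ⟨fun Φ g ρ A hrep hA =>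
    LGT.Lattice.ExtrinsicFrame.exists_electricTwirl_entropy_le Φ g hrep hA, ?_⟩
  intro hfin hcomm F g hg ρ A hrep hA
  -- The commutative structure extends the given group structure, so all spaces and operators stay
  -- the same.
  exact @LGT.Lattice.IntrinsicFrame.exists_magneticTwirl_entropy_le V E Λ _ G
    { (inferInstance : Group G) with mul_comm := hcomm } F g _ _ _ _ _ _ _ hfin hg ρ A hrep hA
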